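/- Let $m_1\ge m_2\ge 2$ and $q\ge 2$ be integers, $\mathcal A_i=\{0,\dots,m_i-1\}$, $\Sigma=(\mathcal A_1\times\mathcal A_2)^{\mathbb N^*}$, $\gamma=\log m_2/\log m_1$ and $L(n)=\lceil n/\gamma\rceil$. Equip $\Sigma$ with the metric $$d\big((x_k,y_k)_k,(u_k,v_k)_k\big)=\max\Big(m_1^{-\min\{k\ge 0:(x_{k+1},y_{k+1})\ne(u_{k+1},v_{k+1})\}},\ m_1^{-\gamma\min\{k\ge 0:\,y_{k+1}\ne v_{k+1}\}}\Big)$$ (a term is $0$ when the sequences compared in it agree) and put $$B_n(x,y)=\{(u,v)\in\Sigma: u_k=x_k\ (1\le k\le n),\ v_k=y_k\ (1\le k\le L(n))\}.$$ Let $\Omega\subset\Sigma$ be closed and nonempty, and $$X_\Omega=\{(x_k,y_k)_k\in\Sigma:\ (x_{iq^\ell},y_{iq^\ell})_{\ell\ge0}\in\Omega\ \text{ for all } i\ge 1 \text{ with } q\nmid i\}.$$ For $u=(x_1,y_1)\cdots(x_p,y_p)\,y_{p+1}\cdots y_{p+\ell}$ let $[u]\subset\Sigma$ be the set of all points whose first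 $p$ letters, and whose next $\ell$ letters in the second coordinate, are those of $u$, and let $\mathrm{Pref}_{p,\ell}(\Omega)$ be the set of all such $u$ with $\Omega\cap[u]\neq\varnothing$. Let $j\ge 0$ be the integer with $q^j\le 1/\gamma<q^{j+1}$. There is a unique function $t:\bigcup_{k\ge1}\mathrm{Pref}_{k,j}(\Omega)\to\big[1,m_2^{2/(\gamma(q-1))}\big]$ such that for all $k\ge 1$ and all $(x_1,y_1)\cdots(x_k,y_k)y_{k+1}\cdots y_{k+j}\in\mathrm{Pref}_{k,j}(\Omega)$ $$t_{(x_1,y_1)\cdots(x_k,y_k)y_{k+1}\cdots y_{k+j}}^{q^{j+1}\gamma}=\sum_{y'_{k+j+1}}\Big(\sum_{x'_{k+1}}t_{(x_1,y_1)\cdots(x_k,y_k)(x'_{k+1},y_{k+1})y_{k+2}\cdots y_{k+j}y'_{k+j+1}}\Big)^{q^j\gamma},$$ where here and below sums run over those letters for which the index of $t$ is in $\mathrm{Pref}_{k+1,j}(\Omega)$, respectively in the relevant $\mathrm{Pref}_{p,j}(\Omega)$ (for $j=0$ the letter $y_{k+1}$ is the summation letter $y'_{k+1}$). Let $$t_\varnothing=\sum_{y'_1}\Big(\sum_{y'_2}\Big(\cdots\Big(\sum_{y'_{j+1}}\Big(\sum_{x'_1}t_{(x'_1,y'_1)y'_2\cdots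 y'_{j+1}}\Big)^{q^j\gamma}\Big)^{1/q}\cdots\Big)^{1/q}\Big)^{1/q}$$ (with $j$ exponents $1/q$). There is a unique Borel probability measure $\mu$ on $\Omega$ (the "optimal" measure) such that for all $k\ge1$ and $u=(x_1,y_1)\cdots(x_k,y_k)y_{k+1}\cdots y_{k+j}\in\mathrm{Pref}_{k,j}(\Omega)$ $$\begin{aligned}\mu([u])={}&\frac{t_{(x_1,y_1)y_2\cdots y_{j+1}}\big(\sum_{x'_1}t_{(x'_1,y_1)y_2\cdots y_{j+1}}\big)^{q^j\gamma-1}}{t_\varnothing}\ \prod_{p=0}^{j-1}S_p(y_1\cdots y_{j-p})^{\frac{1-q}{q}}\\&\cdot\prod_{p=2}^{k}\frac{t_{(x_1,y_1)\cdots(x_p,y_p)y_{p+1}\cdots y_{p+j}}\big(\sum_{x'_p}t_{(x_1,y_1)\cdots(x'_p,y_p)y_{p+1}\cdots y_{p+j}}\big)^{q^j\gamma-1}}{t_{(x_1,y_1)\cdots(x_{p-1},y_{p-1})y_p\cdots y_{p-1+j}}^{q^{j+1}\gamma}},\end{aligned}$$ where $S_0(y_1\cdots y_j)=\sum_{y'_{j+1}}\big(\sum_{x'_1}t_{(x'_1,y_1)y_2\cdots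 y_jy'_{j+1}}\big)^{q^j\gamma}$ (for $j\ge 1$) and $S_{p}(y_1\cdots y_{j-p})=\sum_{y'}S_{p-1}(y_1\cdots y_{j-p}y')^{1/q}$ for $p\ge 1$. There is a unique Borel probability measure $\mathbb P_\mu$ on $\Sigma$ such that for all $n\ge1$ and $(x,y)\in\Sigma$ $$\mathbb P_\mu\big([(x_1,y_1)\cdots(x_n,y_n)]\big)=\prod_{i\le n,\ q\nmid i}\mu\big([(x_i,y_i)(x_{qi},y_{qi})\cdots(x_{q^{r}i},y_{q^{r}i})]\big),\qquad q^{r}i\le n<q^{r+1}i\ \ (r=r(i,n)),$$ and $\mathbb P_\mu(X_\Omega)=1$. With these objects, for every $(x,y)\in X_\Omega$, $$\liminf_{n\to\infty}\frac{-\log_{m_2}\mathbb P_\mu(B_n(x,y))}{L(n)}\le\frac{q-1}{q}\log_{m_2}(t_\varnothing),$$ and the Hausdorff dimension of $X_\Omega$ with respect to $d$ is $$\dim_H(X_\Omega)=\frac{q-1}{q}\log_{m_2}(t_\varnothing).$$ -/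

import Mathlib

open MeasureTheory Filter Topology

noncomputable section

namespace MultCarpet

/-- The ratio `γ = log m₂ / log m₁`. -/
def gam (m₁ m₂ : ℕ) : ℝ := Real.log m₂ / Real.log m₁

/-- The map `L(n) = ⌈n / γ⌉`. -/
def bigL (m₁ m₂ n : ℕ) : ℕ := ⌈(n : ℝ) / gam m₁ m₂⌉₊

/-- The symbolic space `Σ = ({0,…,m₁-1} × {0,…,m₂-1})^{ℕ*}`. Positions are shifted by one:
`z.seq k` is the letter `(x_{k+1}, y_{k+1})`. -/
@[ext]
structure Symb (m₁ m₂ : ℕ) : Type where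
  seq : ℕ → Fin m₁ × Fin m₂

variable {m₁ m₂ : ℕ}

/-- The second coordinates of a point: the projection `π`. -/
def ySeq (z : Symb m₁ m₂) : ℕ → Fin m₂ := fun k => (z.seq k).2

/-- `c ^ (-s * min {k ≥ 0 : a_{k+1} ≠ b_{k+1}})`, and `0` when the two sequences agree. -/
def agreeDist {α : Type} (c s : ℝ) (a b : ℕ → α) : ℝ :=
  open Classical in
  if a = b then 0 else c ^ (-(s * (PiNat.firstDiff (E := fun _ => α) a b : ℝ)))

theorem agreeDist_self {α : Type} (c s : ℝ) (a : ℕ → α) : agreeDist c s a a = 0 := by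
  simp [agreeDist]

theorem agreeDist_comm {α : Type} (c s : ℝ) (a b : ℕ → α) :
    agreeDist c s a b = agreeDist c s b a := by
  by_cases h : a = b
  · subst h; rfl
  · simp only [agreeDist, h, Ne.symm h, if_false, PiNat.firstDiff_comm (E := fun _ => α) a b]

theorem agreeDist_nonneg {α : Type} {c : ℝ} (hc : 0 ≤ c) (s : ℝ) (a b : ℕ → α) :
    0 ≤ agreeDist c s a b := by
  unfold agreeDist
  split_ifs
  · exact le_rfl
  · exact Real.rpow_nonneg hc _

theorem agreeDist_le_max {α : Type} {c s : ℝ} (hc : 1 ≤ c) (hs : 0 ≤ s) (a b d : ℕ → α) :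
    agreeDist c s a d ≤ max (agreeDist c s a b) (agreeDist c s b d) := by
  by_cases hab : a = b
  · subst hab; exact le_max_right _ _
  by_cases hbd : b = d
  · subst hbd; exact le_max_left _ _
  by_cases had : a = d
  · subst had
    rw [agreeDist_self]
    exact le_max_of_le_left (agreeDist_nonneg (by linarith) s _ _)
  have h := PiNat.min_firstDiff_le (E := fun _ => α) a b d had
  simp only [agreeDist, hab, hbd, had, if_false]
  rcases min_le_iff.mp h with h | h
  · refine le_max_of_le_left (Real.rpow_le_rpow_of_exponent_le hc (neg_le_neg ?_))
    exact mul_le_mul_of_nonneg_left (by exact_mod_cast h) hs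
  · refine le_max_of_le_right (Real.rpow_le_rpow_of_exponent_le hc (neg_le_neg ?_))
    exact mul_le_mul_of_nonneg_left (by exact_mod_cast h) hs

theorem gam_nonneg (m₁ m₂ : ℕ) : 0 ≤ gam m₁ m₂ :=
  div_nonneg (Real.log_natCast_nonneg _) (Real.log_natCast_nonneg _)

theorem one_le_of_symb (z : Symb m₁ m₂) : (1 : ℝ) ≤ (m₁ : ℝ) := by
  have h : 0 < m₁ := (Nat.zero_le _).trans_lt (z.seq 0).1.isLt
  exact_mod_cast h

/-- The metric `d`, the maximum of `m₁ ^ (-min {k : (x_{k+1},y_{k+1}) ≠ (u_{k+1},v_{k+1})})` and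
`m₁ ^ (-γ min {k : y_{k+1} ≠ v_{k+1}})`. -/
def symbDist (z w : Symb m₁ m₂) : ℝ :=
  max (agreeDist (m₁ : ℝ) 1 z.seq w.seq) (agreeDist (m₁ : ℝ) (gam m₁ m₂) (ySeq z) (ySeq w))

instance instMetricSpaceSymb : MetricSpace (Symb m₁ m₂) where
  dist := symbDist
  dist_self z := by simp [symbDist, agreeDist_self]
  dist_comm z w := by
    unfold symbDist
    rw [agreeDist_comm _ _ z.seq, agreeDist_comm _ _ (ySeq z)]
  dist_triangle a b d := by
    have hc := one_le_of_symb a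
    have h0 : (0 : ℝ) ≤ m₁ := by linarith
    have n1 : 0 ≤ symbDist a b := le_max_of_le_left (agreeDist_nonneg h0 _ _ _)
    have n2 : 0 ≤ symbDist b d := le_max_of_le_left (agreeDist_nonneg h0 _ _ _)
    have key : symbDist a d ≤ max (symbDist a b) (symbDist b d) := by
      refine max_le ?_ ?_
      · exact (agreeDist_le_max hc zero_le_one a.seq b.seq d.seq).trans
          (max_le_max (le_max_left _ _) (le_max_left _ _))
      · exact (agreeDist_le_max hc (gam_nonneg m₁ m₂) (ySeq a) (ySeq b) (ySeq d)).trans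
          (max_le_max (le_max_right _ _) (le_max_right _ _))
    exact key.trans (max_le (by linarith) (by linarith))
  eq_of_dist_eq_zero := by
    intro z w h
    by_contra hne
    have hc := one_le_of_symb z
    have hpos : 0 < agreeDist (m₁ : ℝ) 1 z.seq w.seq := by
      have hne' : ¬ (z.seq = w.seq) := fun e => hne (Symb.ext e)
      simp only [agreeDist, hne', if_false]
      exact Real.rpow_pos_of_pos (by linarith) _
    exact absurd h (ne_of_gt (lt_of_lt_of_le hpos (le_max_left _ _)))

instance instMeasurableSpaceSymb : MeasurableSpace (Symb m₁ m₂) := borel _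

instance instBorelSpaceSymb : BorelSpace (Symb m₁ m₂) := ⟨rfl⟩

/-- The ball `B_n(x,y)`: the first `n` letters `x_k` and the first `L(n)` letters `y_k` agree. -/
def quasiBall (n : ℕ) (z : Symb m₁ m₂) : Set (Symb m₁ m₂) :=
  {w | (∀ k < n, (w.seq k).1 = (z.seq k).1) ∧ ∀ k < bigL m₁ m₂ n, (w.seq k).2 = (z.seq k).2}

/-- The sequence `(x,y)|_{J_i} = ((x_{i q^l}, y_{i q^l}))_{l ≥ 0}` (for `i ≥ 1`). -/
def alongJ (q i : ℕ) (z : Symb m₁ m₂) : Symb m₁ m₂ := ⟨fun l => z.seq (i * q ^ l - 1)⟩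

/-- The set `X_Ω`. (An `i` with `q ∤ i` is automatically nonzero.) -/
def multSet (q : ℕ) (Ω : Set (Symb m₁ m₂)) : Set (Symb m₁ m₂) :=
  {z | ∀ i : ℕ, ¬ q ∣ i → alongJ q i z ∈ Ω}

/-- A word `(x_1,y_1) ⋯ (x_p,y_p) y_{p+1} ⋯ y_{p+l}`, as the pair of
`(x_1,y_1) ⋯ (x_p,y_p)` and `y_{p+1} ⋯ y_{p+l}`. -/
abbrev GWord (m₁ m₂ : ℕ) : Type := List (Fin m₁ × Fin m₂) × List (Fin m₂)

/-- The word `(x_1,y_1) ⋯ (x_p,y_p) y_{p+1} ⋯ y_{p+l}` read off from a point. -/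
def gPrefix (p l : ℕ) (z : Symb m₁ m₂) : GWord m₁ m₂ :=
  ((List.range p).map z.seq, (List.range l).map fun i => (z.seq (p + i)).2)

/-- The generalized cylinder `[u]`. -/
def cyl (u : GWord m₁ m₂) : Set (Symb m₁ m₂) :=
  {z | gPrefix u.1.length u.2.length z = u}

/-- The set `Pref_{p,l}(Ω)`. -/
def Pref (Ω : Set (Symb m₁ m₂)) (p l : ℕ) : Set (GWord m₁ m₂) :=
  {u | u.1.length = p ∧ u.2.length = l ∧ (Ω ∩ cyl u).Nonempty}

/-- The column sum `∑_{x'} t_{w (x', y_1) y_2 ⋯ y_r}` for a nonempty word `y_1 ⋯ y_r`.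
It is only applied to functions `t` that vanish outside the tree of prefixes, so that it is the
sum over the `x'` for which the word is a prefix. -/
def colSum (t : GWord m₁ m₂ → ℝ) (w : List (Fin m₁ × Fin m₂)) : List (Fin m₂) → ℝ
  | [] => 0
  | c :: r => ∑ x : Fin m₁, t (w ++ [(x, c)], r)

/-- The vector `t`, on the vertices `⋃_{k ≥ 1} Pref_{k,j}(Ω)` of all the trees of followers
`Γ_{u,j}(Ω)`, `u ∈ Pref_{1,j}(Ω)`, extended by zero: its values at the vertices lie in
`[1, m₂^{2/(γ(q-1))}]` and satisfy
`t_{(x_1,y_1)⋯(x_k,y_k) y_{k+1}⋯y_{k+j}} ^ (q^{j+1} γ)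
  = ∑_{y'} (∑_{x'} t_{(x_1,y_1)⋯(x_k,y_k)(x',y_{k+1}) y_{k+2}⋯y_{k+j} y'}) ^ (q^j γ)`. -/
structure IsTreeVector (q j : ℕ) (Ω : Set (Symb m₁ m₂)) (t : GWord m₁ m₂ → ℝ) : Prop where
  off_tree : ∀ u, (¬ ∃ k ≥ 1, u ∈ Pref Ω k j) → t u = 0
  mem_Icc : ∀ k ≥ 1, ∀ u ∈ Pref Ω k j,
    t u ∈ Set.Icc (1 : ℝ) ((m₂ : ℝ) ^ (2 / (gam m₁ m₂ * ((q : ℝ) - 1))))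
  equation : ∀ k ≥ 1, ∀ u ∈ Pref Ω k j,
    t u ^ ((q : ℝ) ^ (j + 1) * gam m₁ m₂) =
      ∑ y : Fin m₂, colSum t u.1 (u.2 ++ [y]) ^ ((q : ℝ) ^ j * gam m₁ m₂)

/-- The nested sum, for `y = y_1 ⋯ y_{j-p}`,
`∑_{y'_{j-p+1}} (∑_{y'_{j-p+2}} ( ⋯ (∑_{y'_{j+1}} (∑_{x'}
  t_{(x',y_1) y_2 ⋯ y_{j-p} y'_{j-p+1} ⋯ y'_{j+1}}) ^ (q^j γ)) ^ (1/q) ⋯ ) ^ (1/q)) ^ (1/q)`,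
with `p + 2` sums and `p` exponents `1/q`. -/
def nestSum (q j : ℕ) (t : GWord m₁ m₂ → ℝ) : ℕ → List (Fin m₂) → ℝ
  | 0, y => ∑ y' : Fin m₂, colSum t [] (y ++ [y']) ^ ((q : ℝ) ^ j * gam m₁ m₂)
  | p + 1, y => ∑ y' : Fin m₂, nestSum q j t p (y ++ [y']) ^ (1 / (q : ℝ))

/-- The number `t_∅`: all the letters `y_1, …, y_{j+1}` and `x_1` are summed over. -/
def tRoot (q j : ℕ) (t : GWord m₁ m₂ → ℝ) : ℝ := nestSum q j t j []

/-- The word `y_1 ⋯ y_{p+l}` of second coordinates of a word. -/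
def yWord (u : GWord m₁ m₂) : List (Fin m₂) := u.1.map Prod.snd ++ u.2

/-- The word `(x_1,y_1) ⋯ (x_p,y_p) y_{p+1} ⋯ y_{p+j}` cut out of a longer word `u`. -/
def cut (j p : ℕ) (u : GWord m₁ m₂) : GWord m₁ m₂ :=
  (u.1.take p, ((yWord u).drop p).take j)

/-- The sum `∑_{x'_p} t_{(x_1,y_1) ⋯ (x_{p-1},y_{p-1}) (x'_p,y_p) y_{p+1} ⋯ y_{p+j}}`,
for `p ≥ 1`. -/
def colSumAt (j p : ℕ) (t : GWord m₁ m₂ → ℝ) (u : GWord m₁ m₂) : ℝ :=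
  colSum t (u.1.take (p - 1)) (((yWord u).drop (p - 1)).take (j + 1))

/-- The prescribed mass `μ([u])` for
`u = (x_1,y_1) ⋯ (x_k,y_k) y_{k+1} ⋯ y_{k+j} ∈ Pref_{k,j}(Ω)`, `k ≥ 1`. -/
def optWeight (q j k : ℕ) (t : GWord m₁ m₂ → ℝ) (u : GWord m₁ m₂) : ℝ :=
  t (cut j 1 u) * colSumAt j 1 t u ^ ((q : ℝ) ^ j * gam m₁ m₂ - 1) / tRoot q j t
  * (∏ p ∈ Finset.range j, nestSum q j t p ((yWord u).take (j - p)) ^ ((1 - (q : ℝ)) / q))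
  * ∏ p ∈ Finset.Icc 2 k,
      t (cut j p u) * colSumAt j p t u ^ ((q : ℝ) ^ j * gam m₁ m₂ - 1)
        / t (cut j (p - 1) u) ^ ((q : ℝ) ^ (j + 1) * gam m₁ m₂)

/-- `μ` is a Borel probability measure on `Ω` with the prescribed masses of cylinders. -/
structure IsOptMeasure (q j : ℕ) (Ω : Set (Symb m₁ m₂)) (t : GWord m₁ m₂ → ℝ)
    (μ : Measure (Symb m₁ m₂)) : Prop where
  prob : IsProbabilityMeasure μ
  supp : μ Ωᶜ = 0
  mass : ∀ k ≥ 1, ∀ u ∈ Pref Ω k j, μ (cyl u) = ENNReal.ofReal (optWeight q j k t u)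

/-- `P = ℙ_μ`: the Borel probability measure with
`P [(x,y)|_n] = ∏_{i ≤ n, q ∤ i} μ [(x,y)|_{J_i^n}]`, where `(x,y)|_{J_i^n}` is the word
`(x_i,y_i) (x_{qi},y_{qi}) ⋯ (x_{q^r i},y_{q^r i})` with `q^r i ≤ n < q^{r+1} i`, that is,
with `r = Nat.log q (n / i)`. -/
structure IsMultMeasure (q : ℕ) (μ P : Measure (Symb m₁ m₂)) : Prop where
  prob : IsProbabilityMeasure P
  mass : ∀ n ≥ 1, ∀ z : Symb m₁ m₂, P (cyl (gPrefix n 0 z)) =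
    ∏ i ∈ (Finset.Icc 1 n).filter (fun i => ¬ q ∣ i),
      μ (cyl (gPrefix (Nat.log q (n / i) + 1) 0 (alongJ q i z)))

/-- The quotient `-log_{m₂} P(B_n(x,y)) / L(n)` in `[-∞, ∞]`, where `-log 0 = ∞`. -/
def localRate (P : Measure (Symb m₁ m₂)) (z : Symb m₁ m₂) (n : ℕ) : EReal :=
  -ENNReal.log (P (quasiBall n z)) / ((Real.log m₂ * bigL m₁ m₂ n : ℝ) : EReal)

end MultCarpet

end

open MultCarpet

/-! ### Generalized cylinders, balls, and the Borel structure of the symbolic space. -/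

namespace MultCarpet

variable {m₁ m₂ : ℕ}

/-! A ball `B_n(z)` splits along the chains `{i, iq, iq², …}`, `q ∤ i`. On one chain it fixes `k`
full letters and then second coordinates, `M` letters in total, where `k` and `M` count the chain
elements up to `n` and up to `L(n)`. Since `q^j ≤ 1/γ < q^(j+1)`, the number `M - k` is `j` or
`j+1`, unless `k = 0` and `M < j`. Under `ℙ_μ` the chains are independent copies of `μ`, so the mass
of a ball is a product of `μ`-masses of cylinders of these shapes (`multMeasure_cyl`), for which `μ`
is explicit. The equation for `t` says precisely that the prescribed weights are consistent, which
gives `μ`. The vector `t` itself is the limit of a bounded monotone iteration, and is unique because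
the iteration is homogeneous of degree `1/q`.

Taking logarithms and summing over the chains (`IsTreeVector.log_multMeasure_quasiBall`), the
log-mass of `B_n(z)` is `-log t_∅` times the number of `i ≤ L(n)` with `q ∤ i`, plus an error. The
count is asymptotic to `(1 - 1/q) n/γ`, which produces the dimension. The exponents in the
definitions of `t`, `S_p` and `μ` make the error a linear combination of differences `H(M_n)/λ -
H(n)`, where `H` is the summatory function of a bounded function on the positive integers and `|M_n
- λn| ≤ 1` (`errTerm_eq`).

Two facts about such differences finish the proof. For every bounded function, their sums with
weights `1/n²` stay bounded: up to a bounded amount each half is `∫ H(u)/u² du`, an integral that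
scaling changes only by bounded end terms (`logSumBounded_sumTo_comp`). As `∑ 1/n` diverges, the
error is at least `-εn` infinitely often, at every point of `X_Ω` (`LogSumBounded.frequently_ge`).
This gives the bound on the liminf and, by a covering argument, the upper bound for the dimension
(`dimH_le_of_frequently_le`). For almost every point, `H(n)/n` converges by the strong law
(`ae_tendsto_alongChains`), so the error is `o(n)`, and the mass distribution principle
(`le_dimH_of_ae_eventually_le`) gives the lower bound. -/

theorem mem_cyl_gPrefix {p l : ℕ} {z w : Symb m₁ m₂} :
    w ∈ cyl (gPrefix p l z) ↔
      (∀ k < p, w.seq k = z.seq k) ∧ ∀ k < l, (w.seq (p + k)).2 = (z.seq (p + k)).2 := by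
  simp [cyl, gPrefix, Prod.ext_iff, List.map_inj_left]

theorem self_mem_cyl_gPrefix (p l : ℕ) (z : Symb m₁ m₂) : z ∈ cyl (gPrefix p l z) :=
  mem_cyl_gPrefix.2 ⟨fun _ _ => rfl, fun _ _ => rfl⟩

theorem gPrefix_eq_of_mem_cyl {u : GWord m₁ m₂} {z : Symb m₁ m₂} (h : z ∈ cyl u) :
    gPrefix u.1.length u.2.length z = u := h

theorem gPrefix_mem_Pref {Ω : Set (Symb m₁ m₂)} {z : Symb m₁ m₂} (hz : z ∈ Ω) (p l : ℕ) :
    gPrefix p l z ∈ Pref Ω p l :=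
  ⟨by simp [gPrefix], by simp [gPrefix], z, hz, self_mem_cyl_gPrefix p l z⟩

theorem exists_of_mem_Pref {Ω : Set (Symb m₁ m₂)} {p l : ℕ} {u : GWord m₁ m₂}
    (h : u ∈ Pref Ω p l) : ∃ z ∈ Ω, gPrefix p l z = u := by
  obtain ⟨h1, h2, z, hz, hzu⟩ := h
  subst h1 h2
  exact ⟨z, hz, hzu⟩

theorem cyl_nonempty (a : Fin m₁ × Fin m₂) (u : GWord m₁ m₂) :
    ∃ z : Symb m₁ m₂, gPrefix u.1.length u.2.length z = u := by
  refine ⟨⟨fun k => if k < u.1.length then u.1.getD k a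
    else (a.1, u.2.getD (k - u.1.length) a.2)⟩, ?_⟩
  refine Prod.ext ?_ ?_
  · refine List.ext_getElem (by simp [gPrefix]) fun n h1 h2 => ?_
    simp [gPrefix, h2]
  · refine List.ext_getElem (by simp [gPrefix]) fun n h1 h2 => ?_
    simp [gPrefix, h2]

theorem mem_quasiBall {n : ℕ} {z w : Symb m₁ m₂} (hn : n ≤ bigL m₁ m₂ n) :
    w ∈ quasiBall n z ↔ w ∈ cyl (gPrefix n (bigL m₁ m₂ n - n) z) := by
  rw [mem_cyl_gPrefix]
  constructor
  · rintro ⟨h1, h2⟩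
    exact ⟨fun k hk => Prod.ext (h1 k hk) (h2 k (hk.trans_le hn)), fun k hk => h2 _ (by omega)⟩
  · rintro ⟨h1, h2⟩
    refine ⟨fun k hk => by rw [h1 k hk], fun k hk => ?_⟩
    rcases lt_or_ge k n with h | h
    · rw [h1 k h]
    · have := h2 (k - n) (by omega)
      rwa [Nat.add_sub_cancel' h] at this

theorem log_pos_of_two_le {m : ℕ} (h : 2 ≤ m) : 0 < Real.log m :=
  Real.log_pos (by exact_mod_cast h)

theorem gam_pos (hm₂ : 2 ≤ m₂) (hm : m₂ ≤ m₁) : 0 < gam m₁ m₂ :=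
  div_pos (log_pos_of_two_le hm₂) (log_pos_of_two_le (hm₂.trans hm))

theorem gam_le_one (hm₂ : 2 ≤ m₂) (hm : m₂ ≤ m₁) : gam m₁ m₂ ≤ 1 := by
  rw [gam, div_le_one (log_pos_of_two_le (hm₂.trans hm))]
  exact Real.log_le_log (by exact_mod_cast (by omega : 0 < m₂)) (by exact_mod_cast hm)

theorem gam_mul_log (hm₂ : 2 ≤ m₂) (hm : m₂ ≤ m₁) : gam m₁ m₂ * Real.log m₁ = Real.log m₂ :=
  div_mul_cancel₀ _ (log_pos_of_two_le (hm₂.trans hm)).ne'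

theorem le_bigL (hm₂ : 2 ≤ m₂) (hm : m₂ ≤ m₁) (n : ℕ) : n ≤ bigL m₁ m₂ n := by
  have h : (n : ℝ) ≤ n / gam m₁ m₂ := by
    rw [le_div_iff₀ (gam_pos hm₂ hm)]
    exact mul_le_of_le_one_right (Nat.cast_nonneg n) (gam_le_one hm₂ hm)
  exact_mod_cast h.trans (Nat.le_ceil _)

theorem agreeDist_le_iff {α : Type} {c s : ℝ} (hc : 1 < c) (hs : 0 < s) (r : ℝ) (a b : ℕ → α) :
    agreeDist c s a b ≤ c ^ (-r) ↔ ∀ k : ℕ, s * k < r → a k = b k := by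
  have hc0 : 0 < c := zero_lt_one.trans hc
  by_cases hab : a = b
  · subst hab
    simp [agreeDist_self, Real.rpow_nonneg hc0.le]
  · simp only [agreeDist, hab, if_false, Real.rpow_le_rpow_left_iff hc, neg_le_neg_iff]
    constructor
    · intro h k hk
      have : k < PiNat.firstDiff (E := fun _ => α) a b := by
        exact_mod_cast lt_of_mul_lt_mul_left (hk.trans_le h) hs.le
      exact PiNat.apply_eq_of_lt_firstDiff this
    · intro h
      by_contra! hlt
      exact PiNat.apply_firstDiff_ne (E := fun _ => α) hab (h _ hlt)

/-- The ceiling in `L(n)` is exactly what turns `γk < n` into `k < L(n)`, and `n ≤ L(n)` makes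
agreement of the first coordinates up to `n` enough. Through this identity all metric questions
become combinatorial. -/
theorem closedBall_eq_quasiBall (hm₂ : 2 ≤ m₂) (hm : m₂ ≤ m₁) (n : ℕ) (z : Symb m₁ m₂) :
    Metric.closedBall z ((m₁ : ℝ) ^ (-(n : ℝ))) = quasiBall n z := by
  have hc : (1 : ℝ) < m₁ := by exact_mod_cast (by omega : 1 < m₁)
  have hγ := gam_pos hm₂ hm
  have hL := le_bigL hm₂ hm n
  ext w
  have hd : dist w z = symbDist w z := rfl
  rw [Metric.mem_closedBall, hd, symbDist, max_le_iff, agreeDist_le_iff hc one_pos,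
    agreeDist_le_iff hc hγ]
  have h1 : ∀ k : ℕ, 1 * (k : ℝ) < n ↔ k < n := fun k => by rw [one_mul, Nat.cast_lt]
  have h2 : ∀ k : ℕ, gam m₁ m₂ * (k : ℝ) < n ↔ k < bigL m₁ m₂ n := fun k => by
    rw [bigL, Nat.lt_ceil, lt_div_iff₀ hγ, mul_comm]
  simp only [h1, h2, ySeq]
  constructor
  · rintro ⟨h, h'⟩
    exact ⟨fun k hk => by rw [h k hk], h'⟩
  · rintro ⟨h, h'⟩
    exact ⟨fun k hk => Prod.ext (h k hk) (h' k (hk.trans_le hL)), h'⟩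

theorem self_mem_quasiBall (n : ℕ) (z : Symb m₁ m₂) : z ∈ quasiBall n z :=
  ⟨fun _ _ => rfl, fun _ _ => rfl⟩

theorem bigL_mono {n n' : ℕ} (h : n ≤ n') : bigL m₁ m₂ n ≤ bigL m₁ m₂ n' :=
  Nat.ceil_mono (div_le_div_of_nonneg_right (by exact_mod_cast h) (gam_nonneg _ _))

theorem quasiBall_subset_of_mem {n n' : ℕ} (h : n ≤ n') {z w v : Symb m₁ m₂}
    (hz : v ∈ quasiBall n z) (hw : v ∈ quasiBall n' w) : quasiBall n' w ⊆ quasiBall n z := by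
  intro u hu
  refine ⟨fun k hk => ?_, fun k hk => ?_⟩
  · rw [hu.1 k (hk.trans_le h), ← hw.1 k (hk.trans_le h), hz.1 k hk]
  · have hk' := hk.trans_le (bigL_mono h)
    rw [hu.2 k hk', ← hw.2 k hk', hz.2 k hk]

theorem quasiBall_eq_of_mem {n : ℕ} {z w : Symb m₁ m₂} (hw : w ∈ quasiBall n z) :
    quasiBall n w = quasiBall n z :=
  (quasiBall_subset_of_mem le_rfl hw (self_mem_quasiBall n w)).antisymm
    (quasiBall_subset_of_mem le_rfl (self_mem_quasiBall n w) hw)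

theorem exists_quasiBall_subset (hm₂ : 2 ≤ m₂) (hm : m₂ ≤ m₁) {U : Set (Symb m₁ m₂)}
    (hU : IsOpen U) {z : Symb m₁ m₂} (hz : z ∈ U) : ∃ n, quasiBall n z ⊆ U := by
  obtain ⟨ε, hε, hb⟩ := Metric.isOpen_iff.1 hU z hz
  have hc : (1 : ℝ) < m₁ := by exact_mod_cast (by omega : 1 < m₁)
  obtain ⟨n, hn⟩ := exists_pow_lt_of_lt_one hε (inv_lt_one_of_one_lt₀ hc)
  refine ⟨n, fun w hw => hb ?_⟩
  rw [← closedBall_eq_quasiBall hm₂ hm] at hw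
  refine lt_of_le_of_lt (Metric.mem_closedBall.1 hw) ?_
  rwa [Real.rpow_neg (by linarith), Real.rpow_natCast, ← inv_pow]

theorem cyl_gPrefix_subset_quasiBall (n p l : ℕ) (hp : bigL m₁ m₂ n ≤ p) (hn : n ≤ p)
    (z : Symb m₁ m₂) : cyl (gPrefix p l z) ⊆ quasiBall n z := by
  intro w hw
  rw [mem_cyl_gPrefix] at hw
  exact ⟨fun k hk => by rw [hw.1 k (by omega)], fun k hk => by rw [hw.1 k (by omega)]⟩

theorem quasiBall_subset_cyl_gPrefix (n p l : ℕ) (h : p + l ≤ n) (hn : n ≤ bigL m₁ m₂ n)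
    (z : Symb m₁ m₂) : quasiBall n z ⊆ cyl (gPrefix p l z) := by
  intro w hw
  rw [mem_cyl_gPrefix]
  exact ⟨fun k hk => Prod.ext (hw.1 k (by omega)) (hw.2 k (by omega)),
    fun k hk => hw.2 _ (by omega)⟩

theorem isOpen_quasiBall (hm₂ : 2 ≤ m₂) (hm : m₂ ≤ m₁) (n : ℕ) (z : Symb m₁ m₂) :
    IsOpen (quasiBall n z) := by
  have hc : (0 : ℝ) < m₁ := by exact_mod_cast (by omega : 0 < m₁)
  refine Metric.isOpen_iff.2 fun w hw => ⟨(m₁ : ℝ) ^ (-(n : ℝ)), Real.rpow_pos_of_pos hc _, ?_⟩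
  rw [← quasiBall_eq_of_mem hw, ← closedBall_eq_quasiBall hm₂ hm]
  exact Metric.ball_subset_closedBall

theorem isOpen_of_quasiBall (hm₂ : 2 ≤ m₂) (hm : m₂ ≤ m₁) {U : Set (Symb m₁ m₂)}
    (h : ∀ z ∈ U, ∃ n, quasiBall n z ⊆ U) : IsOpen U := by
  rw [isOpen_iff_mem_nhds]
  intro z hz
  obtain ⟨n, hn⟩ := h z hz
  exact Filter.mem_of_superset ((isOpen_quasiBall hm₂ hm n z).mem_nhds (self_mem_quasiBall n z)) hn

theorem isOpen_cyl (hm₂ : 2 ≤ m₂) (hm : m₂ ≤ m₁) (u : GWord m₁ m₂) : IsOpen (cyl u) := by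
  refine isOpen_of_quasiBall hm₂ hm fun z hz => ⟨u.1.length + u.2.length, ?_⟩
  have h := quasiBall_subset_cyl_gPrefix _ _ _ le_rfl
    (le_bigL hm₂ hm (u.1.length + u.2.length)) z
  rwa [gPrefix_eq_of_mem_cyl hz] at h

theorem measurableSet_cyl (hm₂ : 2 ≤ m₂) (hm : m₂ ≤ m₁) (u : GWord m₁ m₂) :
    MeasurableSet (cyl u) := (isOpen_cyl hm₂ hm u).measurableSet

/-- An open set is a countable union of generalized cylinders of shape `(p, l)`, `p ≥ 1`. -/
theorem eq_iUnion_cyl_of_isOpen (hm₂ : 2 ≤ m₂) (hm : m₂ ≤ m₁) (l : ℕ) {U : Set (Symb m₁ m₂)}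
    (hU : IsOpen U) :
    U = ⋃ u ∈ {u : GWord m₁ m₂ | 1 ≤ u.1.length ∧ u.2.length = l ∧ cyl u ⊆ U}, cyl u := by
  refine Set.Subset.antisymm (fun z hz => ?_) (Set.iUnion₂_subset fun u hu => hu.2.2)
  obtain ⟨n, hn⟩ := exists_quasiBall_subset hm₂ hm hU hz
  -- The `+ 1` guarantees `p ≥ 1` even when `n = 0`.
  refine Set.mem_biUnion (x := gPrefix (bigL m₁ m₂ n + 1) l z) ⟨by simp [gPrefix],
    by simp [gPrefix], ?_⟩ (self_mem_cyl_gPrefix _ _ z)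
  exact (cyl_gPrefix_subset_quasiBall n _ _ (by omega)
    (by have := le_bigL hm₂ hm n; omega) z).trans hn

/-- The generalized cylinders of shapes `(p, l)`, `p ≥ 1`, and the empty set. -/
def cylFamily (m₁ m₂ l : ℕ) : Set (Set (Symb m₁ m₂)) :=
  {s | s = ∅ ∨ ∃ p ≥ 1, ∃ z, s = cyl (gPrefix p l z)}

theorem borel_eq_generateFrom_cylFamily (hm₂ : 2 ≤ m₂) (hm : m₂ ≤ m₁) (l : ℕ) :
    (instMeasurableSpaceSymb : MeasurableSpace (Symb m₁ m₂)) =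
      MeasurableSpace.generateFrom (cylFamily m₁ m₂ l) := by
  refine le_antisymm (MeasurableSpace.generateFrom_le fun U hU => ?_)
    (MeasurableSpace.generateFrom_le ?_)
  · rw [eq_iUnion_cyl_of_isOpen hm₂ hm l hU]
    refine MeasurableSet.biUnion (Set.to_countable _) fun u hu => ?_
    obtain ⟨z, hz⟩ := cyl_nonempty (⟨0, by omega⟩, ⟨0, by omega⟩) u
    refine MeasurableSpace.measurableSet_generateFrom (Or.inr ⟨_, hu.1, z, ?_⟩)
    rw [← hu.2.1, hz]
  · rintro s (rfl | ⟨p, -, z, rfl⟩)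
    · exact MeasurableSet.empty
    · exact measurableSet_cyl hm₂ hm _

/-- With the number `l` of trailing second coordinates fixed, a larger `p` means more information in
both coordinates, so cylinders of these shapes are nested or disjoint. For two different values of
`l` this would fail. -/
theorem cyl_gPrefix_subset_of_mem {p p' l : ℕ} (h : p ≤ p') {z w v : Symb m₁ m₂}
    (hz : v ∈ cyl (gPrefix p l z)) (hw : v ∈ cyl (gPrefix p' l w)) :
    cyl (gPrefix p' l w) ⊆ cyl (gPrefix p l z) := by
  intro u hu
  rw [mem_cyl_gPrefix] at *
  refine ⟨fun k hk => ?_, fun k hk => ?_⟩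
  · rw [hu.1 k (by omega), ← hw.1 k (by omega), hz.1 k hk]
  · rcases lt_or_ge (p + k) p' with h' | h'
    · rw [hu.1 _ h', ← hw.1 _ h', hz.2 k hk]
    · have e : p + k = p' + (p + k - p') := by omega
      have h1 := hu.2 (p + k - p') (by omega)
      have h2 := hw.2 (p + k - p') (by omega)
      rw [← e] at h1 h2
      rw [h1, ← h2, hz.2 k hk]

theorem isPiSystem_cylFamily (l : ℕ) : IsPiSystem (cylFamily m₁ m₂ l) := by
  rintro s (rfl | ⟨p, hp, z, rfl⟩) t (rfl | ⟨p', hp', w, rfl⟩) ⟨v, hv, hv'⟩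
  · exact absurd hv id
  · exact absurd hv id
  · exact absurd hv' id
  · rcases le_total p p' with h | h
    · rw [Set.inter_eq_right.2 (cyl_gPrefix_subset_of_mem h hv hv')]
      exact Or.inr ⟨p', hp', w, rfl⟩
    · rw [Set.inter_eq_left.2 (cyl_gPrefix_subset_of_mem h hv' hv)]
      exact Or.inr ⟨p, hp, z, rfl⟩

theorem measure_eq_of_cyl (hm₂ : 2 ≤ m₂) (hm : m₂ ≤ m₁) (l : ℕ) {μ ν : Measure (Symb m₁ m₂)}
    (hμ : IsProbabilityMeasure μ) (hν : IsProbabilityMeasure ν)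
    (h : ∀ p ≥ 1, ∀ z, μ (cyl (gPrefix p l z)) = ν (cyl (gPrefix p l z))) : μ = ν := by
  refine ext_of_generate_finite _ (borel_eq_generateFrom_cylFamily hm₂ hm l)
    (isPiSystem_cylFamily l) ?_ (by simp)
  rintro s (rfl | ⟨p, hp, z, rfl⟩)
  · simp
  · exact h p hp z

theorem measurable_to_symb (hm₂ : 2 ≤ m₂) (hm : m₂ ≤ m₁) {X : Type*} [MeasurableSpace X]
    {f : X → Symb m₁ m₂} (h : ∀ k, Measurable fun x => (f x).seq k) : Measurable f := by
  rw [borel_eq_generateFrom_cylFamily hm₂ hm 0]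
  refine measurable_generateFrom ?_
  rintro s (rfl | ⟨p, -, z, rfl⟩)
  · simp
  · have : f ⁻¹' cyl (gPrefix p 0 z) = ⋂ k ∈ Finset.range p, {x | (f x).seq k = z.seq k} := by
      ext x
      simp [mem_cyl_gPrefix]
    rw [this]
    exact Finset.measurableSet_biInter _ fun k _ => h k (measurableSet_singleton _)

theorem measurable_seq (hm₂ : 2 ≤ m₂) (hm : m₂ ≤ m₁) (k : ℕ) :
    Measurable fun z : Symb m₁ m₂ => z.seq k := by
  refine measurable_to_countable' fun c => IsOpen.measurableSet ?_
  refine isOpen_of_quasiBall hm₂ hm fun z hz => ⟨k + 1, fun w hw => ?_⟩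
  have hL := le_bigL hm₂ hm (k + 1)
  rw [Set.mem_preimage, Set.mem_singleton_iff] at *
  rw [← hz]
  exact Prod.ext (hw.1 k (by omega)) (hw.2 k (by omega))

theorem measurable_gPrefix (hm₂ : 2 ≤ m₂) (hm : m₂ ≤ m₁) {α : Type*} [MeasurableSpace α]
    (p l : ℕ) (f : GWord m₁ m₂ → α) :
    Measurable fun z : Symb m₁ m₂ => f (gPrefix p l z) := by
  intro s _
  have : (fun z : Symb m₁ m₂ => f (gPrefix p l z)) ⁻¹' s =
      ⋃ u ∈ {u : GWord m₁ m₂ | u.1.length = p ∧ u.2.length = l ∧ f u ∈ s}, cyl u := by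
    ext z
    simp only [Set.mem_preimage, Set.mem_iUnion, Set.mem_ofPred_eq, exists_prop]
    constructor
    · exact fun h => ⟨_, ⟨by simp [gPrefix], by simp [gPrefix], h⟩, self_mem_cyl_gPrefix p l z⟩
    · rintro ⟨u, ⟨rfl, rfl, h⟩, hz⟩
      rwa [gPrefix_eq_of_mem_cyl hz]
  rw [this]
  exact MeasurableSet.biUnion (Set.to_countable _) fun u _ => measurableSet_cyl hm₂ hm u

end MultCarpet

/-! ### Measures with prescribed masses of cylinders. -/

namespace MultCarpet

section ListMeasure

variable {A : Type}

/-- The word of length `n` produced by a choice `ω` of a successor letter for each word. -/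
def historyWord (ω : List A → A) : ℕ → List A
  | 0 => []
  | n + 1 => historyWord ω n ++ [ω (historyWord ω n)]

theorem length_historyWord (ω : List A → A) (n : ℕ) : (historyWord ω n).length = n := by
  induction n with
  | zero => rfl
  | succ n ih => simp [historyWord, ih]

theorem historyWord_eq_map (ω : List A → A) (n : ℕ) :
    historyWord ω n = (List.range n).map fun k => ω (historyWord ω k) := by
  induction n with
  | zero => rfl
  | succ n ih => rw [List.range_succ, List.map_append, ← ih]; rfl

/-- This describes the event by one condition on `ω` at each proper prefix of `l`, hence as a finite
box in the product space. -/
theorem historyWord_eq_iff (ω : List A → A) (l : List A) :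
    historyWord ω l.length = l ↔ ∀ l' a, l' ++ [a] <+: l → ω l' = a := by
  induction l using List.reverseRecOn with
  | nil => simp [historyWord]
  | append_singleton l a ih =>
    rw [List.length_append, List.length_singleton, historyWord]
    constructor
    · intro h l' b hb
      obtain ⟨h1, h2⟩ := List.append_inj' h rfl
      rw [List.prefix_concat_iff] at hb
      rcases hb with hb | hb
      · obtain ⟨e1, e2⟩ := List.append_inj' hb rfl
        rw [h1] at h2
        simp_all
      · exact ih.1 h1 l' b hb
    · intro h
      have h1 := ih.2 fun l' b hb => h l' b (hb.trans (List.prefix_append _ _))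
      rw [h1, h l a (List.prefix_refl _)]

variable [Fintype A] [MeasurableSpace A]

/-- The transition probability at the word `l` for the weights `w`. -/
noncomputable def transMeasure (w : List A → ENNReal) (a₀ : A) (l : List A) : Measure A :=
  open Classical in
  if w l = 0 then Measure.dirac a₀ else ∑ a, (w (l ++ [a]) / w l) • Measure.dirac a

theorem isProbabilityMeasure_transMeasure {w : List A → ENNReal} (a₀ : A)
    (hw : ∀ l, w l = ∑ a, w (l ++ [a])) (hfin : ∀ l, w l ≠ ⊤) (l : List A) :
    IsProbabilityMeasure (transMeasure w a₀ l) := by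
  classical
  by_cases hl : w l = 0
  · simp only [transMeasure, hl, if_true]
    infer_instance
  · refine ⟨?_⟩
    simp only [transMeasure, hl, if_false, Measure.finsetSum_apply, Measure.smul_apply,
      measure_univ, smul_eq_mul, mul_one]
    simp only [div_eq_mul_inv]
    rw [← Finset.sum_mul, ← hw l, ENNReal.mul_inv_cancel hl (hfin l)]

variable [MeasurableSingletonClass A]

theorem transMeasure_singleton {w : List A → ENNReal} (a₀ : A) {l : List A} (hl : w l ≠ 0)
    (a : A) : transMeasure w a₀ l {a} = w (l ++ [a]) / w l := by
  classical
  simp only [transMeasure, hl, if_false, Measure.finsetSum_apply, Measure.smul_apply,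
    smul_eq_mul, MeasurableSet.singleton, Measure.dirac_apply', Set.indicator_apply,
    Set.mem_singleton_iff, Pi.one_apply, mul_ite, mul_one, mul_zero]
  simp

/-- A successor is drawn independently at every finite word, and then the path from the empty word
is followed. The path starts with `l` exactly when the draws at the proper prefixes of `l` are the
right ones; the product of transition probabilities telescopes to `w l`. An infinite product thus
realises the dependent process. -/
theorem infinitePi_historyWord {w : List A → ENNReal} (a₀ : A)
    (hw : ∀ l, w l = ∑ a, w (l ++ [a])) (hfin : ∀ l, w l ≠ ⊤) (h1 : w [] = 1) (l : List A) :
    Measure.infinitePi (transMeasure w a₀) {ω | historyWord ω l.length = l} = w l := by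
  classical
  have := isProbabilityMeasure_transMeasure a₀ hw hfin
  have key : ∀ l : List A, {ω : List A → A | historyWord ω l.length = l} =
      Set.pi ↑((Finset.range l.length).image l.take) fun l' => {a | l' ++ [a] <+: l} := by
    intro l
    ext ω
    rw [Set.mem_ofPred_eq, historyWord_eq_iff, Set.mem_pi]
    constructor
    · intro h l' hl'
      simp only [Finset.coe_image, Finset.coe_range, Set.mem_image, Set.mem_Iio] at hl'
      obtain ⟨k, hk, rfl⟩ := hl'
      have hp : l.take k ++ [l[k]] <+: l := by
        rw [← List.take_succ_eq_append_getElem hk]; exact List.take_prefix _ _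
      have := h _ _ hp
      rw [Set.mem_ofPred_eq, this]
      exact hp
    · intro h l' a hp
      have hlen : l'.length < l.length := by
        have := hp.length_le; simp at this; omega
      have ht : l' = l.take l'.length :=
        List.prefix_iff_eq_take.1 ((List.prefix_append _ _).trans hp)
      have := h l' (by
        simp only [Finset.coe_image, Finset.coe_range, Set.mem_image, Set.mem_Iio]
        exact ⟨_, hlen, ht.symm⟩)
      have h2 := List.prefix_of_prefix_length_le this hp (by simp)
      have h3 := h2.eq_of_length (by simp)
      simpa using (List.append_inj' h3 rfl).2
  have hmass : ∀ l : List A, ∀ n ≤ l.length,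
      ∏ k ∈ Finset.range n, transMeasure w a₀ (l.take k) {a | l.take k ++ [a] <+: l} =
        w (l.take n) := by
    intro l n hn
    induction n with
    | zero => simp [h1]
    | succ n ih =>
      rw [Finset.prod_range_succ, ih (by omega)]
      have hs : {a | l.take n ++ [a] <+: l} = {l[n]} := by
        ext a
        have hp : l.take n ++ [l[n]] <+: l := by
          rw [← List.take_succ_eq_append_getElem hn]; exact List.take_prefix _ _
        constructor
        · intro h
          have h3 : l.take n ++ [a] = l.take n ++ [l[n]] :=
            (List.prefix_of_prefix_length_le h hp (by simp [Nat.lt_of_succ_le hn])).eq_of_length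
              (by simp only [List.length_append, List.length_take, List.length_singleton])
          simpa using (List.append_inj' h3 rfl).2
        · rintro rfl
          exact hp
      rw [hs, List.take_succ_eq_append_getElem hn]
      -- At a word of weight zero the transition law is an arbitrary Dirac mass. This is harmless:
      -- consistency forces all successors to have weight zero as well.
      by_cases h0 : w (l.take n) = 0
      · rw [h0, zero_mul]
        have := hw (l.take n)
        rw [h0] at this
        exact ((Finset.sum_eq_zero_iff.1 this.symm) _ (Finset.mem_univ _)).symm
      · rw [transMeasure_singleton a₀ h0, ENNReal.mul_div_cancel h0 (hfin _)]
  rw [key, Measure.infinitePi_pi, Finset.prod_image]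
  · simpa using hmass l l.length le_rfl
  · intro x hx y hy hxy
    have hx := Finset.mem_range.1 hx
    have hy := Finset.mem_range.1 hy
    have := congrArg List.length hxy
    simp only [List.length_take] at this
    omega
  · intro l' _
    exact (Set.toFinite _).measurableSet

theorem measurable_historyWord (n : ℕ) (l : List A) :
    MeasurableSet {ω : List A → A | historyWord ω n = l} := by
  classical
  by_cases h : l.length = n
  · subst h
    have : {ω : List A → A | historyWord ω l.length = l} =
        ⋂ l' : List A, ⋂ a : A, ⋂ _ : l' ++ [a] <+: l, (fun ω => ω l') ⁻¹' {a} := by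
      ext ω
      rw [Set.mem_ofPred_eq, historyWord_eq_iff]
      simp
    rw [this]
    refine MeasurableSet.iInter fun l' => MeasurableSet.iInter fun a => MeasurableSet.iInter
      fun _ => (measurable_pi_apply l') (measurableSet_singleton a)
  · convert MeasurableSet.empty
    ext ω
    simp only [Set.mem_ofPred_eq, Set.mem_empty_iff_false, iff_false]
    rintro rfl
    exact h (length_historyWord ω n)

theorem measurable_historyLetter (n : ℕ) :
    Measurable fun ω : List A → A => ω (historyWord ω n) := by
  refine measurable_to_countable' fun c => ?_
  have : (fun ω : List A → A => ω (historyWord ω n)) ⁻¹' {c} =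
      ⋃ l : List A, {ω | historyWord ω n = l} ∩ (fun ω => ω l) ⁻¹' {c} := by
    ext ω; simp
  rw [this]
  exact MeasurableSet.iUnion fun l => (measurable_historyWord n l).inter
    ((measurable_pi_apply l) (measurableSet_singleton c))

end ListMeasure

variable {m₁ m₂ : ℕ}

theorem exists_measure_of_full_weights (hm₂ : 2 ≤ m₂) (hm : m₂ ≤ m₁)
    {w : List (Fin m₁ × Fin m₂) → ENNReal} (hw : ∀ l, w l = ∑ a, w (l ++ [a]))
    (hfin : ∀ l, w l ≠ ⊤) (h1 : w [] = 1) :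
    ∃ μ : Measure (Symb m₁ m₂), IsProbabilityMeasure μ ∧ ∀ l, μ (cyl (l, [])) = w l := by
  let a₀ : Fin m₁ × Fin m₂ := (⟨0, by omega⟩, ⟨0, by omega⟩)
  have := isProbabilityMeasure_transMeasure a₀ hw hfin
  let F : (List (Fin m₁ × Fin m₂) → Fin m₁ × Fin m₂) → Symb m₁ m₂ :=
    fun ω => ⟨fun n => ω (historyWord ω n)⟩
  have hF : Measurable F := measurable_to_symb hm₂ hm measurable_historyLetter
  refine ⟨(Measure.infinitePi (transMeasure w a₀)).map F,
    Measure.isProbabilityMeasure_map hF.aemeasurable, fun l => ?_⟩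
  rw [Measure.map_apply hF (measurableSet_cyl hm₂ hm _), ← infinitePi_historyWord a₀ hw hfin h1 l]
  congr 1
  ext ω
  rw [Set.mem_ofPred_eq, historyWord_eq_map]
  simp [cyl, gPrefix, F]

theorem mem_cyl_cons {l : List (Fin m₁ × Fin m₂)} {c : Fin m₂} {v : List (Fin m₂)}
    {z : Symb m₁ m₂} :
    z ∈ cyl (l, c :: v) ↔ ∃ x, z ∈ cyl (l ++ [(x, c)], v) := by
  simp only [cyl, gPrefix, Set.mem_ofPred_eq, Prod.mk.injEq, List.length_append,
    List.length_cons, List.length_nil, Nat.zero_add]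
  rw [List.range_succ_eq_map (n := v.length), List.map_cons, List.map_map, List.cons.injEq,
    Nat.add_zero, List.range_succ, List.map_append, List.map_singleton]
  have e : ((fun i => (z.seq (l.length + i)).2) ∘ Nat.succ) =
      fun i => (z.seq (l.length + 1 + i)).2 := by
    funext i
    simp only [Function.comp_apply]
    congr 2
    omega
  rw [e]
  constructor
  · rintro ⟨h1, h2, h3⟩
    refine ⟨(z.seq l.length).1, ?_, h3⟩
    rw [h1, ← h2]
  · rintro ⟨x, h1, h2⟩
    obtain ⟨h3, h4⟩ := List.append_inj' h1 rfl
    simp only [List.cons.injEq, and_true] at h4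
    exact ⟨h3, by rw [h4], h2⟩

/-- Splitting according to the missing first coordinate `x` promotes the first trailing second
coordinate to a full letter. -/
theorem measure_cyl_cons (hm₂ : 2 ≤ m₂) (hm : m₂ ≤ m₁) (μ : Measure (Symb m₁ m₂))
    (l : List (Fin m₁ × Fin m₂)) (c : Fin m₂) (v : List (Fin m₂)) :
    μ (cyl (l, c :: v)) = ∑ x, μ (cyl (l ++ [(x, c)], v)) := by
  have h : cyl (l, c :: v) = ⋃ x, cyl (l ++ [(x, c)], v) := by
    ext z; rw [mem_cyl_cons, Set.mem_iUnion]
  rw [h, measure_iUnion _ fun x => measurableSet_cyl hm₂ hm _, tsum_fintype]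
  refine fun x x' hx => Set.disjoint_left.2 fun z hz hz' => hx ?_
  have h1 : z ∈ cyl (l ++ [(x, c)], v) := hz
  have h2 : z ∈ cyl (l ++ [(x', c)], v) := hz'
  have e := (gPrefix_eq_of_mem_cyl h1).symm.trans
    (Eq.trans (by simp) (gPrefix_eq_of_mem_cyl h2))
  simpa using e

/-- The sum of `f` over all extensions of a word by `n` second coordinates. -/
def sumExt (f : GWord m₁ m₂ → ℝ) : ℕ → GWord m₁ m₂ → ℝ
  | 0, u => f u
  | n + 1, u => ∑ y : Fin m₂, sumExt f n (u.1, u.2 ++ [y])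

theorem sumExt_nonneg {f : GWord m₁ m₂ → ℝ} (hf : ∀ u, 0 ≤ f u) (n : ℕ) (u : GWord m₁ m₂) :
    0 ≤ sumExt f n u := by
  induction n generalizing u with
  | zero => exact hf u
  | succ n ih => exact Finset.sum_nonneg fun y _ => ih _

/-- The outer sums over the last second coordinates are peeled off until the trailing word has
length `j`, where `hcons` applies. So the extended weights obey the additivity that
`measure_cyl_cons` imposes on a measure. -/
theorem sum_sumExt_succ {f : GWord m₁ m₂ → ℝ} {j : ℕ}
    (hcons : ∀ l v, v.length = j → f (l, v) = ∑ y, colSum f l (v ++ [y])) (n : ℕ)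
    (l : List (Fin m₁ × Fin m₂)) (c : Fin m₂) (v : List (Fin m₂)) (hv : v.length + (n + 1) = j) :
    ∑ x, sumExt f (n + 1) (l ++ [(x, c)], v) = sumExt f n (l, c :: v) := by
  induction n generalizing v with
  | zero =>
    simp only [sumExt]
    rw [hcons l (c :: v) (by simpa using hv), Finset.sum_comm]
    simp [colSum]
  | succ n ih =>
    simp only [sumExt]
    rw [Finset.sum_comm]
    refine Finset.sum_congr rfl fun y _ => ?_
    have := ih (v ++ [y]) (by simp; omega)
    simpa [sumExt] using this

theorem sumExt_eq_sum {f : GWord m₁ m₂ → ℝ} {j : ℕ}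
    (hcons : ∀ l v, v.length = j → f (l, v) = ∑ y, colSum f l (v ++ [y]))
    (l : List (Fin m₁ × Fin m₂)) :
    sumExt f j (l, []) = ∑ a : Fin m₁ × Fin m₂, sumExt f j (l ++ [a], []) := by
  rw [Fintype.sum_prod_type, Finset.sum_comm]
  cases j with
  | zero => simpa [sumExt, colSum] using hcons l [] rfl
  | succ n =>
    refine Finset.sum_congr rfl fun c _ => ?_
    exact (sum_sumExt_succ hcons n l c [] (by simp)).symm

/-- The weights are given on words with `j` trailing second coordinates. Summing those out yields
consistent weights on full words, hence a measure; the masses with trailing letters are then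
recovered by promoting these letters one at a time. -/
theorem exists_measure_of_weights (hm₂ : 2 ≤ m₂) (hm : m₂ ≤ m₁) {f : GWord m₁ m₂ → ℝ} {j : ℕ}
    (hf : ∀ u, 0 ≤ f u)
    (hcons : ∀ l v, v.length = j → f (l, v) = ∑ y, colSum f l (v ++ [y]))
    (h1 : sumExt f j ([], []) = 1) :
    ∃ μ : Measure (Symb m₁ m₂), IsProbabilityMeasure μ ∧
      ∀ v l n, v.length + n = j → μ (cyl (l, v)) = ENNReal.ofReal (sumExt f n (l, v)) := by
  obtain ⟨μ, hμ, hmass⟩ := exists_measure_of_full_weights hm₂ hm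
    (w := fun l => ENNReal.ofReal (sumExt f j (l, [])))
    (fun l => by
      rw [← ENNReal.ofReal_sum_of_nonneg fun _ _ => sumExt_nonneg hf _ _,
        ← sumExt_eq_sum hcons l])
    (fun l => ENNReal.ofReal_ne_top) (by rw [h1, ENNReal.ofReal_one])
  refine ⟨μ, hμ, ?_⟩
  intro v
  induction v with
  | nil =>
    rintro l n hn
    rw [List.length_nil, Nat.zero_add] at hn
    rw [hn, hmass]
  | cons c v ih =>
    intro l n hn
    have hn' : v.length + (n + 1) = j := by rw [List.length_cons] at hn; omega
    rw [measure_cyl_cons hm₂ hm, ← sum_sumExt_succ hcons n l c v hn',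
      ENNReal.ofReal_sum_of_nonneg fun _ _ => sumExt_nonneg hf _ _]
    exact Finset.sum_congr rfl fun x _ => ih _ _ hn'

end MultCarpet

/-! ### Existence and uniqueness of the vector `t`. -/

namespace MultCarpet

variable {m₁ m₂ : ℕ}

theorem colSum_mono {t t' : GWord m₁ m₂ → ℝ} (h : ∀ u, t u ≤ t' u)
    (w : List (Fin m₁ × Fin m₂)) (v : List (Fin m₂)) : colSum t w v ≤ colSum t' w v := by
  cases v with
  | nil => exact le_rfl
  | cons c r => exact Finset.sum_le_sum fun x _ => h _

theorem colSum_nonneg {t : GWord m₁ m₂ → ℝ} (h : ∀ u, 0 ≤ t u)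
    (w : List (Fin m₁ × Fin m₂)) (v : List (Fin m₂)) : 0 ≤ colSum t w v := by
  cases v with
  | nil => exact le_rfl
  | cons c r => exact Finset.sum_nonneg fun x _ => h _

theorem colSum_const_mul (C : ℝ) (t : GWord m₁ m₂ → ℝ)
    (w : List (Fin m₁ × Fin m₂)) (v : List (Fin m₂)) :
    colSum (fun u => C * t u) w v = C * colSum t w v := by
  cases v with
  | nil => simp [colSum]
  | cons c r => simp [colSum, Finset.mul_sum]

theorem colSum_le {t : GWord m₁ m₂ → ℝ} {M : ℝ} (hM : 0 ≤ M) (h : ∀ u, t u ≤ M)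
    (w : List (Fin m₁ × Fin m₂)) (v : List (Fin m₂)) : colSum t w v ≤ m₁ * M := by
  cases v with
  | nil => exact mul_nonneg (Nat.cast_nonneg _) hM
  | cons c r =>
    refine (Finset.sum_le_sum fun x _ => h _).trans_eq ?_
    simp

theorem gPrefix_snd_concat (k l : ℕ) (z : Symb m₁ m₂) :
    (gPrefix k l z).2 ++ [(z.seq (k + l)).2] = (gPrefix k (l + 1) z).2 := by
  simp [gPrefix, List.range_succ]

theorem gPrefix_snd_succ (k l : ℕ) (z : Symb m₁ m₂) :
    (gPrefix k (l + 1) z).2 = (z.seq k).2 :: (gPrefix (k + 1) l z).2 := by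
  simp only [gPrefix, List.range_succ_eq_map, List.map_cons, List.map_map, Nat.add_zero]
  congr 2
  funext i
  simp [Nat.add_assoc, Nat.add_comm 1]

theorem gPrefix_fst_succ (k l : ℕ) (z : Symb m₁ m₂) :
    (gPrefix (k + 1) l z).1 = (gPrefix k l z).1 ++ [z.seq k] := by
  simp [gPrefix, List.range_succ]

/-- The column sum read off from a point. -/
theorem colSum_gPrefix (t : GWord m₁ m₂ → ℝ) (k l l' : ℕ) (z : Symb m₁ m₂) :
    colSum t (gPrefix k l' z).1 (gPrefix k (l + 1) z).2 =
      ∑ x, t ((gPrefix k l z).1 ++ [(x, (z.seq k).2)], (gPrefix (k + 1) l z).2) := by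
  rw [gPrefix_snd_succ]; rfl

theorem le_colSum_gPrefix {t : GWord m₁ m₂ → ℝ} (h : ∀ u, 0 ≤ t u) (k l l' : ℕ)
    (z : Symb m₁ m₂) :
    t (gPrefix (k + 1) l z) ≤ colSum t (gPrefix k l' z).1 (gPrefix k (l + 1) z).2 := by
  rw [colSum_gPrefix]
  have e : gPrefix (k + 1) l z =
      ((gPrefix k l z).1 ++ [((z.seq k).1, (z.seq k).2)], (gPrefix (k + 1) l z).2) :=
    Prod.ext (gPrefix_fst_succ k l z) rfl
  nth_rw 1 [e]
  exact Finset.single_le_sum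
    (f := fun x => t ((gPrefix k l z).1 ++ [(x, (z.seq k).2)], (gPrefix (k + 1) l z).2))
    (fun x _ => h _) (Finset.mem_univ _)

/-- The vertices `⋃_{k ≥ 1} Pref_{k,j}(Ω)`. -/
def treeSet (Ω : Set (Symb m₁ m₂)) (j : ℕ) : Set (GWord m₁ m₂) := {u | ∃ k ≥ 1, u ∈ Pref Ω k j}

theorem exists_of_mem_treeSet {Ω : Set (Symb m₁ m₂)} {j : ℕ} {u : GWord m₁ m₂}
    (h : u ∈ treeSet Ω j) : ∃ k ≥ 1, ∃ z ∈ Ω, gPrefix k j z = u := by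
  obtain ⟨k, hk, hu⟩ := h
  obtain ⟨z, hz, rfl⟩ := exists_of_mem_Pref hu
  exact ⟨k, hk, z, hz, rfl⟩

theorem gPrefix_mem_treeSet {Ω : Set (Symb m₁ m₂)} {z : Symb m₁ m₂} (hz : z ∈ Ω) (j : ℕ) {k : ℕ}
    (hk : 1 ≤ k) : gPrefix k j z ∈ treeSet Ω j := ⟨k, hk, gPrefix_mem_Pref hz k j⟩

/-- The right-hand side of the equation for `t`. -/
noncomputable def branchSum (a : ℝ) (t : GWord m₁ m₂ → ℝ) (u : GWord m₁ m₂) : ℝ :=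
  ∑ y : Fin m₂, colSum t u.1 (u.2 ++ [y]) ^ a

theorem branchSum_nonneg {a : ℝ} {t : GWord m₁ m₂ → ℝ} (h : ∀ u, 0 ≤ t u) (u : GWord m₁ m₂) :
    0 ≤ branchSum a t u :=
  Finset.sum_nonneg fun _ _ => Real.rpow_nonneg (colSum_nonneg h _ _) _

theorem branchSum_mono {a : ℝ} (ha : 0 ≤ a) {t t' : GWord m₁ m₂ → ℝ} (h0 : ∀ u, 0 ≤ t u)
    (h : ∀ u, t u ≤ t' u) (u : GWord m₁ m₂) : branchSum a t u ≤ branchSum a t' u :=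
  Finset.sum_le_sum fun _ _ =>
    Real.rpow_le_rpow (colSum_nonneg h0 _ _) (colSum_mono h _ _) ha

theorem one_le_branchSum {a : ℝ} (ha : 0 ≤ a) {Ω : Set (Symb m₁ m₂)} {j : ℕ}
    {t : GWord m₁ m₂ → ℝ} (h0 : ∀ u, 0 ≤ t u) (h1 : ∀ u ∈ treeSet Ω j, 1 ≤ t u)
    {u : GWord m₁ m₂} (hu : u ∈ treeSet Ω j) : 1 ≤ branchSum a t u := by
  obtain ⟨k, hk, z, hz, rfl⟩ := exists_of_mem_treeSet hu
  have h2 := (h1 _ (gPrefix_mem_treeSet hz j (Nat.succ_le_succ (Nat.zero_le k)))).trans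
    (le_colSum_gPrefix h0 k j j z)
  rw [← gPrefix_snd_concat] at h2
  exact (Real.one_le_rpow h2 ha).trans (Finset.single_le_sum
    (f := fun y => colSum t (gPrefix k j z).1 ((gPrefix k j z).2 ++ [y]) ^ a)
    (fun y _ => Real.rpow_nonneg (colSum_nonneg h0 _ _) _) (Finset.mem_univ (z.seq (k + j)).2))

/-- The iteration, starting from the indicator of the tree, whose limit is the vector `t`. -/
noncomputable def treeIter (a b : ℝ) (T : Set (GWord m₁ m₂)) : ℕ → GWord m₁ m₂ → ℝ
  | 0 => T.indicator 1
  | n + 1 => T.indicator fun u => branchSum a (treeIter a b T n) u ^ (1 / b)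

section iter

variable {a b M : ℝ} {Ω : Set (Symb m₁ m₂)} {j : ℕ}

theorem treeIter_nonneg (n : ℕ) (u : GWord m₁ m₂) : 0 ≤ treeIter a b (treeSet Ω j) n u := by
  induction n generalizing u with
  | zero => exact Set.indicator_nonneg (fun _ _ => zero_le_one) u
  | succ n ih => exact Set.indicator_nonneg (fun _ _ => Real.rpow_nonneg (branchSum_nonneg ih _) _) u

theorem one_le_treeIter (ha : 0 ≤ a) (hb : 0 ≤ b) (n : ℕ) {u : GWord m₁ m₂}
    (hu : u ∈ treeSet Ω j) : 1 ≤ treeIter a b (treeSet Ω j) n u := by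
  induction n generalizing u with
  | zero => simp [treeIter, hu]
  | succ n ih =>
    rw [treeIter, Set.indicator_of_mem hu]
    exact Real.one_le_rpow (one_le_branchSum ha (treeIter_nonneg n) (fun u hu => ih hu) hu)
      (by positivity)

theorem treeIter_le_succ (ha : 0 ≤ a) (hb : 0 ≤ b) (n : ℕ) (u : GWord m₁ m₂) :
    treeIter a b (treeSet Ω j) n u ≤ treeIter a b (treeSet Ω j) (n + 1) u := by
  induction n generalizing u with
  | zero =>
    by_cases hu : u ∈ treeSet Ω j
    · have := one_le_treeIter ha hb 1 hu
      simpa [treeIter, hu] using this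
    · simp [treeIter, hu]
  | succ n ih =>
    refine Set.indicator_le_indicator (Real.rpow_le_rpow (branchSum_nonneg (treeIter_nonneg n) _)
      (branchSum_mono ha (treeIter_nonneg n) ih u) (by positivity))

/-- By `hMb` the constant `M` is a supersolution: there are at most `m₂` column sums, each at most
`m₁ M`. -/
theorem treeIter_le (ha : 0 ≤ a) (hb : 0 < b) (hM : 1 ≤ M) (hMb : m₂ * (m₁ * M) ^ a ≤ M ^ b)
    (n : ℕ) (u : GWord m₁ m₂) : treeIter a b (treeSet Ω j) n u ≤ M := by
  have hM0 : 0 ≤ M := zero_le_one.trans hM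
  induction n generalizing u with
  | zero => exact Set.indicator_apply_le' (fun _ => hM) fun _ => hM0
  | succ n ih =>
    refine Set.indicator_apply_le' (fun _ => ?_) fun _ => hM0
    have h : branchSum a (treeIter a b (treeSet Ω j) n) u ≤ M ^ b := by
      refine le_trans (Finset.sum_le_sum fun y _ => Real.rpow_le_rpow
        (colSum_nonneg (treeIter_nonneg n) _ _) (colSum_le hM0 ih _ _) ha) ?_
      simpa using hMb
    calc _ ≤ (M ^ b) ^ (1 / b) :=
          Real.rpow_le_rpow (branchSum_nonneg (treeIter_nonneg n) _) h (by positivity)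
      _ = M := by rw [← Real.rpow_mul hM0, mul_one_div_cancel hb.ne', Real.rpow_one]

/-- The iterates increase and stay in `[1, M]` on the tree, so they converge pointwise. The equation
at one vertex involves finitely many values, continuously, and passes to the limit. -/
theorem exists_tree_fixed_point (ha : 0 ≤ a) (hb : 0 < b) (hM : 1 ≤ M)
    (hMb : m₂ * (m₁ * M) ^ a ≤ M ^ b) :
    ∃ t : GWord m₁ m₂ → ℝ, (∀ u ∉ treeSet Ω j, t u = 0) ∧
      (∀ u ∈ treeSet Ω j, t u ∈ Set.Icc 1 M) ∧
      ∀ u ∈ treeSet Ω j, t u ^ b = branchSum a t u := by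
  have hlim : ∀ u, ∃ l, Tendsto (fun n => treeIter a b (treeSet Ω j) n u) atTop (𝓝 l) :=
    fun u => ⟨_, tendsto_atTop_ciSup (monotone_nat_of_le_succ fun n => treeIter_le_succ ha hb.le n u)
      ⟨M, by rintro _ ⟨n, rfl⟩; exact treeIter_le ha hb hM hMb n u⟩⟩
  choose t ht using hlim
  have hlim' : ∀ u, Tendsto (fun n => branchSum a (treeIter a b (treeSet Ω j) n) u) atTop
      (𝓝 (branchSum a t u)) := by
    intro u
    refine tendsto_finsetSum _ fun y _ => ?_
    refine ((Real.continuous_rpow_const ha).tendsto _).comp ?_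
    cases u.2 ++ [y] with
    | nil => exact tendsto_const_nhds
    | cons c r => exact tendsto_finsetSum _ fun x _ => ht _
  refine ⟨t, fun u hu => ?_, fun u hu => ⟨?_, ?_⟩, fun u hu => ?_⟩
  · refine tendsto_nhds_unique (ht u) (tendsto_const_nhds.congr fun n => ?_)
    cases n <;> simp [treeIter, hu]
  · exact ge_of_tendsto' (ht u) fun n => one_le_treeIter ha hb.le n hu
  · exact le_of_tendsto' (ht u) fun n => treeIter_le ha hb hM hMb n u
  · have h1 := (((Real.continuous_rpow_const hb.le).tendsto _).comp (ht u)).comp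
      (tendsto_add_atTop_nat 1)
    refine tendsto_nhds_unique h1 ((hlim' u).congr fun n => ?_)
    simp only [Function.comp_apply, treeIter, Set.indicator_of_mem hu]
    rw [← Real.rpow_mul (branchSum_nonneg (treeIter_nonneg n) _), one_div_mul_cancel hb.ne',
      Real.rpow_one]

end iter

theorem branchSum_const_mul {a C : ℝ} (hC : 0 ≤ C) {t : GWord m₁ m₂ → ℝ} (h0 : ∀ u, 0 ≤ t u)
    (u : GWord m₁ m₂) : branchSum a (fun u => C * t u) u = C ^ a * branchSum a t u := by
  simp only [branchSum, colSum_const_mul, Finset.mul_sum]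
  exact Finset.sum_congr rfl fun y _ => Real.mul_rpow hC (colSum_nonneg h0 _ _)

/-- The right-hand side of the equation is homogeneous of degree `a` and the left-hand side of
degree `qa`. Hence `t ≤ C t'` improves to `t ≤ C^(1/q) t'`; starting from `C = M` and iterating, the
constant tends to `1`. -/
theorem tree_fixed_point_le {a q M : ℝ} (ha : 0 < a) (hq : 1 < q) (hM : 1 ≤ M)
    {T : Set (GWord m₁ m₂)} {t t' : GWord m₁ m₂ → ℝ}
    (h0 : ∀ u ∉ T, t u = 0) (h0' : ∀ u ∉ T, t' u = 0)
    (hI : ∀ u ∈ T, t u ∈ Set.Icc 1 M) (hI' : ∀ u ∈ T, t' u ∈ Set.Icc 1 M)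
    (he : ∀ u ∈ T, t u ^ (q * a) = branchSum a t u)
    (he' : ∀ u ∈ T, t' u ^ (q * a) = branchSum a t' u) (u : GWord m₁ m₂) : t u ≤ t' u := by
  have hM0 : 0 < M := zero_lt_one.trans_le hM
  have hq0 : 0 < q := by linarith
  have hnn : ∀ u, 0 ≤ t u := fun u => by
    by_cases hu : u ∈ T
    · linarith [(hI u hu).1]
    · exact (h0 u hu).ge
  have hnn' : ∀ u, 0 ≤ t' u := fun u => by
    by_cases hu : u ∈ T
    · linarith [(hI' u hu).1]
    · exact (h0' u hu).ge
  have key : ∀ n : ℕ, ∀ u, t u ≤ M ^ ((1 / q) ^ n) * t' u := by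
    intro n
    induction n with
    | zero =>
      intro u
      rw [pow_zero, Real.rpow_one]
      by_cases hu : u ∈ T
      · exact (hI u hu).2.trans (le_mul_of_one_le_right hM0.le (hI' u hu).1)
      · rw [h0 u hu, h0' u hu, mul_zero]
    | succ n ih =>
      intro u
      by_cases hu : u ∈ T
      · have hC : 0 ≤ M ^ ((1 / q) ^ n) := Real.rpow_nonneg hM0.le _
        have h1 := branchSum_mono ha.le hnn ih u
        rw [branchSum_const_mul hC hnn', ← he u hu, ← he' u hu] at h1
        have e : M ^ ((1 / q) ^ n) = (M ^ ((1 / q) ^ (n + 1))) ^ q := by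
          rw [← Real.rpow_mul hM0.le, pow_succ, mul_assoc, one_div_mul_cancel hq0.ne', mul_one]
        have hC' : 0 ≤ M ^ ((1 / q) ^ (n + 1)) := Real.rpow_nonneg hM0.le _
        rw [e, ← Real.rpow_mul hC', ← Real.mul_rpow hC' (hnn' u)] at h1
        exact (Real.rpow_le_rpow_iff (hnn u) (mul_nonneg hC' (hnn' u)) (by positivity)).1 h1
      · rw [h0 u hu, h0' u hu, mul_zero]
  have hlim : Tendsto (fun n : ℕ => M ^ ((1 / q) ^ n) * t' u) atTop (𝓝 (M ^ (0 : ℝ) * t' u)) :=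
    (((Real.continuous_const_rpow hM0.ne').tendsto 0).comp
      (tendsto_pow_atTop_nhds_zero_of_lt_one (by positivity)
        ((div_lt_one hq0).2 hq))).mul_const _
  rw [Real.rpow_zero, one_mul] at hlim
  exact ge_of_tendsto' hlim fun n => key n u

/-- The exponent `a = q^j γ`. -/
noncomputable def expA (m₁ m₂ q j : ℕ) : ℝ := (q : ℝ) ^ j * gam m₁ m₂

theorem isTreeVector_iff {q j : ℕ} {Ω : Set (Symb m₁ m₂)} {t : GWord m₁ m₂ → ℝ} :
    IsTreeVector q j Ω t ↔ (∀ u ∉ treeSet Ω j, t u = 0) ∧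
      (∀ u ∈ treeSet Ω j,
        t u ∈ Set.Icc (1 : ℝ) ((m₂ : ℝ) ^ (2 / (gam m₁ m₂ * ((q : ℝ) - 1))))) ∧
      ∀ u ∈ treeSet Ω j, t u ^ ((q : ℝ) * expA m₁ m₂ q j) = branchSum (expA m₁ m₂ q j) t u := by
  have e : (q : ℝ) * expA m₁ m₂ q j = (q : ℝ) ^ (j + 1) * gam m₁ m₂ := by rw [expA]; ring
  rw [e]
  constructor
  · rintro ⟨h1, h2, h3⟩
    exact ⟨h1, fun u ⟨k, hk, hu⟩ => h2 k hk u hu, fun u ⟨k, hk, hu⟩ => h3 k hk u hu⟩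
  · rintro ⟨h1, h2, h3⟩
    exact ⟨h1, fun k hk u hu => h2 u ⟨k, hk, hu⟩, fun k hk u hu => h3 u ⟨k, hk, hu⟩⟩

theorem expA_pos (hm₂ : 2 ≤ m₂) (hm : m₂ ≤ m₁) {q : ℕ} (hq : 2 ≤ q) (j : ℕ) :
    0 < expA m₁ m₂ q j :=
  mul_pos (pow_pos (by exact_mod_cast (by omega : 0 < q)) j) (gam_pos hm₂ hm)

theorem one_le_treeBound (hm₂ : 2 ≤ m₂) {q : ℕ} (hq : 2 ≤ q) :
    1 ≤ (m₂ : ℝ) ^ (2 / (gam m₁ m₂ * ((q : ℝ) - 1))) := by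
  have : (2 : ℝ) ≤ q := by exact_mod_cast hq
  exact Real.one_le_rpow (by exact_mod_cast (by omega : 1 ≤ m₂))
    (div_nonneg zero_le_two (mul_nonneg (gam_nonneg _ _) (by linarith)))

theorem exists_isTreeVector (hm₂ : 2 ≤ m₂) (hm : m₂ ≤ m₁) {q : ℕ} (hq : 2 ≤ q) (j : ℕ)
    (Ω : Set (Symb m₁ m₂)) : ∃ t, IsTreeVector q j Ω t := by
  simp_rw [isTreeVector_iff]
  have ha := expA_pos hm₂ hm hq j
  have hγ := gam_pos hm₂ hm
  have hq' : (2 : ℝ) ≤ q := by exact_mod_cast hq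
  have hm₂' : (0 : ℝ) < m₂ := by exact_mod_cast (by omega : 0 < m₂)
  have hm₁' : (0 : ℝ) < m₁ := by exact_mod_cast (by omega : 0 < m₁)
  refine exists_tree_fixed_point ha.le (by positivity) (one_le_treeBound hm₂ hq) ?_
  set M := (m₂ : ℝ) ^ (2 / (gam m₁ m₂ * ((q : ℝ) - 1))) with hM
  have hMpos : 0 < M := Real.rpow_pos_of_pos hm₂' _
  have hlogM : Real.log M = 2 / (gam m₁ m₂ * ((q : ℝ) - 1)) * Real.log m₂ := Real.log_rpow hm₂' _
  rw [← Real.log_le_log_iff (by positivity) (by positivity), Real.log_rpow hMpos,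
    Real.log_mul hm₂'.ne' (by positivity), Real.log_rpow (by positivity),
    Real.log_mul hm₁'.ne' hMpos.ne', hlogM]
  have hl := gam_mul_log hm₂ hm
  have hl2 := log_pos_of_two_le hm₂
  have hqj : (1 : ℝ) ≤ (q : ℝ) ^ j := one_le_pow₀ (by linarith)
  have e1 : expA m₁ m₂ q j * (Real.log m₁ + 2 / (gam m₁ m₂ * ((q : ℝ) - 1)) * Real.log m₂) =
      (q : ℝ) ^ j * Real.log m₂ + (q : ℝ) ^ j * (2 / ((q : ℝ) - 1)) * Real.log m₂ := by
    rw [← hl, expA]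
    have : (q : ℝ) - 1 ≠ 0 := by linarith
    field_simp
  have e2 : (q : ℝ) * expA m₁ m₂ q j * (2 / (gam m₁ m₂ * ((q : ℝ) - 1)) * Real.log m₂) =
      (q : ℝ) ^ j * (2 / ((q : ℝ) - 1)) * Real.log m₂ + 2 * (q : ℝ) ^ j * Real.log m₂ := by
    rw [expA]
    have : (q : ℝ) - 1 ≠ 0 := by linarith
    field_simp
    ring
  -- After cancellation `(1 + q^j) log m₂ ≤ 2 q^j log m₂` remains; the constant `2` in the bound for
  -- `t` is chosen for this.
  rw [e1, e2]
  nlinarith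

theorem IsTreeVector.unique (hm₂ : 2 ≤ m₂) (hm : m₂ ≤ m₁) {q : ℕ} (hq : 2 ≤ q) {j : ℕ}
    {Ω : Set (Symb m₁ m₂)} {t t' : GWord m₁ m₂ → ℝ} (h : IsTreeVector q j Ω t)
    (h' : IsTreeVector q j Ω t') : t' = t := by
  rw [isTreeVector_iff] at h h'
  have hq' : (1 : ℝ) < q := by exact_mod_cast hq
  have ha := expA_pos hm₂ hm hq j
  have hM := one_le_treeBound (m₁ := m₁) hm₂ hq
  funext u
  exact le_antisymm
    (tree_fixed_point_le ha hq' hM h'.1 h.1 h'.2.1 h.2.1 h'.2.2 h.2.2 u)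
    (tree_fixed_point_le ha hq' hM h.1 h'.1 h.2.1 h'.2.1 h.2.2 h'.2.2 u)

end MultCarpet

/-! ### The optimal measure. -/

namespace MultCarpet

variable {m₁ m₂ q j : ℕ} {Ω : Set (Symb m₁ m₂)} {t : GWord m₁ m₂ → ℝ}

theorem IsTreeVector.nonneg (h : IsTreeVector q j Ω t) (u : GWord m₁ m₂) : 0 ≤ t u := by
  by_cases hu : u ∈ treeSet Ω j
  · obtain ⟨k, hk, hu⟩ := hu
    linarith [(h.mem_Icc k hk u hu).1]
  · exact (h.off_tree u hu).ge

theorem IsTreeVector.one_le (h : IsTreeVector q j Ω t) {z : Symb m₁ m₂} (hz : z ∈ Ω) {k : ℕ}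
    (hk : 1 ≤ k) : 1 ≤ t (gPrefix k j z) := (h.mem_Icc k hk _ (gPrefix_mem_Pref hz k j)).1

theorem IsTreeVector.one_le_colSum (h : IsTreeVector q j Ω t) {z : Symb m₁ m₂} (hz : z ∈ Ω)
    (k l : ℕ) : 1 ≤ colSum t (gPrefix k l z).1 (gPrefix k (j + 1) z).2 :=
  (h.one_le hz (Nat.succ_le_succ (Nat.zero_le k))).trans (le_colSum_gPrefix h.nonneg k j l z)

theorem nestSum_nonneg (h : ∀ u, 0 ≤ t u) (p : ℕ) (v : List (Fin m₂)) :
    0 ≤ nestSum q j t p v := by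
  cases p with
  | zero => exact Finset.sum_nonneg fun y _ => Real.rpow_nonneg (colSum_nonneg h _ _) _
  | succ p =>
    exact Finset.sum_nonneg fun y _ => Real.rpow_nonneg (nestSum_nonneg h p _) _

/-- A point of `Ω` contributes a term at least `1` at every level of the nesting. This positivity
legitimises the negative powers and the logarithms below. -/
theorem IsTreeVector.one_le_nestSum (h : IsTreeVector q j Ω t) {z : Symb m₁ m₂} (hz : z ∈ Ω)
    (p : ℕ) (hp : p ≤ j) : 1 ≤ nestSum q j t p (gPrefix 0 (j - p) z).2 := by
  induction p with
  | zero =>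
    have h1 := h.one_le_colSum hz 0 0
    rw [← gPrefix_snd_concat] at h1
    refine (Real.one_le_rpow h1 (mul_nonneg (pow_nonneg (Nat.cast_nonneg q) j)
      (gam_nonneg m₁ m₂))).trans (Finset.single_le_sum
        (f := fun y => colSum t [] ((gPrefix 0 j z).2 ++ [y]) ^ ((q : ℝ) ^ j * gam m₁ m₂))
        (fun y _ => Real.rpow_nonneg (colSum_nonneg h.nonneg _ _) _) (Finset.mem_univ _))
  | succ p ih =>
    have h1 := ih (by omega)
    rw [show j - p = j - (p + 1) + 1 by omega, ← gPrefix_snd_concat] at h1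
    refine (Real.one_le_rpow h1 (by positivity)).trans (Finset.single_le_sum
        (f := fun y => nestSum q j t p ((gPrefix 0 (j - (p + 1)) z).2 ++ [y]) ^ (1 / (q : ℝ)))
        (fun y _ => Real.rpow_nonneg (nestSum_nonneg h.nonneg _ _) _) (Finset.mem_univ _))

theorem IsTreeVector.one_le_tRoot (h : IsTreeVector q j Ω t) (hne : Ω.Nonempty) :
    1 ≤ tRoot q j t := by
  obtain ⟨z, hz⟩ := hne
  simpa [tRoot, gPrefix] using h.one_le_nestSum hz j le_rfl

theorem yWord_concat (l : List (Fin m₁ × Fin m₂)) (x : Fin m₁) (c y : Fin m₂)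
    (r v : List (Fin m₂)) (h : c :: r = v ++ [y]) :
    yWord (l ++ [(x, c)], r) = yWord (l, v) ++ [y] := by
  simp [yWord, h]

theorem length_yWord (u : GWord m₁ m₂) : (yWord u).length = u.1.length + u.2.length := by
  simp [yWord]

theorem take_drop_append {α : Type*} (l l' : List α) {i n : ℕ} (h : i + n ≤ l.length) :
    ((l ++ l').drop i).take n = (l.drop i).take n := by
  rw [List.drop_append_of_le_length (by omega), List.take_append_of_le_length]
  rw [List.length_drop]; omega

/-- The mass prescribed for the word `u`. -/
noncomputable def optW (q j : ℕ) (t : GWord m₁ m₂ → ℝ) (u : GWord m₁ m₂) : ℝ :=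
  optWeight q j u.1.length t u

/-- The product of the powers of the nested sums in the prescribed mass. -/
noncomputable def nestFactor (q j : ℕ) (t : GWord m₁ m₂ → ℝ) (n : ℕ) (y : List (Fin m₂)) : ℝ :=
  ∏ p ∈ Finset.Ico n j, nestSum q j t p (y.take (j - p)) ^ ((1 - (q : ℝ)) / q)

theorem nestFactor_append {n : ℕ} {y y' : List (Fin m₂)} (h : j ≤ y.length + n) :
    nestFactor q j t n (y ++ y') = nestFactor q j t n y := by
  refine Finset.prod_congr rfl fun p hp => ?_
  rw [Finset.mem_Ico] at hp
  rw [List.take_append_of_le_length (by omega)]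

/-- The factors with index `p ≤ l.length` only read second coordinates up to position `l.length +
j`, which both words share, so one more letter contributes exactly one more factor. The condition `c
:: r = v ++ [y]` expresses the shift of the trailing window. -/
theorem optW_concat {l : List (Fin m₁ × Fin m₂)} (hl : l ≠ []) {v r : List (Fin m₂)}
    (hv : v.length = j) {c y : Fin m₂} (h : c :: r = v ++ [y]) (x : Fin m₁) :
    optW q j t (l ++ [(x, c)], r) = optW q j t (l, v) * (t (l ++ [(x, c)], r) *
      colSum t l (c :: r) ^ (expA m₁ m₂ q j - 1) / t (l, v) ^ ((q : ℝ) * expA m₁ m₂ q j)) := by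
  have hk : 1 ≤ l.length := List.length_pos_iff.2 hl
  have hr : r.length = j := by
    have := congrArg List.length h
    simp at this; omega
  have hy := yWord_concat l x c y r v h
  have hlen : (yWord (l, v)).length = l.length + j := by rw [length_yWord, hv]
  have hcut : ∀ p ≤ l.length, cut j p (l ++ [(x, c)], r) = cut j p (l, v) := by
    intro p hp
    refine Prod.ext ?_ ?_
    · simp [cut, List.take_append_of_le_length hp]
    · simp only [cut]
      rw [hy, take_drop_append _ _ (by omega)]
  have hcol : ∀ p, 1 ≤ p → p ≤ l.length →
      colSumAt j p t (l ++ [(x, c)], r) = colSumAt j p t (l, v) := by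
    intro p hp hp'
    simp only [colSumAt]
    rw [hy, take_drop_append _ _ (by omega), List.take_append_of_le_length (by omega)]
  have hyl : yWord (l ++ [(x, c)], r) = l.map Prod.snd ++ c :: r := by simp [yWord]
  have hd1 : (yWord (l ++ [(x, c)], r)).drop l.length = c :: r := by
    rw [hyl, List.drop_left' (by simp)]
  have hcut1 : cut j (l.length + 1) (l ++ [(x, c)], r) = (l ++ [(x, c)], r) := by
    refine Prod.ext ?_ ?_
    · simp [cut]
    · simp only [cut]
      rw [← List.drop_drop, hd1]
      simp [← hr]
  have hcol1 : colSumAt j (l.length + 1) t (l ++ [(x, c)], r) = colSum t l (c :: r) := by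
    simp only [colSumAt, Nat.add_sub_cancel]
    rw [hd1, List.take_left' rfl, List.take_of_length_le (by simp [hr])]
  have hcut2 : cut j l.length (l, v) = (l, v) := by
    refine Prod.ext ?_ ?_
    · simp [cut]
    · simp [cut, yWord, hv]
  have hprod : ∏ p ∈ Finset.range j, nestSum q j t p ((yWord (l ++ [(x, c)], r)).take (j - p)) ^
        ((1 - (q : ℝ)) / q) =
      ∏ p ∈ Finset.range j, nestSum q j t p ((yWord (l, v)).take (j - p)) ^
        ((1 - (q : ℝ)) / q) := by
    rw [hy]
    exact Finset.prod_congr rfl fun p hp => by rw [List.take_append_of_le_length (by omega)]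
  have e : (q : ℝ) ^ (j + 1) * gam m₁ m₂ = (q : ℝ) * expA m₁ m₂ q j := by rw [expA]; ring
  simp only [optW, optWeight]
  rw [List.length_append, List.length_singleton, Finset.prod_Icc_succ_top (by omega), hprod,
    hcut 1 hk, hcol 1 le_rfl hk, hcut1, hcol1, Nat.add_sub_cancel, hcut _ le_rfl, hcut2, e]
  have hIcc : ∀ p ∈ Finset.Icc 2 l.length,
      t (cut j p (l ++ [(x, c)], r)) *
          colSumAt j p t (l ++ [(x, c)], r) ^ ((q : ℝ) ^ j * gam m₁ m₂ - 1) /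
          t (cut j (p - 1) (l ++ [(x, c)], r)) ^ ((q : ℝ) * expA m₁ m₂ q j) =
        t (cut j p (l, v)) * colSumAt j p t (l, v) ^ ((q : ℝ) ^ j * gam m₁ m₂ - 1) /
          t (cut j (p - 1) (l, v)) ^ ((q : ℝ) * expA m₁ m₂ q j) := by
    intro p hp
    rw [Finset.mem_Icc] at hp
    rw [hcut p hp.2, hcol p (by omega) hp.2, hcut (p - 1) (by omega)]
  rw [Finset.prod_congr rfl hIcc]
  simp only [expA]
  ring

theorem optW_singleton {v r : List (Fin m₂)} (hv : v.length = j) {c y : Fin m₂}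
    (h : c :: r = v ++ [y]) (x : Fin m₁) :
    optW q j t ([(x, c)], r) = t ([(x, c)], r) * colSum t [] (c :: r) ^ (expA m₁ m₂ q j - 1) /
      tRoot q j t * nestFactor q j t 0 v := by
  have hr : r.length = j := by
    have := congrArg List.length h
    simp at this; omega
  have hy : yWord ([(x, c)], r) = v ++ [y] := by simp [yWord, ← h]
  have hy' : yWord ([(x, c)], r) = c :: r := by simp [yWord]
  have h1 : cut j 1 ([(x, c)], r) = ([(x, c)], r) := by
    simp [cut, hy', hr]
  have h2 : colSumAt j 1 t ([(x, c)], r) = colSum t [] (c :: r) := by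
    simp only [colSumAt, hy']
    simp [← hr]
  have h3 := nestFactor_append (q := q) (t := t) (n := 0) (y := v) (y' := [y]) (j := j) (by omega)
  rw [optW, optWeight, h1, h2, hy, ← h3, nestFactor]
  simp [expA]

/-- The number `t u` is a factor of the last fraction, or of the leading one when the word has a
single full letter. -/
theorem optW_eq_zero {u : GWord m₁ m₂} (hl : u.1 ≠ []) (hv : u.2.length = j) (h : t u = 0) :
    optW q j t u = 0 := by
  have hk : 1 ≤ u.1.length := List.length_pos_iff.2 hl
  have hcut : cut j u.1.length u = u := by
    refine Prod.ext ?_ ?_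
    · simp [cut]
    · simp [cut, yWord, hv]
  rw [optW, optWeight]
  rcases hk.eq_or_lt with h1 | h1
  · rw [← h1] at hcut
    rw [hcut, h]
    simp
  · have : ∏ p ∈ Finset.Icc 2 u.1.length,
        t (cut j p u) * colSumAt j p t u ^ ((q : ℝ) ^ j * gam m₁ m₂ - 1)
          / t (cut j (p - 1) u) ^ ((q : ℝ) ^ (j + 1) * gam m₁ m₂) = 0 :=
      Finset.prod_eq_zero (Finset.mem_Icc.2 ⟨h1, le_rfl⟩) (by rw [hcut, h]; simp)
    rw [this, mul_zero]

theorem colSumAt_nonneg (h : ∀ u, 0 ≤ t u) (p : ℕ) (u : GWord m₁ m₂) : 0 ≤ colSumAt j p t u :=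
  colSum_nonneg h _ _

theorem optW_nonneg (h : ∀ u, 0 ≤ t u) (u : GWord m₁ m₂) : 0 ≤ optW q j t u := by
  refine mul_nonneg (mul_nonneg (div_nonneg (mul_nonneg (h _)
    (Real.rpow_nonneg (colSumAt_nonneg h _ _) _)) (nestSum_nonneg h _ _))
    (Finset.prod_nonneg fun p _ => Real.rpow_nonneg (nestSum_nonneg h _ _) _))
    (Finset.prod_nonneg fun p _ => div_nonneg (mul_nonneg (h _)
    (Real.rpow_nonneg (colSumAt_nonneg h _ _) _)) (Real.rpow_nonneg (h _) _))

theorem mul_rpow_sub_one {x a : ℝ} (hx : 0 ≤ x) (ha : 0 < a) : x * x ^ (a - 1) = x ^ a := by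
  rcases hx.eq_or_lt with rfl | hx
  · rw [zero_mul, Real.zero_rpow ha.ne']
  · rw [Real.rpow_sub_one hx.ne', mul_div_cancel₀ _ hx.ne']

/-- Only the value of `t` depends on the summation letter, so `C · C^(a-1) = C^a` with `C` the
column sum. Since `a > 0` this holds even for `C = 0`, and no separate treatment off the tree is
needed. -/
theorem colSum_optW (h : ∀ u, 0 ≤ t u) (ha : 0 < expA m₁ m₂ q j)
    {l : List (Fin m₁ × Fin m₂)} (hl : l ≠ []) {v : List (Fin m₂)} (hv : v.length = j)
    (y : Fin m₂) :
    colSum (optW q j t) l (v ++ [y]) = optW q j t (l, v) *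
      (colSum t l (v ++ [y]) ^ expA m₁ m₂ q j / t (l, v) ^ ((q : ℝ) * expA m₁ m₂ q j)) := by
  obtain ⟨c, r, hcr⟩ : ∃ c r, v ++ [y] = c :: r := by
    cases v with
    | nil => exact ⟨_, _, rfl⟩
    | cons c v => exact ⟨_, _, rfl⟩
  rw [hcr, ← mul_rpow_sub_one (colSum_nonneg h _ _) ha]
  nth_rw 2 [colSum]
  simp only [colSum, optW_concat hl hv hcr.symm, Finset.sum_mul, Finset.mul_sum, Finset.sum_div]

theorem colSum_optW_nil (h : ∀ u, 0 ≤ t u) (ha : 0 < expA m₁ m₂ q j)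
    {v : List (Fin m₂)} (hv : v.length = j) (y : Fin m₂) :
    colSum (optW q j t) [] (v ++ [y]) =
      colSum t [] (v ++ [y]) ^ expA m₁ m₂ q j / tRoot q j t * nestFactor q j t 0 v := by
  obtain ⟨c, r, hcr⟩ : ∃ c r, v ++ [y] = c :: r := by
    cases v with
    | nil => exact ⟨_, _, rfl⟩
    | cons c v => exact ⟨_, _, rfl⟩
  rw [hcr, ← mul_rpow_sub_one (colSum_nonneg h _ _) ha]
  nth_rw 2 [colSum]
  simp only [colSum, List.nil_append, optW_singleton hv hcr.symm, Finset.sum_mul, Finset.sum_div]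

/-- The prescribed mass, extended to words without letters of the first alphabet. -/
noncomputable def optExt (q j : ℕ) (t : GWord m₁ m₂ → ℝ) (u : GWord m₁ m₂) : ℝ :=
  if u.1 = [] then ∑ y, colSum (optW q j t) [] (u.2 ++ [y]) else optW q j t u

theorem colSum_optExt (l : List (Fin m₁ × Fin m₂)) (v : List (Fin m₂)) :
    colSum (optExt q j t) l v = colSum (optW q j t) l v := by
  cases v <;> simp [colSum, optExt]

theorem optExt_nonneg (h : ∀ u, 0 ≤ t u) (u : GWord m₁ m₂) : 0 ≤ optExt q j t u := by
  rw [optExt]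
  split_ifs
  · exact Finset.sum_nonneg fun y _ => colSum_nonneg (optW_nonneg h) _ _
  · exact optW_nonneg h u

/-- On the tree this is the equation for `t` divided by its left-hand side; off the tree both sides
vanish. Without full letters it holds by the definition of the extension. -/
theorem IsTreeVector.optExt_eq_sum (h : IsTreeVector q j Ω t) (ha : 0 < expA m₁ m₂ q j)
    (l : List (Fin m₁ × Fin m₂)) (v : List (Fin m₂)) (hv : v.length = j) :
    optExt q j t (l, v) = ∑ y, colSum (optExt q j t) l (v ++ [y]) := by
  simp only [colSum_optExt]
  by_cases hl : l = []
  · simp [optExt, hl]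
  · simp only [optExt, hl, if_false, colSum_optW h.nonneg ha hl hv, ← Finset.mul_sum,
      ← Finset.sum_div]
    by_cases hu : (l, v) ∈ treeSet Ω j
    · have h1 := (isTreeVector_iff.1 h).2.2 _ hu
      rw [branchSum] at h1
      have h2 := ((isTreeVector_iff.1 h).2.1 _ hu).1
      rw [← h1, div_self, mul_one]
      exact (Real.rpow_pos_of_pos (by linarith) _).ne'
    · rw [optW_eq_zero (u := (l, v)) hl hv (h.off_tree _ hu), zero_mul]

/-- Summing out a second coordinate turns `S · S^((1-q)/q)` into `S^(1/q)`, the summand of the next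
nested sum. Hence the total mass is `1`, and the masses of short words of second coordinates become
explicit. -/
theorem sumExt_optExt_nil (h : ∀ u, 0 ≤ t u) (ha : 0 < expA m₁ m₂ q j) (hq : 2 ≤ q) (n : ℕ)
    (v : List (Fin m₂)) (hv : v.length + n = j) :
    sumExt (optExt q j t) n ([], v) =
      nestSum q j t n v / tRoot q j t * nestFactor q j t n v := by
  have hq' : (0 : ℝ) < q := by exact_mod_cast (by omega : 0 < q)
  induction n generalizing v with
  | zero =>
    simp only [sumExt, optExt, if_true, colSum_optW_nil h ha (show v.length = j from hv)]
    rw [← Finset.sum_mul, ← Finset.sum_div]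
    rfl
  | succ n ih =>
    simp only [sumExt, nestSum]
    rw [Finset.sum_div, Finset.sum_mul]
    refine Finset.sum_congr rfl fun y _ => ?_
    rw [ih (v ++ [y]) (by simp; omega)]
    have h1 : nestFactor q j t n (v ++ [y]) =
        nestSum q j t n (v ++ [y]) ^ ((1 - (q : ℝ)) / q) * nestFactor q j t (n + 1) v := by
      rw [nestFactor, Finset.prod_eq_prod_Ico_succ_bot (by omega), List.take_of_length_le
        (by simp; omega), ← nestFactor, nestFactor_append (by omega)]
    have h2 : nestSum q j t n (v ++ [y]) ^ (1 / (q : ℝ)) =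
        nestSum q j t n (v ++ [y]) * nestSum q j t n (v ++ [y]) ^ ((1 - (q : ℝ)) / q) := by
      rw [sub_div, div_self hq'.ne']
      exact (mul_rpow_sub_one (nestSum_nonneg h _ _) (by positivity)).symm
    rw [h1, h2]
    ring

theorem IsTreeVector.exists_measure (h : IsTreeVector q j Ω t) (hm₂ : 2 ≤ m₂) (hm : m₂ ≤ m₁)
    (hq : 2 ≤ q) (hne : Ω.Nonempty) :
    ∃ μ : Measure (Symb m₁ m₂), IsProbabilityMeasure μ ∧
      ∀ v l n, v.length + n = j →
        μ (cyl (l, v)) = ENNReal.ofReal (sumExt (optExt q j t) n (l, v)) := by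
  have ha := expA_pos hm₂ hm hq j
  refine exists_measure_of_weights hm₂ hm (optExt_nonneg h.nonneg) (h.optExt_eq_sum ha) ?_
  rw [sumExt_optExt_nil h.nonneg ha hq j [] (by simp), ← tRoot, div_self]
  · simp [nestFactor]
  · linarith [h.one_le_tRoot hne]

theorem measure_cyl_of_sumExt {μ : Measure (Symb m₁ m₂)}
    (hμ : ∀ v l n, v.length + n = j →
        μ (cyl (l, v)) = ENNReal.ofReal (sumExt (optExt q j t) n (l, v)))
    {u : GWord m₁ m₂} (h1 : u.1 ≠ []) (h2 : u.2.length = j) :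
    μ (cyl u) = ENNReal.ofReal (optW q j t u) := by
  have := hμ u.2 u.1 0 h2
  simpa [sumExt, optExt, h1] using this

/-- As `Ω` is closed, its complement is a countable union of cylinders missing `Ω`; these are off
the tree, where the weights vanish. -/
theorem IsTreeVector.isOptMeasure (h : IsTreeVector q j Ω t) (hm₂ : 2 ≤ m₂) (hm : m₂ ≤ m₁)
    (hΩ : IsClosed Ω) {μ : Measure (Symb m₁ m₂)} [IsProbabilityMeasure μ]
    (hμ : ∀ v l n, v.length + n = j →
        μ (cyl (l, v)) = ENNReal.ofReal (sumExt (optExt q j t) n (l, v))) :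
    IsOptMeasure q j Ω t μ := by
  refine ⟨inferInstance, ?_, fun k hk u hu => ?_⟩
  · rw [eq_iUnion_cyl_of_isOpen hm₂ hm j hΩ.isOpen_compl]
    refine (measure_biUnion_null_iff (Set.to_countable _)).2 fun u hu => ?_
    obtain ⟨h1, h2, h3⟩ := hu
    have hu' : u ∉ treeSet Ω j := by
      rintro ⟨k, -, -, -, z, hz, hz'⟩
      exact h3 hz' hz
    have h1' : u.1 ≠ [] := List.length_pos_iff.1 h1
    rw [measure_cyl_of_sumExt hμ h1' h2, optW_eq_zero h1' h2 (h.off_tree u hu'), ENNReal.ofReal_zero]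
  · have h1 : u.1 ≠ [] := List.length_pos_iff.1 (by rw [hu.1]; exact hk)
    rw [measure_cyl_of_sumExt hμ h1 hu.2.1, optW, hu.1]

theorem IsOptMeasure.unique (hm₂ : 2 ≤ m₂) (hm : m₂ ≤ m₁) {μ μ' : Measure (Symb m₁ m₂)}
    (h : IsOptMeasure q j Ω t μ) (h' : IsOptMeasure q j Ω t μ') : μ' = μ := by
  refine measure_eq_of_cyl hm₂ hm j h'.prob h.prob fun p hp z => ?_
  by_cases hz : gPrefix p j z ∈ Pref Ω p j
  · rw [h'.mass p hp _ hz, h.mass p hp _ hz]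
  · have hsub : cyl (gPrefix p j z) ⊆ Ωᶜ := fun w hw hwΩ =>
      hz ⟨by simp [gPrefix], by simp [gPrefix], w, hwΩ, hw⟩
    rw [measure_mono_null hsub h'.supp, measure_mono_null hsub h.supp]

end MultCarpet

/-! ### Multiplicative chains and the measure `ℙ_μ`. -/

namespace MultCarpet

variable {m₁ m₂ q : ℕ}

theorem padicValNat_mul_pow (hq : 2 ≤ q) {i : ℕ} (hi : ¬ q ∣ i) (l : ℕ) :
    padicValNat q (i * q ^ l) = l := by
  have hi0 : i ≠ 0 := by rintro rfl; exact hi (dvd_zero q)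
  rw [mul_comm, padicValNat_base_pow_mul (by omega) hi0,
    padicValNat.eq_zero_iff.2 (Or.inr (Or.inr hi)), Nat.zero_add]

theorem divMaxPow_mul_pow (hq : 2 ≤ q) {i : ℕ} (hi : ¬ q ∣ i) (l : ℕ) :
    Nat.divMaxPow (i * q ^ l) q = i := by
  have h := Nat.divMaxPow_mul_pow_padicValNat q (i * q ^ l)
  rw [padicValNat_mul_pow hq hi] at h
  exact Nat.eq_of_mul_eq_mul_right (pow_pos (by omega) l) h

theorem pos_of_not_dvd {i : ℕ} (hi : ¬ q ∣ i) : 0 < i :=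
  Nat.pos_of_ne_zero fun h => hi (h ▸ dvd_zero q)

/-- The number of `l ≥ 0` with `i q ^ l ≤ N`. -/
def chainCount (q N i : ℕ) : ℕ := if i ≤ N then Nat.log q (N / i) + 1 else 0

theorem lt_chainCount (hq : 2 ≤ q) {N i l : ℕ} (hi : 0 < i) :
    l < chainCount q N i ↔ i * q ^ l ≤ N := by
  have hql : 0 < q ^ l := pow_pos (by omega) l
  rw [chainCount]
  split_ifs with h
  · rw [Nat.lt_succ_iff, Nat.le_log_iff_pow_le (by omega) (Nat.div_pos h hi).ne',
      Nat.le_div_iff_mul_le hi, mul_comm]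
  · have : i ≤ i * q ^ l := Nat.le_mul_of_pos_right i hql
    omega

theorem chainCount_mono (hq : 2 ≤ q) {n N i : ℕ} (hi : 0 < i) (h : n ≤ N) :
    chainCount q n i ≤ chainCount q N i := by
  by_contra! hlt
  exact lt_irrefl _ ((lt_chainCount hq hi).2 (((lt_chainCount hq hi).1 hlt).trans h))

/-- The first elements `i ≤ N`, `q ∤ i`, of the chains `{i, i q, i q ^ 2, …}`. -/
def chainHeads (q N : ℕ) : Finset ℕ := (Finset.Icc 1 N).filter fun i => ¬ q ∣ i

theorem mem_chainHeads {N i : ℕ} : i ∈ chainHeads q N ↔ i ≤ N ∧ ¬ q ∣ i := by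
  simp only [chainHeads, Finset.mem_filter, Finset.mem_Icc]
  constructor
  · rintro ⟨⟨-, h⟩, h'⟩; exact ⟨h, h'⟩
  · rintro ⟨h, h'⟩; exact ⟨⟨pos_of_not_dvd h', h⟩, h'⟩

/-- The point whose restriction to the chain of `i` is `ω i`, for all `i` with `q ∤ i`. -/
def interleave (q : ℕ) (ω : ℕ → Symb m₁ m₂) : Symb m₁ m₂ :=
  ⟨fun k => (ω (Nat.divMaxPow (k + 1) q)).seq (padicValNat q (k + 1))⟩

theorem interleave_seq (hq : 2 ≤ q) (ω : ℕ → Symb m₁ m₂) {i : ℕ} (hi : ¬ q ∣ i) (l : ℕ) :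
    (interleave q ω).seq (i * q ^ l - 1) = (ω i).seq l := by
  have h : i * q ^ l - 1 + 1 = i * q ^ l :=
    Nat.sub_add_cancel (Nat.mul_pos (pos_of_not_dvd hi) (pow_pos (by omega) l))
  simp only [interleave, h, divMaxPow_mul_pow hq hi, padicValNat_mul_pow hq hi]

theorem alongJ_interleave (hq : 2 ≤ q) (ω : ℕ → Symb m₁ m₂) {i : ℕ} (hi : ¬ q ∣ i) :
    alongJ q i (interleave q ω) = ω i :=
  Symb.ext (funext fun l => interleave_seq hq ω hi l)

theorem exists_chain_index (hq : 2 ≤ q) (k : ℕ) : ∃ i l, ¬ q ∣ i ∧ i * q ^ l = k + 1 :=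
  ⟨_, _, Nat.not_dvd_divMaxPow (by omega) (Nat.succ_ne_zero k),
    Nat.divMaxPow_mul_pow_padicValNat q (k + 1)⟩

/-- Every positive integer is `i q^v` for a unique `i` with `q ∤ i`, so the constraints sort
themselves by chain: full letters at positions up to `n`, second coordinates up to `n + l`. -/
theorem interleave_mem_cyl_iff (hq : 2 ≤ q) (ω : ℕ → Symb m₁ m₂) (z : Symb m₁ m₂) (n l : ℕ) :
    interleave q ω ∈ cyl (gPrefix n l z) ↔ ∀ i ∈ chainHeads q (n + l),
      ω i ∈ cyl (gPrefix (chainCount q n i) (chainCount q (n + l) i - chainCount q n i)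
        (alongJ q i z)) := by
  simp only [mem_cyl_gPrefix]
  constructor
  · rintro ⟨h1, h2⟩ i hi
    obtain ⟨hiN, hqi⟩ := mem_chainHeads.1 hi
    have hi0 := pos_of_not_dvd hqi
    refine ⟨fun k hk => ?_, fun k hk => ?_⟩
    · have hk' := (lt_chainCount hq hi0).1 hk
      have hpos : 0 < i * q ^ k := Nat.mul_pos hi0 (pow_pos (by omega) k)
      rw [← interleave_seq hq ω hqi k]
      exact h1 _ (by omega)
    · have hk' := (lt_chainCount hq hi0).1 (show chainCount q n i + k < chainCount q (n + l) i by
        omega)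
      have hk'' : ¬ i * q ^ (chainCount q n i + k) ≤ n := fun h => by
        have := (lt_chainCount hq hi0).2 h
        omega
      rw [← interleave_seq hq ω hqi]
      have := h2 (i * q ^ (chainCount q n i + k) - 1 - n) (by omega)
      rwa [show n + (i * q ^ (chainCount q n i + k) - 1 - n) =
        i * q ^ (chainCount q n i + k) - 1 by omega] at this
  · intro h
    have hboth : ∀ k < n + l, (k < n → (interleave q ω).seq k = z.seq k) ∧
        ((interleave q ω).seq k).2 = (z.seq k).2 := by
      intro k hk
      obtain ⟨i, v, hqi, hiv⟩ := exists_chain_index hq k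
      have hi0 := pos_of_not_dvd hqi
      have hle : i ≤ i * q ^ v := Nat.le_mul_of_pos_right i (pow_pos (by omega) v)
      obtain ⟨h1, h2⟩ := h i (mem_chainHeads.2 ⟨by omega, hqi⟩)
      have hv : v < chainCount q (n + l) i := (lt_chainCount hq hi0).2 (by omega)
      have ek : k = i * q ^ v - 1 := by omega
      have e1 : (interleave q ω).seq k = (ω i).seq v := by rw [ek, interleave_seq hq ω hqi]
      have e2 : z.seq k = (alongJ q i z).seq v := by rw [ek]; rfl
      rw [e1, e2]
      refine ⟨fun hkn => h1 v ((lt_chainCount hq hi0).2 (by omega)), ?_⟩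
      rcases lt_or_ge v (chainCount q n i) with hlt | hge
      · rw [h1 v hlt]
      · have := h2 (v - chainCount q n i) (by omega)
        rwa [Nat.add_sub_cancel' hge] at this
    exact ⟨fun k hk => (hboth k (by omega)).1 hk, fun k hk => (hboth _ (by omega)).2⟩

theorem measurable_interleave (hm₂ : 2 ≤ m₂) (hm : m₂ ≤ m₁) (q : ℕ) :
    Measurable (interleave (m₁ := m₁) (m₂ := m₂) q) :=
  measurable_to_symb hm₂ hm fun k =>
    (measurable_seq hm₂ hm (padicValNat q (k + 1))).comp
      (measurable_pi_apply (Nat.divMaxPow (k + 1) q))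

theorem measurable_alongJ (hm₂ : 2 ≤ m₂) (hm : m₂ ≤ m₁) (q i : ℕ) :
    Measurable (alongJ (m₁ := m₁) (m₂ := m₂) q i) :=
  measurable_to_symb hm₂ hm fun _ => measurable_seq hm₂ hm _

/-- The measure `ℙ_μ`. -/
noncomputable def multMeasure (q : ℕ) (μ : Measure (Symb m₁ m₂)) : Measure (Symb m₁ m₂) :=
  (Measure.infinitePi fun _ : ℕ => μ).map (interleave q)

theorem multMeasure_cyl (hm₂ : 2 ≤ m₂) (hm : m₂ ≤ m₁) (hq : 2 ≤ q) (μ : Measure (Symb m₁ m₂))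
    [IsProbabilityMeasure μ] (n l : ℕ) (z : Symb m₁ m₂) :
    multMeasure q μ (cyl (gPrefix n l z)) = ∏ i ∈ chainHeads q (n + l),
      μ (cyl (gPrefix (chainCount q n i) (chainCount q (n + l) i - chainCount q n i)
        (alongJ q i z))) := by
  rw [multMeasure, Measure.map_apply (measurable_interleave hm₂ hm q) (measurableSet_cyl hm₂ hm _),
    ← Measure.infinitePi_pi (fun _ : ℕ => μ) fun i _ => measurableSet_cyl hm₂ hm _]
  congr 1
  ext ω
  rw [Set.mem_preimage, interleave_mem_cyl_iff hq]
  rfl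

theorem isProbabilityMeasure_multMeasure (hm₂ : 2 ≤ m₂) (hm : m₂ ≤ m₁) (q : ℕ)
    (μ : Measure (Symb m₁ m₂)) [IsProbabilityMeasure μ] :
    IsProbabilityMeasure (multMeasure q μ) :=
  Measure.isProbabilityMeasure_map (measurable_interleave hm₂ hm q).aemeasurable

theorem isMultMeasure_multMeasure (hm₂ : 2 ≤ m₂) (hm : m₂ ≤ m₁) (hq : 2 ≤ q)
    (μ : Measure (Symb m₁ m₂)) [IsProbabilityMeasure μ] :
    IsMultMeasure q μ (multMeasure q μ) := by
  refine ⟨isProbabilityMeasure_multMeasure hm₂ hm q μ, fun n _ z => ?_⟩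
  rw [multMeasure_cyl hm₂ hm hq]
  refine Finset.prod_congr rfl fun i hi => ?_
  have hi' : i ≤ n := (mem_chainHeads.1 hi).1
  simp [chainCount, hi']

theorem IsMultMeasure.unique (hm₂ : 2 ≤ m₂) (hm : m₂ ≤ m₁) {μ P P' : Measure (Symb m₁ m₂)}
    (h : IsMultMeasure q μ P) (h' : IsMultMeasure q μ P') : P' = P :=
  measure_eq_of_cyl hm₂ hm 0 h'.prob h.prob fun p hp z => by rw [h'.mass p hp z, h.mass p hp z]

/-- There are countably many chains, and the restriction to each has law `μ`. -/
theorem multMeasure_compl_multSet (hm₂ : 2 ≤ m₂) (hm : m₂ ≤ m₁) (hq : 2 ≤ q)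
    {μ : Measure (Symb m₁ m₂)} [IsProbabilityMeasure μ] {Ω : Set (Symb m₁ m₂)}
    (hΩ : MeasurableSet Ω) (h : μ Ωᶜ = 0) : multMeasure q μ (multSet q Ω)ᶜ = 0 := by
  have e : (multSet q Ω)ᶜ = ⋃ i ∈ {i : ℕ | ¬ q ∣ i}, alongJ q i ⁻¹' Ωᶜ := by
    ext z
    simp [multSet]
  rw [e]
  refine (measure_biUnion_null_iff (Set.to_countable _)).2 fun i hi => ?_
  rw [multMeasure, Measure.map_apply (measurable_interleave hm₂ hm q)
    (measurable_alongJ hm₂ hm q i hΩ.compl)]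
  have e' : interleave q ⁻¹' (alongJ q i ⁻¹' Ωᶜ) =
      (Function.eval i : (ℕ → Symb m₁ m₂) → Symb m₁ m₂) ⁻¹' Ωᶜ := by
    ext ω
    simp only [Set.mem_preimage]
    rw [alongJ_interleave hq ω hi]
  rw [e', (measurePreserving_eval_infinitePi (fun _ : ℕ => μ) i).measure_preimage
    hΩ.compl.nullMeasurableSet, h]

/-- Summation along chains. -/
theorem sum_chainHeads_sum (hq : 2 ≤ q) {N N' : ℕ} (h : N ≤ N') (f : ℕ → ℝ) :
    ∑ i ∈ chainHeads q N', ∑ l ∈ Finset.range (chainCount q N i), f (i * q ^ l) =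
      ∑ m ∈ Finset.Icc 1 N, f m := by
  rw [Finset.sum_sigma']
  refine Finset.sum_bij' (fun x _ => x.1 * q ^ x.2)
    (fun m _ => ⟨Nat.divMaxPow m q, padicValNat q m⟩) ?_ ?_ ?_ ?_ ?_
  · rintro ⟨i, l⟩ hx
    rw [Finset.mem_sigma, mem_chainHeads, Finset.mem_range] at hx
    have hi0 := pos_of_not_dvd hx.1.2
    exact Finset.mem_Icc.2 ⟨Nat.mul_pos hi0 (pow_pos (by omega) _), (lt_chainCount hq hi0).1 hx.2⟩
  · intro m hm
    rw [Finset.mem_Icc] at hm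
    have hqi := Nat.not_dvd_divMaxPow (p := q) (n := m) (by omega) (by omega)
    have hmul := Nat.divMaxPow_mul_pow_padicValNat q m
    have hle : Nat.divMaxPow m q ≤ Nat.divMaxPow m q * q ^ padicValNat q m :=
      Nat.le_mul_of_pos_right _ (pow_pos (by omega) _)
    rw [Finset.mem_sigma, mem_chainHeads, Finset.mem_range, lt_chainCount hq (pos_of_not_dvd hqi)]
    exact ⟨⟨hle.trans (by omega), hqi⟩, hmul.le.trans hm.2⟩
  · rintro ⟨i, l⟩ hx
    rw [Finset.mem_sigma, mem_chainHeads] at hx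
    simp only [divMaxPow_mul_pow hq hx.1.2, padicValNat_mul_pow hq hx.1.2]
  · intro m _
    exact Nat.divMaxPow_mul_pow_padicValNat q m
  · intro _ _
    rfl

/-- Dividing the cutoff by `q^r` removes the last `r` elements of every chain; truncated subtraction
covers shorter chains. -/
theorem chainCount_div_pow (hq : 2 ≤ q) {N i : ℕ} (hi : 0 < i) (r : ℕ) :
    chainCount q (N / q ^ r) i = chainCount q N i - r := by
  refine eq_of_forall_lt_iff fun l => ?_
  rw [lt_chainCount hq hi, Nat.lt_sub_iff_add_lt, lt_chainCount hq hi,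
    Nat.le_div_iff_mul_le (pow_pos (by omega) r), mul_assoc, ← pow_add]

end MultCarpet

/-! ### The logarithm of the mass of a ball. -/

namespace MultCarpet

variable {m₁ m₂ q j : ℕ} {Ω : Set (Symb m₁ m₂)} {t : GWord m₁ m₂ → ℝ}

/-- The logarithm of `t` at the prefix of `w` of length `l + 1`. -/
noncomputable def logT (j : ℕ) (t : GWord m₁ m₂ → ℝ) (w : Symb m₁ m₂) (l : ℕ) : ℝ :=
  Real.log (t (gPrefix (l + 1) j w))

/-- The logarithm of the column sum of `t` above the prefix of `w` of length `l`. -/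
noncomputable def logC (j : ℕ) (t : GWord m₁ m₂ → ℝ) (w : Symb m₁ m₂) (l : ℕ) : ℝ :=
  Real.log (colSum t (gPrefix l (j + 1) w).1 (gPrefix l (j + 1) w).2)

/-- The logarithm of the nested sum `S_p` along `w` for `l = 0`, and `0` for `l > 0`. -/
noncomputable def logS (q j : ℕ) (t : GWord m₁ m₂ → ℝ) (p : ℕ) (w : Symb m₁ m₂) (l : ℕ) : ℝ :=
  if l = 0 then Real.log (nestSum q j t p (gPrefix 0 (j - p) w).2) else 0

/-- The nested sums enter once per chain. Writing them as a function of the position supported at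
the head lets them be summed over integers, just like `logT` and `logC`. -/
theorem sum_range_logS (p c : ℕ) (w : Symb m₁ m₂) :
    ∑ l ∈ Finset.range c, logS q j t p w l = if 0 < c then logS q j t p w 0 else 0 := by
  cases c with
  | zero => simp
  | succ c => simp [logS, Finset.sum_ite_eq']

theorem take_gPrefix_snd {l l' : ℕ} (h : l ≤ l') (w : Symb m₁ m₂) :
    (gPrefix 0 l' w).2.take l = (gPrefix 0 l w).2 := by
  simp [gPrefix, ← List.map_take, List.take_range, h]

theorem IsTreeVector.log_nestFactor (h : IsTreeVector q j Ω t) {w : Symb m₁ m₂} (hw : w ∈ Ω)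
    {n l : ℕ} (hl : j ≤ l + n) : 0 < nestFactor q j t n (gPrefix 0 l w).2 ∧
      Real.log (nestFactor q j t n (gPrefix 0 l w).2) =
        ∑ p ∈ Finset.Ico n j, (1 - (q : ℝ)) / q * logS q j t p w 0 := by
  have hp : ∀ p ∈ Finset.Ico n j, 0 < nestSum q j t p ((gPrefix 0 l w).2.take (j - p)) ∧
      Real.log (nestSum q j t p ((gPrefix 0 l w).2.take (j - p))) = logS q j t p w 0 := by
    intro p hp
    rw [Finset.mem_Ico] at hp
    rw [take_gPrefix_snd (by omega)]
    exact ⟨zero_lt_one.trans_le (h.one_le_nestSum hw p (by omega)), by simp [logS]⟩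
  refine ⟨Finset.prod_pos fun p hp' => Real.rpow_pos_of_pos (hp p hp').1 _, ?_⟩
  rw [nestFactor, Real.log_prod fun p hp' => (Real.rpow_pos_of_pos (hp p hp').1 _).ne']
  refine Finset.sum_congr rfl fun p hp' => ?_
  rw [Real.log_rpow (hp p hp').1, (hp p hp').2]

theorem IsTreeVector.log_optW (h : IsTreeVector q j Ω t) (hne : Ω.Nonempty) {w : Symb m₁ m₂}
    (hw : w ∈ Ω) (k : ℕ) :
    0 < optW q j t (gPrefix (k + 1) j w) ∧
      Real.log (optW q j t (gPrefix (k + 1) j w)) = -Real.log (tRoot q j t)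
        + ∑ p ∈ Finset.range j, (1 - (q : ℝ)) / q * logS q j t p w 0
        + ∑ l ∈ Finset.range (k + 1), logT j t w l
        - q * expA m₁ m₂ q j * ∑ l ∈ Finset.range k, logT j t w l
        + (expA m₁ m₂ q j - 1) * ∑ l ∈ Finset.range (k + 1), logC j t w l := by
  have hT : ∀ l, 0 < t (gPrefix (l + 1) j w) := fun l =>
    zero_lt_one.trans_le (h.one_le hw (by omega))
  have hC : ∀ l, 0 < colSum t (gPrefix l (j + 1) w).1 (gPrefix l (j + 1) w).2 := fun l =>
    zero_lt_one.trans_le (h.one_le_colSum hw l (j + 1))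
  have hR : 0 < tRoot q j t := zero_lt_one.trans_le (h.one_le_tRoot hne)
  have hcr : ∀ l, (w.seq l).2 :: (gPrefix (l + 1) j w).2 =
      (gPrefix l j w).2 ++ [(w.seq (l + j)).2] := fun l => by
    rw [gPrefix_snd_concat, gPrefix_snd_succ]
  have hlen : ∀ l, (gPrefix l j w).2.length = j := fun l => by simp [gPrefix]
  have hstep : ∀ l, gPrefix (l + 1) j w =
      ((gPrefix l j w).1 ++ [((w.seq l).1, (w.seq l).2)], (gPrefix (l + 1) j w).2) := fun l =>
    Prod.ext (gPrefix_fst_succ l j w) rfl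
  have hC' : ∀ l, colSum t (gPrefix l j w).1 ((w.seq l).2 :: (gPrefix (l + 1) j w).2) =
      colSum t (gPrefix l (j + 1) w).1 (gPrefix l (j + 1) w).2 := fun l => by
    rw [gPrefix_snd_succ]; rfl
  induction k with
  | zero =>
    obtain ⟨hF, hF'⟩ := h.log_nestFactor hw (n := 0) (l := j) (by omega)
    have e : optW q j t (gPrefix (0 + 1) j w) = t (gPrefix (0 + 1) j w) *
        colSum t (gPrefix 0 (j + 1) w).1 (gPrefix 0 (j + 1) w).2 ^ (expA m₁ m₂ q j - 1) /
        tRoot q j t * nestFactor q j t 0 (gPrefix 0 j w).2 := by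
      have e1 := optW_singleton (q := q) (t := t) (hlen 0) (hcr 0) (w.seq 0).1
      have e2 : gPrefix (0 + 1) j w =
        ([((w.seq 0).1, (w.seq 0).2)], (gPrefix (0 + 1) j w).2) := hstep 0
      rw [← hC' 0, e2]
      exact e1
    have hCp := Real.rpow_pos_of_pos (hC 0) (expA m₁ m₂ q j - 1)
    have hT0 := hT 0
    rw [e]
    refine ⟨by positivity, ?_⟩
    rw [Real.log_mul (by positivity) (by positivity), Real.log_div (by positivity) hR.ne',
      Real.log_mul hT0.ne' hCp.ne', Real.log_rpow (hC 0), hF', ← Finset.range_eq_Ico]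
    simp only [zero_add, Finset.range_one, Finset.sum_singleton, Finset.range_zero,
      Finset.sum_empty, logT, logC]
    ring
  | succ k ih =>
    obtain ⟨ih1, ih2⟩ := ih
    have hne' : (gPrefix (k + 1) j w).1 ≠ [] := by simp [gPrefix]
    have e : optW q j t (gPrefix (k + 1 + 1) j w) = optW q j t (gPrefix (k + 1) j w) *
        (t (gPrefix (k + 1 + 1) j w) *
        colSum t (gPrefix (k + 1) (j + 1) w).1 (gPrefix (k + 1) (j + 1) w).2 ^
          (expA m₁ m₂ q j - 1) / t (gPrefix (k + 1) j w) ^ ((q : ℝ) * expA m₁ m₂ q j)) := by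
      have e1 := optW_concat (q := q) (t := t) hne' (hlen (k + 1)) (hcr (k + 1)) (w.seq (k + 1)).1
      rw [← hC' (k + 1), hstep (k + 1)]
      exact e1
    have hCp := Real.rpow_pos_of_pos (hC (k + 1)) (expA m₁ m₂ q j - 1)
    have hTp := Real.rpow_pos_of_pos (hT k) (q * expA m₁ m₂ q j)
    have hT0 := hT (k + 1)
    rw [e]
    refine ⟨by positivity, ?_⟩
    rw [Real.log_mul ih1.ne' (by positivity), Real.log_div (by positivity) hTp.ne',
      Real.log_mul hT0.ne' hCp.ne', Real.log_rpow (hC _), Real.log_rpow (hT _), ih2,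
      Finset.sum_range_succ (fun l => logT j t w l) (k + 1),
      Finset.sum_range_succ (fun l => logC j t w l) (k + 1),
      Finset.sum_range_succ (fun l => logT j t w l) k]
    simp only [logT, logC]
    ring

theorem measure_cyl_eq_colSum (hm₂ : 2 ≤ m₂) (hm : m₂ ≤ m₁) (h0 : ∀ u, 0 ≤ t u)
    {μ : Measure (Symb m₁ m₂)}
    (hμ : ∀ v l n, v.length + n = j →
        μ (cyl (l, v)) = ENNReal.ofReal (sumExt (optExt q j t) n (l, v)))
    (k : ℕ) (w : Symb m₁ m₂) : μ (cyl (gPrefix k (j + 1) w)) = ENNReal.ofReal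
      (colSum (optW q j t) (gPrefix k j w).1 ((gPrefix k j w).2 ++ [(w.seq (k + j)).2])) := by
  have e : gPrefix k (j + 1) w =
      ((gPrefix k j w).1, (w.seq k).2 :: (gPrefix (k + 1) j w).2) :=
    Prod.ext rfl (gPrefix_snd_succ k j w)
  rw [gPrefix_snd_concat, gPrefix_snd_succ, e, measure_cyl_cons hm₂ hm, colSum,
    ENNReal.ofReal_sum_of_nonneg fun _ _ => optW_nonneg h0 _]
  exact Finset.sum_congr rfl fun x _ =>
    measure_cyl_of_sumExt hμ (by simp) (by simp [gPrefix])

theorem sum_logS_of_lt {M : ℕ} (hM : j < M) (w : Symb m₁ m₂) :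
    ∑ p ∈ Finset.range j, (1 / (q : ℝ) * ∑ l ∈ Finset.range (M - (j - p - 1)), logS q j t p w l
        - ∑ l ∈ Finset.range (M - (j - p)), logS q j t p w l) =
      ∑ p ∈ Finset.range j, (1 / (q : ℝ) - 1) * logS q j t p w 0 := by
  refine Finset.sum_congr rfl fun p hp => ?_
  rw [Finset.mem_range] at hp
  rw [sum_range_logS, sum_range_logS, if_pos (by omega), if_pos (by omega)]
  ring

/-- For `p < j - M` both truncated ranges are empty, and for `p > j - M` both are nonempty. At `p =
j - M` only the first is nonempty: this leaves the numerator `S_(j-M)` of the mass of a short word.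
One expression therefore serves all chain lengths. -/
theorem sum_logS_of_le {M : ℕ} (hM0 : 1 ≤ M) (hM : M ≤ j) (w : Symb m₁ m₂) :
    ∑ p ∈ Finset.range j, (1 / (q : ℝ) * ∑ l ∈ Finset.range (M - (j - p - 1)), logS q j t p w l
        - ∑ l ∈ Finset.range (M - (j - p)), logS q j t p w l) =
      logS q j t (j - M) w 0 +
        ∑ p ∈ Finset.Ico (j - M) j, (1 / (q : ℝ) - 1) * logS q j t p w 0 := by
  simp only [sum_range_logS]
  rw [Finset.range_eq_Ico, ← Finset.sum_Ico_consecutive _ (Nat.zero_le (j - M)) (by omega),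
    Finset.sum_eq_zero, zero_add, Finset.sum_eq_sum_Ico_succ_bot (by omega),
    Finset.sum_eq_sum_Ico_succ_bot (by omega) (fun p => (1 / (q : ℝ) - 1) * logS q j t p w 0),
    if_pos (by omega), if_neg (by omega)]
  · have : ∀ p ∈ Finset.Ico (j - M + 1) j,
        (1 / (q : ℝ) * (if 0 < M - (j - p - 1) then logS q j t p w 0 else 0)
          - if 0 < M - (j - p) then logS q j t p w 0 else 0) =
        (1 / (q : ℝ) - 1) * logS q j t p w 0 := by
      intro p hp
      rw [Finset.mem_Ico] at hp
      rw [if_pos (by omega), if_pos (by omega)]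
      ring
    rw [Finset.sum_congr rfl this]
    ring
  · intro p hp
    rw [Finset.mem_Ico] at hp
    rw [if_neg (by omega), if_neg (by omega)]
    ring

/-- The logarithm of the mass of a generalized cylinder of `k` letters followed by second
coordinates, `M` letters in total, around a point of `Ω`. -/
theorem IsTreeVector.log_measure_cyl (h : IsTreeVector q j Ω t) (hm₂ : 2 ≤ m₂) (hm : m₂ ≤ m₁)
    (hq : 2 ≤ q) {μ : Measure (Symb m₁ m₂)}
    (hμ : ∀ v l n, v.length + n = j →
        μ (cyl (l, v)) = ENNReal.ofReal (sumExt (optExt q j t) n (l, v)))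
    {w : Symb m₁ m₂} (hw : w ∈ Ω) {k M : ℕ} (hM : 1 ≤ M) (hk : k ≤ M - j) (hk' : M - j ≤ k + 1) :
    0 < (μ (cyl (gPrefix k (M - k) w))).toReal ∧
    Real.log (μ (cyl (gPrefix k (M - k) w))).toReal = -Real.log (tRoot q j t)
      + ∑ p ∈ Finset.range j,
        (1 / (q : ℝ) * ∑ l ∈ Finset.range (M - (j - p - 1)), logS q j t p w l
          - ∑ l ∈ Finset.range (M - (j - p)), logS q j t p w l)
      + ∑ l ∈ Finset.range k, logT j t w l
      - q * expA m₁ m₂ q j * ∑ l ∈ Finset.range (M - (j + 1)), logT j t w l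
      + expA m₁ m₂ q j * ∑ l ∈ Finset.range (M - j), logC j t w l
      - ∑ l ∈ Finset.range k, logC j t w l := by
  have ha := expA_pos hm₂ hm hq j
  have hq' : (0 : ℝ) < q := by exact_mod_cast (by omega : 0 < q)
  have hne : Ω.Nonempty := ⟨w, hw⟩
  have hR : 0 < tRoot q j t := zero_lt_one.trans_le (h.one_le_tRoot hne)
  have hT : ∀ l, 0 < t (gPrefix (l + 1) j w) := fun l =>
    zero_lt_one.trans_le (h.one_le hw (by omega))
  have hC : ∀ l, 0 < colSum t (gPrefix l (j + 1) w).1 (gPrefix l (j + 1) w).2 := fun l =>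
    zero_lt_one.trans_le (h.one_le_colSum hw l (j + 1))
  have hq1 : 1 / (q : ℝ) - 1 = (1 - (q : ℝ)) / q := by rw [sub_div, div_self hq'.ne']
  rcases (Nat.le_succ_iff.1 hk') with hle | heq
  · have hkM : M - j = k := le_antisymm hle hk
    rcases Nat.eq_zero_or_pos k with rfl | hk0
    · have hMj : M ≤ j := by omega
      obtain ⟨hF, hF'⟩ := h.log_nestFactor hw (n := j - M) (l := M) (by omega)
      have hS : 0 < nestSum q j t (j - M) (gPrefix 0 M w).2 := by
        have := h.one_le_nestSum hw (j - M) (by omega)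
        rw [show j - (j - M) = M by omega] at this
        linarith
      have e : (μ (cyl (gPrefix 0 (M - 0) w))).toReal = nestSum q j t (j - M) (gPrefix 0 M w).2 /
          tRoot q j t * nestFactor q j t (j - M) (gPrefix 0 M w).2 := by
        have h1 := hμ (gPrefix 0 M w).2 [] (j - M) (by simp [gPrefix]; omega)
        rw [sumExt_optExt_nil h.nonneg ha hq _ _ (by simp [gPrefix]; omega)] at h1
        have h2 : gPrefix 0 (M - 0) w = ([], (gPrefix 0 M w).2) := rfl
        rw [h2, h1, ENNReal.toReal_ofReal (by positivity)]
      rw [e]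
      refine ⟨by positivity, ?_⟩
      rw [sum_logS_of_le hM hMj, Real.log_mul (by positivity) hF.ne', Real.log_div hS.ne' hR.ne',
        hF', hkM, show M - (j + 1) = 0 by omega, hq1]
      simp only [logS, if_true, show j - (j - M) = M by omega, Finset.range_zero,
        Finset.sum_empty]
      ring
    -- Here there are exactly `j` trailing second coordinates, the shape on which `μ` is prescribed.
    · obtain ⟨k, rfl⟩ : ∃ k', k = k' + 1 := ⟨k - 1, by omega⟩
      obtain ⟨hO, hO'⟩ := h.log_optW hne hw k
      have e : (μ (cyl (gPrefix (k + 1) (M - (k + 1)) w))).toReal =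
          optW q j t (gPrefix (k + 1) j w) := by
        rw [show M - (k + 1) = j by omega,
          measure_cyl_of_sumExt hμ (by simp [gPrefix]) (by simp [gPrefix]),
          ENNReal.toReal_ofReal hO.le]
      rw [e]
      refine ⟨hO, ?_⟩
      rw [hO', sum_logS_of_lt (by omega), hkM, show M - (j + 1) = k by omega, hq1]
      ring
  -- Here there are `j + 1` trailing second coordinates: the mass is a column sum of prescribed
  -- weights, which is why one more `logC` than `logT` appears.
  · have hCp := Real.rpow_pos_of_pos (hC k) (expA m₁ m₂ q j)
    have eM : M - k = j + 1 := by omega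
    have hC' : colSum t (gPrefix k j w).1 ((gPrefix k j w).2 ++ [(w.seq (k + j)).2]) =
        colSum t (gPrefix k (j + 1) w).1 (gPrefix k (j + 1) w).2 := by
      rw [gPrefix_snd_concat]; rfl
    rw [eM, measure_cyl_eq_colSum hm₂ hm h.nonneg hμ, sum_logS_of_lt (by omega), heq,
      show M - (j + 1) = k by omega, Finset.sum_range_succ, hq1]
    rcases Nat.eq_zero_or_pos k with rfl | hk0
    · obtain ⟨hF, hF'⟩ := h.log_nestFactor hw (n := 0) (l := j) (by omega)
      have e := colSum_optW_nil h.nonneg ha (show (gPrefix 0 j w).2.length = j by simp [gPrefix])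
        (w.seq (0 + j)).2
      have e' : (gPrefix 0 j w).1 = [] := rfl
      rw [e', e]
      rw [e'] at hC'
      rw [hC', ENNReal.toReal_ofReal (by positivity)]
      refine ⟨by positivity, ?_⟩
      rw [Real.log_mul (by positivity) hF.ne', Real.log_div hCp.ne' hR.ne', Real.log_rpow (hC 0),
        hF', ← Finset.range_eq_Ico]
      simp only [Finset.range_zero, Finset.sum_empty, logC]
      ring
    · obtain ⟨k, rfl⟩ : ∃ k', k = k' + 1 := ⟨k - 1, by omega⟩
      obtain ⟨hO, hO'⟩ := h.log_optW hne hw k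
      have hTp := Real.rpow_pos_of_pos (hT k) (q * expA m₁ m₂ q j)
      rw [colSum_optW h.nonneg ha (by simp [gPrefix]) (by simp [gPrefix]), hC']
      change 0 < (ENNReal.ofReal (optW q j t (gPrefix (k + 1) j w) * _)).toReal ∧
        Real.log (ENNReal.ofReal (optW q j t (gPrefix (k + 1) j w) *
          (_ / t (gPrefix (k + 1) j w) ^ _))).toReal = _
      rw [ENNReal.toReal_ofReal (by positivity)]
      refine ⟨by positivity, ?_⟩
      rw [Real.log_mul hO.ne' (by positivity), Real.log_div hCp.ne' hTp.ne', Real.log_rpow (hC _),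
        Real.log_rpow (hT _), hO', Finset.sum_range_succ (fun l => logT j t w l) k]
      simp only [logT, logC]
      ring

/-- The function on the positive integers given by `F` along all chains of `z`. -/
def alongChains (q : ℕ) (F : Symb m₁ m₂ → ℕ → ℝ) (z : Symb m₁ m₂) (m : ℕ) : ℝ :=
  F (alongJ q (Nat.divMaxPow m q) z) (padicValNat q m)

/-- The sum of `h` over `1, …, N`. -/
def sumTo (h : ℕ → ℝ) (N : ℕ) : ℝ := ∑ m ∈ Finset.Icc 1 N, h m

theorem sum_chainHeads_alongChains (hq : 2 ≤ q) {N N' : ℕ} (h : N ≤ N')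
    (F : Symb m₁ m₂ → ℕ → ℝ) (z : Symb m₁ m₂) :
    ∑ i ∈ chainHeads q N', ∑ l ∈ Finset.range (chainCount q N i), F (alongJ q i z) l =
      sumTo (alongChains q F z) N := by
  rw [sumTo, ← sum_chainHeads_sum hq h]
  refine Finset.sum_congr rfl fun i hi => Finset.sum_congr rfl fun l _ => ?_
  have hqi := (mem_chainHeads.1 hi).2
  rw [alongChains, divMaxPow_mul_pow hq hqi, padicValNat_mul_pow hq hqi]

/-- Together with `bigL_div_le` this sandwiches `n` between `L(n)/q^(j+1)` and `L(n)/q^j`. In terms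
of chains, it controls the number of trailing second coordinates; the choice of `j` enters the proof
only here. -/
theorem le_bigL_div (hq : 2 ≤ q)
    (hj : (q : ℝ) ^ j ≤ 1 / gam m₁ m₂) (n : ℕ) : n ≤ bigL m₁ m₂ n / q ^ j := by
  rw [Nat.le_div_iff_mul_le (pow_pos (by omega) j)]
  have h : (n : ℝ) * (q : ℝ) ^ j ≤ n / gam m₁ m₂ := by
    rw [div_eq_mul_one_div]
    exact mul_le_mul_of_nonneg_left hj (Nat.cast_nonneg n)
  exact_mod_cast h.trans (Nat.le_ceil _)

theorem bigL_div_le (hm₂ : 2 ≤ m₂) (hm : m₂ ≤ m₁) (hq : 2 ≤ q)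
    (hj' : 1 / gam m₁ m₂ < (q : ℝ) ^ (j + 1)) (n : ℕ) : bigL m₁ m₂ n / q ^ (j + 1) ≤ n := by
  rw [← Nat.lt_succ_iff, Nat.div_lt_iff_lt_mul (pow_pos (by omega) _)]
  have hγ := gam_pos hm₂ hm
  have h1 : 1 ≤ 1 / gam m₁ m₂ := (one_le_div hγ).2 (gam_le_one hm₂ hm)
  have h2 : (bigL m₁ m₂ n : ℝ) < n / gam m₁ m₂ + 1 :=
    Nat.ceil_lt_add_one (div_nonneg (Nat.cast_nonneg n) hγ.le)
  have h3 : ((n : ℝ) + 1) * (1 / gam m₁ m₂) ≤ (n + 1) * (q : ℝ) ^ (j + 1) :=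
    mul_le_mul_of_nonneg_left hj'.le (by positivity)
  have h4 : (bigL m₁ m₂ n : ℝ) < (n + 1) * (q : ℝ) ^ (j + 1) := by
    rw [div_eq_mul_one_div] at h2
    linarith
  exact_mod_cast h4

/-- The logarithm of the mass of a ball around a point of `X_Ω`. -/
theorem IsTreeVector.log_multMeasure_quasiBall (h : IsTreeVector q j Ω t) (hm₂ : 2 ≤ m₂)
    (hm : m₂ ≤ m₁) (hq : 2 ≤ q) (hj : (q : ℝ) ^ j ≤ 1 / gam m₁ m₂)
    (hj' : 1 / gam m₁ m₂ < (q : ℝ) ^ (j + 1)) {μ : Measure (Symb m₁ m₂)} [IsProbabilityMeasure μ]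
    (hμ : ∀ v l n, v.length + n = j →
        μ (cyl (l, v)) = ENNReal.ofReal (sumExt (optExt q j t) n (l, v)))
    {z : Symb m₁ m₂} (hz : z ∈ multSet q Ω) (n : ℕ) :
    0 < (multMeasure q μ (quasiBall n z)).toReal ∧
    Real.log (multMeasure q μ (quasiBall n z)).toReal =
      -(Real.log (tRoot q j t) * (chainHeads q (bigL m₁ m₂ n)).card)
      + ∑ p ∈ Finset.range j,
        (1 / (q : ℝ) * sumTo (alongChains q (logS q j t p) z) (bigL m₁ m₂ n / q ^ (j - p - 1))
          - sumTo (alongChains q (logS q j t p) z) (bigL m₁ m₂ n / q ^ (j - p)))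
      + sumTo (alongChains q (logT j t) z) n
      - q * expA m₁ m₂ q j * sumTo (alongChains q (logT j t) z) (bigL m₁ m₂ n / q ^ (j + 1))
      + expA m₁ m₂ q j * sumTo (alongChains q (logC j t) z) (bigL m₁ m₂ n / q ^ j)
      - sumTo (alongChains q (logC j t) z) n := by
  set L := bigL m₁ m₂ n with hL
  have hnL : n ≤ L := le_bigL hm₂ hm n
  have e : quasiBall n z = cyl (gPrefix n (L - n) z) := Set.ext fun w => mem_quasiBall hnL
  have eL : n + (L - n) = L := by omega
  have key : ∀ i ∈ chainHeads q L, _ := fun i hi =>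
    h.log_measure_cyl hm₂ hm hq hμ (hz i (mem_chainHeads.1 hi).2) (k := chainCount q n i)
      (M := chainCount q L i) (by
        obtain ⟨h1, h2⟩ := mem_chainHeads.1 hi
        exact (lt_chainCount hq (pos_of_not_dvd h2)).2 (by simpa using h1))
      (by
        have h2 := pos_of_not_dvd (mem_chainHeads.1 hi).2
        rw [← chainCount_div_pow hq h2]
        exact chainCount_mono hq h2 (le_bigL_div hq hj n))
      (by
        have h2 := pos_of_not_dvd (mem_chainHeads.1 hi).2
        have h3 := chainCount_mono hq h2 (bigL_div_le hm₂ hm hq hj' n)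
        rw [chainCount_div_pow hq h2, ← hL] at h3
        omega)
  rw [e, multMeasure_cyl hm₂ hm hq, eL, ENNReal.toReal_prod]
  refine ⟨Finset.prod_pos fun i hi => (key i hi).1, ?_⟩
  rw [Real.log_prod fun i hi => (key i hi).1.ne', Finset.sum_congr rfl fun i hi => (key i hi).2]
  have hdiv : ∀ r, L / q ^ r ≤ L := fun r => Nat.div_le_self _ _
  have hsum : ∀ (F : Symb m₁ m₂ → ℕ → ℝ) (r : ℕ),
      ∑ i ∈ chainHeads q L, ∑ l ∈ Finset.range (chainCount q L i - r), F (alongJ q i z) l =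
        sumTo (alongChains q F z) (L / q ^ r) := by
    intro F r
    rw [← sum_chainHeads_alongChains hq (hdiv r)]
    exact Finset.sum_congr rfl fun i hi => by
      rw [chainCount_div_pow hq (pos_of_not_dvd (mem_chainHeads.1 hi).2)]
  simp only [Finset.sum_add_distrib, Finset.sum_sub_distrib, ← Finset.mul_sum, hsum,
    sum_chainHeads_alongChains hq hnL, Finset.sum_const]
  rw [Finset.sum_comm (s := chainHeads q L), Finset.sum_comm (s := chainHeads q L)]
  simp only [hsum, nsmul_eq_mul]
  ring

end MultCarpet

/-! ### Rescaled partial sums and logarithmic averages. -/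

namespace MultCarpet

section averages

variable {h : ℕ → ℝ} {B lam : ℝ} {M : ℕ → ℕ}

theorem abs_sumTo_le (hB : ∀ m, |h m| ≤ B) (N : ℕ) : |sumTo h N| ≤ B * N := by
  refine (Finset.abs_sum_le_sum_abs _ _).trans ((Finset.sum_le_sum fun m _ => hB m).trans_eq ?_)
  simp [mul_comm]

theorem abs_sumTo_sub_le (hB : ∀ m, |h m| ≤ B) (N N' : ℕ) :
    |sumTo h N - sumTo h N'| ≤ B * |(N : ℝ) - N'| := by
  wlog hle : N' ≤ N generalizing N N'
  · rw [abs_sub_comm, abs_sub_comm (N : ℝ)]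
    exact this N' N (by omega)
  have e : sumTo h N = sumTo h N' + ∑ m ∈ Finset.Ioc N' N, h m := by
    have := Finset.sum_Ioc_consecutive h (Nat.zero_le N') hle
    rw [sumTo, sumTo]
    exact this.symm
  have hle' : (0 : ℝ) ≤ (N : ℝ) - N' := sub_nonneg.2 (by exact_mod_cast hle)
  rw [e, add_sub_cancel_left, abs_of_nonneg hle']
  refine (Finset.abs_sum_le_sum_abs _ _).trans ((Finset.sum_le_sum fun m _ => hB m).trans_eq ?_)
  simp [Nat.cast_sub hle, mul_comm]

theorem tendsto_div_of_abs_sub_le (hM : ∀ n : ℕ, |(M n : ℝ) - lam * n| ≤ 1) :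
    Tendsto (fun n => (M n : ℝ) / n) atTop (𝓝 lam) := by
  have h1 : Tendsto (fun n : ℕ => 1 / (n : ℝ)) atTop (𝓝 0) := tendsto_one_div_atTop_nhds_zero_nat
  rw [tendsto_iff_dist_tendsto_zero]
  refine squeeze_zero' (Eventually.of_forall fun n => dist_nonneg) ?_ h1
  filter_upwards [eventually_gt_atTop 0] with n hn
  have hn' : (0 : ℝ) < n := by exact_mod_cast hn
  rw [Real.dist_eq, show (M n : ℝ) / n - lam = (M n - lam * n) / n by field_simp, abs_div,
    abs_of_pos hn']
  exact div_le_div_of_nonneg_right (hM n) hn'.le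

theorem tendsto_atTop_of_abs_sub_le (hlam : 0 < lam) (hM : ∀ n : ℕ, |(M n : ℝ) - lam * n| ≤ 1) :
    Tendsto M atTop atTop := by
  rw [← tendsto_natCast_atTop_iff (R := ℝ)]
  refine tendsto_atTop_mono (fun n => ?_) (tendsto_atTop_add_const_right _ (-1)
    (tendsto_natCast_atTop_atTop.const_mul_atTop hlam))
  have := (abs_le.1 (hM n)).1
  linarith

theorem tendsto_sumTo_comp (hlam : 0 < lam) (hM : ∀ n : ℕ, |(M n : ℝ) - lam * n| ≤ 1) {c : ℝ}
    (hc : Tendsto (fun n => sumTo h n / n) atTop (𝓝 c)) :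
    Tendsto (fun n => sumTo h (M n) / n) atTop (𝓝 (c * lam)) := by
  have h1 := (hc.comp (tendsto_atTop_of_abs_sub_le hlam hM)).mul (tendsto_div_of_abs_sub_le hM)
  refine h1.congr' ?_
  filter_upwards [(tendsto_atTop_of_abs_sub_le hlam hM).eventually_gt_atTop 0] with n hn
  have hn' : (M n : ℝ) ≠ 0 := by exact_mod_cast hn.ne'
  simp only [Function.comp_apply]
  field_simp

/-- The integrand `s(u) / u ^ 2` with `s(u)` the sum of `h` up to `u`. -/
noncomputable def avgFun (h : ℕ → ℝ) (u : ℝ) : ℝ := sumTo h ⌊u⌋₊ / u ^ 2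

theorem abs_avgFun_le (hB : ∀ m, |h m| ≤ B) {u : ℝ} (hu : 0 < u) : |avgFun h u| ≤ B / u := by
  have hB0 : 0 ≤ B := (abs_nonneg _).trans (hB 0)
  rw [avgFun, abs_div, abs_of_pos (pow_pos hu 2), div_le_div_iff₀ (pow_pos hu 2) hu]
  have h1 : |sumTo h ⌊u⌋₊| ≤ B * u :=
    (abs_sumTo_le hB _).trans (mul_le_mul_of_nonneg_left (Nat.floor_le hu.le) hB0)
  calc _ ≤ B * u * u := mul_le_mul_of_nonneg_right h1 hu.le
    _ = _ := by ring

theorem measurable_avgFun (h : ℕ → ℝ) : Measurable (avgFun h) :=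
  ((measurable_from_top (f := sumTo h)).comp Nat.measurable_floor).div (measurable_id.pow_const 2)

theorem intervalIntegrable_avgFun (hB : ∀ m, |h m| ≤ B) {a b : ℝ} (ha : 0 < a) (hb : 0 < b) :
    IntervalIntegrable (avgFun h) volume a b := by
  have hB0 : 0 ≤ B := (abs_nonneg _).trans (hB 0)
  rw [intervalIntegrable_iff]
  refine Measure.integrableOn_of_bounded (M := B / min a b) (by simp [Set.uIoc])
    (measurable_avgFun h).aestronglyMeasurable ?_
  refine (ae_restrict_iff' measurableSet_uIoc).2 (Eventually.of_forall fun u hu => ?_)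
  have hu' : min a b < u := hu.1
  have hab : 0 < min a b := lt_min ha hb
  rw [Real.norm_eq_abs]
  exact (abs_avgFun_le hB (hab.trans hu')).trans (div_le_div_of_nonneg_left hB0 hab hu'.le)

/-- The integrand is at most `B/u`, and the endpoints have ratio `lam`, so the bound does not depend
on `Y`. -/
theorem abs_integral_avgFun_le (hB : ∀ m, |h m| ≤ B) (hlam : 0 < lam) {Y : ℝ} (hY : 0 < Y) :
    |∫ u in (lam * Y)..Y, avgFun h u| ≤ B / min lam 1 * |1 - lam| := by
  have hB0 : 0 ≤ B := (abs_nonneg _).trans (hB 0)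
  have hmin : 0 < min lam 1 := lt_min hlam one_pos
  have e : min (lam * Y) Y = min lam 1 * Y := by
    rw [min_mul_of_nonneg _ _ hY.le, one_mul]
  have := intervalIntegral.norm_integral_le_of_norm_le_const (f := avgFun h) (a := lam * Y) (b := Y)
    (C := B / (min lam 1 * Y)) (fun u hu => by
      have hu' : min (lam * Y) Y < u := hu.1
      rw [e] at hu'
      have h0 : 0 < min lam 1 * Y := mul_pos hmin hY
      rw [Real.norm_eq_abs]
      exact (abs_avgFun_le hB (h0.trans hu')).trans (div_le_div_of_nonneg_left hB0 h0 hu'.le))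
  rw [Real.norm_eq_abs] at this
  refine this.trans_eq ?_
  rw [show Y - lam * Y = (1 - lam) * Y by ring, abs_mul, abs_of_pos hY]
  field_simp

/-- On `[n, n+1]` the two cutoffs differ by at most `lam + 2`. Replacing `n²` by `x²` costs `x² - n²
≤ 3n` against a partial sum of size at most `B (lam + 1) n`. Both errors are `O(1/n²)`. -/
theorem abs_sumTo_div_sq_sub_le (hB : ∀ m, |h m| ≤ B) (hlam : 0 < lam)
    (hM : ∀ n : ℕ, |(M n : ℝ) - lam * n| ≤ 1) {n : ℕ} (hn : 1 ≤ n) {x : ℝ}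
    (hx : (n : ℝ) ≤ x) (hx' : x ≤ n + 1) :
    |sumTo h (M n) / (lam * (n : ℝ) ^ 2) - lam * avgFun h (lam * x)| ≤
      (B * (lam + 2) + 3 * B * (lam + 1)) / lam / (n : ℝ) ^ 2 := by
  have hB0 : 0 ≤ B := (abs_nonneg _).trans (hB 0)
  have hn' : (1 : ℝ) ≤ n := by exact_mod_cast hn
  have hx0 : 0 < x := by linarith
  have h1 : |sumTo h (M n) - sumTo h ⌊lam * x⌋₊| ≤ B * (lam + 2) := by
    refine (abs_sumTo_sub_le hB _ _).trans (mul_le_mul_of_nonneg_left ?_ hB0)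
    have a1 := abs_le.1 (hM n)
    have a2 := Nat.floor_le (mul_pos hlam hx0).le
    have a3 := Nat.lt_floor_add_one (lam * x)
    have a4 := mul_le_mul_of_nonneg_left hx hlam.le
    have a5 := mul_le_mul_of_nonneg_left hx' hlam.le
    rw [abs_le]
    constructor <;> linarith [a1.1, a1.2]
  have h2 : |sumTo h (M n)| ≤ B * (lam + 1) * n := by
    refine (abs_sumTo_le hB _).trans ?_
    rw [mul_assoc]
    refine mul_le_mul_of_nonneg_left ?_ hB0
    linarith [(abs_le.1 (hM n)).2]
  have hsq : (n : ℝ) ^ 2 ≤ x ^ 2 := pow_le_pow_left₀ (by linarith) hx 2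
  have hxx : x ^ 2 - (n : ℝ) ^ 2 ≤ 3 * n := by nlinarith
  have e : sumTo h (M n) / (lam * (n : ℝ) ^ 2) - lam * avgFun h (lam * x) =
      ((sumTo h (M n) - sumTo h ⌊lam * x⌋₊) / x ^ 2 +
        sumTo h (M n) * (x ^ 2 - n ^ 2) / (n ^ 2 * x ^ 2)) / lam := by
    rw [avgFun]
    field_simp
    ring
  have hn2 : (0 : ℝ) < n ^ 2 := by positivity
  rw [e, abs_div, abs_of_pos hlam, div_right_comm]
  refine div_le_div_of_nonneg_right ((abs_add_le _ _).trans ?_) hlam.le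
  rw [add_div]
  refine add_le_add ?_ ?_
  · rw [abs_div, abs_of_pos (pow_pos hx0 2)]
    exact div_le_div₀ (by positivity) h1 hn2 hsq
  · have hp : (0 : ℝ) < n ^ 2 * x ^ 2 := by positivity
    rw [abs_div, abs_mul, abs_of_nonneg (sub_nonneg.2 hsq), abs_of_pos hp]
    calc _ ≤ B * (lam + 1) * n * (3 * n) / (n ^ 2 * n ^ 2) := by
          refine div_le_div₀ (by positivity) ?_ (by positivity) ?_
          · exact mul_le_mul h2 hxx (sub_nonneg.2 hsq) (by positivity)
          · exact mul_le_mul_of_nonneg_left hsq hn2.le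
      _ = _ := by field_simp

theorem sum_inv_sq_le_two (N : ℕ) : ∑ n ∈ Finset.Ico 1 (N + 1), ((n : ℝ) ^ 2)⁻¹ ≤ 2 := by
  have e : Finset.Ico 1 (N + 1) = Finset.Ioo 0 (N + 1) := by
    ext n
    simp only [Finset.mem_Ico, Finset.mem_Ioo]
    omega
  rw [e]
  refine (sum_Ioo_inv_sq_le 0 (N + 1)).trans_eq (by simp)

/-- The sum is compared with an integral term by term, the errors being summable. The substitution
`u = lam x` moves the interval to `[lam, lam (N+1)]`, and going back to `[1, N+1]` changes two end
pieces that are bounded uniformly in `N`. -/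
theorem exists_abs_sum_sub_integral_le (hB : ∀ m, |h m| ≤ B) (hlam : 0 < lam)
    (hM : ∀ n : ℕ, |(M n : ℝ) - lam * n| ≤ 1) :
    ∃ C, ∀ N : ℕ, |∑ n ∈ Finset.Ico 1 (N + 1), sumTo h (M n) / (lam * (n : ℝ) ^ 2)
      - ∫ u in (1 : ℝ)..(N + 1), avgFun h u| ≤ C := by
  have hB0 : 0 ≤ B := (abs_nonneg _).trans (hB 0)
  set K := (B * (lam + 2) + 3 * B * (lam + 1)) / lam with hK
  have hK0 : 0 ≤ K := by positivity
  refine ⟨K * 2 + (B / min lam 1 * |1 - lam| + B / min lam 1 * |1 - lam|), fun N => ?_⟩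
  have hint : ∀ a b : ℝ, 0 < a → 0 < b →
      IntervalIntegrable (fun x => lam * avgFun h (lam * x)) volume a b := by
    intro a b ha hb
    have := (intervalIntegrable_avgFun hB (mul_pos hlam ha) (mul_pos hlam hb)).comp_mul_left
      (c := lam)
    simp only [mul_div_cancel_left₀ _ hlam.ne'] at this
    exact this.const_mul lam
  have h1 : ∑ n ∈ Finset.Ico 1 (N + 1), ∫ x in (n : ℝ)..((n + 1 : ℕ) : ℝ),
      lam * avgFun h (lam * x) = ∫ u in lam..(lam * (N + 1)), avgFun h u := by
    rw [intervalIntegral.sum_integral_adjacent_intervals_Ico (by omega) fun k hk =>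
      hint _ _ (by exact_mod_cast hk.1) (by positivity), intervalIntegral.integral_const_mul,
      intervalIntegral.mul_integral_comp_mul_left]
    simp
  have h2 : |∑ n ∈ Finset.Ico 1 (N + 1), sumTo h (M n) / (lam * (n : ℝ) ^ 2) -
      ∫ u in lam..(lam * (N + 1)), avgFun h u| ≤ K * 2 := by
    rw [← h1, ← Finset.sum_sub_distrib]
    refine (Finset.abs_sum_le_sum_abs _ _).trans ?_
    refine le_trans ?_ (mul_le_mul_of_nonneg_left (sum_inv_sq_le_two N) hK0)
    rw [Finset.mul_sum]
    refine Finset.sum_le_sum fun n hn => ?_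
    have hn1 : 1 ≤ n := (Finset.mem_Ico.1 hn).1
    have hn1' : (0 : ℝ) < n := by exact_mod_cast hn1
    have e : sumTo h (M n) / (lam * (n : ℝ) ^ 2) - ∫ x in (n : ℝ)..((n + 1 : ℕ) : ℝ),
        lam * avgFun h (lam * x) = ∫ x in (n : ℝ)..((n + 1 : ℕ) : ℝ),
        (sumTo h (M n) / (lam * (n : ℝ) ^ 2) - lam * avgFun h (lam * x)) := by
      rw [intervalIntegral.integral_sub (by simp) (hint _ _ hn1' (by positivity))]
      simp
    rw [e, ← Real.norm_eq_abs]
    refine (intervalIntegral.norm_integral_le_of_norm_le_const (C := K / (n : ℝ) ^ 2)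
      fun x hx => ?_).trans_eq (by simp [div_eq_mul_inv])
    rw [Set.uIoc_of_le (by push_cast; linarith)] at hx
    rw [Real.norm_eq_abs]
    have hx2 := hx.2
    push_cast at hx2
    exact abs_sumTo_div_sq_sub_le hB hlam hM hn1 hx.1.le hx2
  have h3 : (∫ u in lam..(lam * (N + 1)), avgFun h u) - ∫ u in (1 : ℝ)..(N + 1), avgFun h u =
      (∫ u in (lam * 1)..1, avgFun h u) - ∫ u in (lam * (N + 1))..(N + 1), avgFun h u := by
    have hN : (0 : ℝ) < N + 1 := by positivity
    rw [mul_one]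
    exact intervalIntegral.integral_interval_sub_interval_comm
      (intervalIntegrable_avgFun hB hlam (mul_pos hlam hN))
      (intervalIntegrable_avgFun hB one_pos hN) (intervalIntegrable_avgFun hB hlam one_pos)
  have h4 := abs_integral_avgFun_le hB hlam (Y := 1) one_pos
  have h5 := abs_integral_avgFun_le hB hlam (Y := N + 1) (by positivity)
  have h6 := (abs_sub (∫ u in (lam * 1)..1, avgFun h u)
    (∫ u in (lam * (N + 1))..(N + 1), avgFun h u)).trans (add_le_add h4 h5)
  rw [← h3] at h6
  exact (abs_sub_le _ _ _).trans (add_le_add h2 h6)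

/-- The sums of `e n / n ^ 2` are bounded. -/
def LogSumBounded (e : ℕ → ℝ) : Prop :=
  ∃ C, ∀ N : ℕ, |∑ n ∈ Finset.Ico 1 (N + 1), e n / (n : ℝ) ^ 2| ≤ C

theorem LogSumBounded.add {e e' : ℕ → ℝ} (he : LogSumBounded e) (he' : LogSumBounded e') :
    LogSumBounded fun n => e n + e' n := by
  obtain ⟨C, hC⟩ := he
  obtain ⟨C', hC'⟩ := he'
  refine ⟨C + C', fun N => ?_⟩
  simp only [add_div, Finset.sum_add_distrib]
  exact (abs_add_le _ _).trans (add_le_add (hC N) (hC' N))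

theorem LogSumBounded.const_mul {e : ℕ → ℝ} (he : LogSumBounded e) (c : ℝ) :
    LogSumBounded fun n => c * e n := by
  obtain ⟨C, hC⟩ := he
  refine ⟨|c| * C, fun N => ?_⟩
  simp only [mul_div_assoc, ← Finset.mul_sum, abs_mul]
  exact mul_le_mul_of_nonneg_left (hC N) (abs_nonneg c)

theorem LogSumBounded.sum {ι : Type*} (s : Finset ι) {e : ι → ℕ → ℝ}
    (he : ∀ i ∈ s, LogSumBounded (e i)) : LogSumBounded fun n => ∑ i ∈ s, e i n := by
  classical
  induction s using Finset.induction_on with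
  | empty => exact ⟨0, fun N => by simp⟩
  | insert i s hi ih =>
    simp only [Finset.sum_insert hi]
    exact (he i (Finset.mem_insert_self i s)).add
      (ih fun k hk => he k (Finset.mem_insert_of_mem hk))

/-- Both halves of the difference are compared with the same integral, the second one with scaling
factor `1`. -/
theorem logSumBounded_sumTo_comp (hB : ∀ m, |h m| ≤ B) (hlam : 0 < lam)
    (hM : ∀ n : ℕ, |(M n : ℝ) - lam * n| ≤ 1) :
    LogSumBounded fun n => sumTo h (M n) / lam - sumTo h n := by
  obtain ⟨C, hC⟩ := exists_abs_sum_sub_integral_le hB hlam hM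
  obtain ⟨C', hC'⟩ := exists_abs_sum_sub_integral_le (M := id) hB one_pos (fun n => by simp)
  refine ⟨C + C', fun N => ?_⟩
  have e : ∑ n ∈ Finset.Ico 1 (N + 1), (sumTo h (M n) / lam - sumTo h n) / (n : ℝ) ^ 2 =
      (∑ n ∈ Finset.Ico 1 (N + 1), sumTo h (M n) / (lam * (n : ℝ) ^ 2)
        - ∫ u in (1 : ℝ)..(N + 1), avgFun h u)
      - (∑ n ∈ Finset.Ico 1 (N + 1), sumTo h (id n) / (1 * (n : ℝ) ^ 2)
        - ∫ u in (1 : ℝ)..(N + 1), avgFun h u) := by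
    simp only [sub_div, Finset.sum_sub_distrib, div_div, one_mul, id]
    ring
  rw [e]
  exact (abs_sub _ _).trans (add_le_add (hC N) (hC' N))

/-- Otherwise `e n / n² < -ε/n` for all large `n`, and divergence of the harmonic series would make
the sums unbounded below. This holds at every point, with no convergence of averages. -/
theorem LogSumBounded.frequently_ge {e : ℕ → ℝ} (he : LogSumBounded e) {ε : ℝ} (hε : 0 < ε) :
    ∃ᶠ n : ℕ in atTop, -ε * n ≤ e n := by
  obtain ⟨C, hC⟩ := he
  intro hev
  obtain ⟨n₀, hn₀⟩ := eventually_atTop.1 (hev.and (eventually_ge_atTop 1))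
  have hn₀1 : 1 ≤ n₀ := (hn₀ n₀ le_rfl).2
  set f : ℕ → ℝ := fun n => e n / (n : ℝ) ^ 2 + ε * (1 / n) with hf
  have hneg : ∀ n ≥ n₀, f n ≤ 0 := by
    intro n hn
    obtain ⟨h1, h2⟩ := hn₀ n hn
    have hn' : (0 : ℝ) < n := by exact_mod_cast h2
    have : f n = (e n - -ε * n) / (n : ℝ) ^ 2 := by
      simp only [hf]; field_simp; ring
    rw [this]
    exact div_nonpos_of_nonpos_of_nonneg (by linarith [not_le.1 h1]) (by positivity)
  have hbd : ∀ N ≥ n₀, ε * ∑ n ∈ Finset.range N, 1 / ((n : ℝ) + 1) ≤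
      C + ∑ n ∈ Finset.Ico 1 n₀, f n := by
    intro N hN
    have h1 : ∑ n ∈ Finset.Ico 1 (N + 1), f n ≤ ∑ n ∈ Finset.Ico 1 n₀, f n := by
      rw [← Finset.sum_Ico_consecutive _ hn₀1 (show n₀ ≤ N + 1 by omega)]
      have := Finset.sum_nonpos fun n (hn : n ∈ Finset.Ico n₀ (N + 1)) =>
        hneg n (Finset.mem_Ico.1 hn).1
      linarith
    have h2 : ∑ n ∈ Finset.Ico 1 (N + 1), f n = ∑ n ∈ Finset.Ico 1 (N + 1), e n / (n : ℝ) ^ 2 +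
        ε * ∑ n ∈ Finset.range N, 1 / ((n : ℝ) + 1) := by
      simp only [hf, Finset.sum_add_distrib, ← Finset.mul_sum]
      congr 2
      rw [Finset.sum_Ico_eq_sum_range]
      simp [add_comm]
    have h3 := (abs_le.1 (hC N)).1
    linarith
  have hlim := Real.tendsto_sum_range_one_div_nat_succ_atTop.const_mul_atTop hε
  obtain ⟨N, hN, hN'⟩ := ((hlim.eventually_gt_atTop (C + ∑ n ∈ Finset.Ico 1 n₀, f n)).and
    (eventually_ge_atTop n₀)).exists
  exact absurd (hbd N hN') (not_le.2 hN)

end averages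

end MultCarpet

/-! ### The strong law of large numbers along chains. -/

namespace MultCarpet

section lawOfLargeNumbers

variable {X : Type*} [MeasurableSpace X] {μ : Measure X} [IsProbabilityMeasure μ]

theorem ae_tendsto_average {f : X → ℝ} (hf : Measurable f) {B : ℝ} (hB : ∀ x, |f x| ≤ B)
    {σ : ℕ → ℕ} (hσ : Function.Injective σ) :
    ∀ᵐ ω ∂(Measure.infinitePi fun _ : ℕ => μ),
      Tendsto (fun n : ℕ => (∑ i ∈ Finset.range n, f (ω (σ i))) / n) atTop (𝓝 (∫ x, f x ∂μ)) := by
  have hmp : ∀ i, MeasurePreserving (fun ω : ℕ → X => ω i) (Measure.infinitePi fun _ : ℕ => μ) μ :=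
    fun i => measurePreserving_eval_infinitePi (fun _ : ℕ => μ) i
  have hident : ∀ i, ProbabilityTheory.IdentDistrib (fun ω : ℕ → X => f (ω (σ i)))
      (fun ω : ℕ → X => f (ω (σ 0))) (Measure.infinitePi fun _ : ℕ => μ)
      (Measure.infinitePi fun _ : ℕ => μ) := by
    intro i
    refine ⟨(hf.comp (measurable_pi_apply _)).aemeasurable,
      (hf.comp (measurable_pi_apply _)).aemeasurable, ?_⟩
    have e : ∀ i, (Measure.infinitePi fun _ : ℕ => μ).map (fun ω : ℕ → X => f (ω (σ i))) =
        μ.map f := fun i => by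
      conv_rhs => rw [← (hmp (σ i)).map_eq]
      rw [Measure.map_map hf (measurable_pi_apply _)]
      rfl
    rw [e, e]
  have hindep := ProbabilityTheory.iIndepFun_infinitePi (P := fun _ : ℕ => μ)
    (X := fun _ : ℕ => f) fun _ => hf
  have h := ProbabilityTheory.strong_law_ae_real (μ := Measure.infinitePi fun _ : ℕ => μ)
    (fun i ω => f (ω (σ i)))
    (Integrable.of_bound (hf.comp (measurable_pi_apply _)).aestronglyMeasurable B
      (Eventually.of_forall fun ω => by rw [Real.norm_eq_abs]; exact hB _))
    (fun i k hik => hindep.indepFun (hσ.ne hik)) hident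
  have e : ∫ ω, f (ω (σ 0)) ∂(Measure.infinitePi fun _ : ℕ => μ) = ∫ x, f x ∂μ := by
    conv_rhs => rw [← (hmp (σ 0)).map_eq]
    rw [integral_map (measurable_pi_apply _).aemeasurable
      hf.aestronglyMeasurable]
  rw [e] at h
  exact h

theorem abs_natCast_div_sub_le {d : ℕ} (hd : 0 < d) (n : ℕ) :
    |((n / d : ℕ) : ℝ) - 1 / d * n| ≤ 1 := by
  have h1 : ((n / d : ℕ) : ℝ) ≤ n / d := Nat.cast_div_le
  have h2 : (n : ℝ) / d < (n / d : ℕ) + 1 := by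
    rw [div_lt_iff₀ (by exact_mod_cast hd)]
    exact_mod_cast (Nat.lt_mul_of_div_lt (Nat.lt_succ_self _) hd).trans_eq (by rw [Nat.succ_eq_add_one])
  rw [one_div_mul_eq_div, abs_le]
  constructor <;> linarith

theorem sum_chainHeads {q : ℕ} (hq : 2 ≤ q) (f : ℕ → ℝ) (N : ℕ) :
    ∑ i ∈ chainHeads q N, f i = sumTo f N - sumTo (fun k => f (q * k)) (N / q) := by
  have h := Finset.sum_filter_add_sum_filter_not (Finset.Icc 1 N) (fun i => q ∣ i) f
  have h2 : ∑ i ∈ (Finset.Icc 1 N).filter (fun i => q ∣ i), f i =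
      sumTo (fun k => f (q * k)) (N / q) := by
    symm
    refine Finset.sum_bij (fun k _ => q * k) ?_ ?_ ?_ (fun _ _ => rfl)
    · intro k hk
      rw [Finset.mem_Icc, Nat.le_div_iff_mul_le (by omega)] at hk
      refine Finset.mem_filter.2 ⟨Finset.mem_Icc.2 ⟨Nat.mul_pos (by omega) hk.1, ?_⟩,
        dvd_mul_right q k⟩
      rw [mul_comm]; exact hk.2
    · intro a _ b _ hab
      exact Nat.eq_of_mul_eq_mul_left (by omega) hab
    · intro i hi
      obtain ⟨h1, k, rfl⟩ := Finset.mem_filter.1 hi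
      rw [Finset.mem_Icc] at h1
      refine ⟨k, ?_, rfl⟩
      rw [Finset.mem_Icc, Nat.le_div_iff_mul_le (by omega), mul_comm k]
      exact ⟨Nat.pos_of_mul_pos_left (show 0 < q * k by omega), h1.2⟩
  rw [sumTo, ← h, h2]
  simp [chainHeads]

/-- The sum over `q ∤ i` is the sum over all `i` minus the sum over multiples of `q`; the strong law
applies to both families. -/
theorem ae_tendsto_chainHeads {q : ℕ} (hq : 2 ≤ q) {f : X → ℝ} (hf : Measurable f) {B : ℝ}
    (hB : ∀ x, |f x| ≤ B) :
    ∃ c, ∀ᵐ ω ∂(Measure.infinitePi fun _ : ℕ => μ),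
      Tendsto (fun n : ℕ => (∑ i ∈ chainHeads q n, f (ω i)) / n) atTop (𝓝 c) := by
  refine ⟨(∫ x, f x ∂μ) - (∫ x, f x ∂μ) * (1 / q), ?_⟩
  filter_upwards [ae_tendsto_average (μ := μ) hf hB (σ := fun i => i + 1) (add_left_injective 1),
    ae_tendsto_average (μ := μ) hf hB (σ := fun i => q * (i + 1))
      (fun a b hab => by simpa using Nat.eq_of_mul_eq_mul_left (by omega) hab)] with ω h1 h2
  have e : ∀ (g : ℕ → ℝ) (n : ℕ), ∑ i ∈ Finset.range n, g (i + 1) = sumTo g n := by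
    intro g n
    rw [sumTo, Finset.range_eq_Ico, Finset.sum_Ico_add' g 0 n 1]
    rfl
  simp only [e (fun i => f (ω i)), e (fun i => f (ω (q * i)))] at h1 h2
  have h3 := tendsto_sumTo_comp (M := fun n => n / q) (lam := 1 / (q : ℝ))
    (by have : (0 : ℝ) < q := by exact_mod_cast (by omega : 0 < q)
        positivity) (fun n => abs_natCast_div_sub_le (by omega) n) h2
  refine (h1.sub h3).congr fun n => ?_
  rw [← sub_div, sum_chainHeads hq]

theorem tendsto_chainHeads_comp {q : ℕ} {f : ℕ → ℝ} {c : ℝ}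
    (h : Tendsto (fun n : ℕ => (∑ i ∈ chainHeads q n, f i) / n) atTop (𝓝 c)) {d : ℕ}
    (hd : 0 < d) :
    Tendsto (fun n : ℕ => (∑ i ∈ chainHeads q (n / d), f i) / n) atTop (𝓝 (c * (1 / d))) := by
  have e : ∀ n, ∑ i ∈ chainHeads q n, f i = sumTo (fun i => if ¬ q ∣ i then f i else 0) n := by
    intro n
    rw [chainHeads, Finset.sum_filter]; rfl
  simp only [e] at h ⊢
  have hd' : (0 : ℝ) < d := by exact_mod_cast hd
  exact tendsto_sumTo_comp (M := fun n => n / d) (by positivity)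
    (fun n => abs_natCast_div_sub_le hd n) h

end lawOfLargeNumbers

variable {m₁ m₂ q : ℕ}

/-- Sorting by the level `l` makes each layer a sum of one fixed function over independent copies.
Levels `l ≥ n` are empty because `l < q^l`. -/
theorem sumTo_alongChains_eq (hq : 2 ≤ q) (F : Symb m₁ m₂ → ℕ → ℝ) (z : Symb m₁ m₂) (n : ℕ) :
    sumTo (alongChains q F z) n =
      ∑ l ∈ Finset.range n, ∑ i ∈ chainHeads q (n / q ^ l), F (alongJ q i z) l := by
  rw [← sum_chainHeads_alongChains hq le_rfl]
  refine Finset.sum_comm' fun i l => ?_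
  rw [Finset.mem_range, Finset.mem_range, mem_chainHeads, mem_chainHeads,
    Nat.le_div_iff_mul_le (pow_pos (by omega) l)]
  constructor
  · rintro ⟨⟨h1, h2⟩, h3⟩
    have hi := pos_of_not_dvd h2
    rw [lt_chainCount hq hi] at h3
    refine ⟨⟨h3, h2⟩, ?_⟩
    calc l < q ^ l := Nat.lt_pow_self (by omega)
      _ ≤ i * q ^ l := Nat.le_mul_of_pos_left _ hi
      _ ≤ n := h3
  · rintro ⟨⟨h1, h2⟩, h3⟩
    have hi := pos_of_not_dvd h2
    rw [lt_chainCount hq hi]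
    exact ⟨⟨(Nat.le_mul_of_pos_right i (pow_pos (by omega) l)).trans h1, h2⟩, h1⟩

theorem card_chainHeads_le (N : ℕ) : (chainHeads q N).card ≤ N :=
  (Finset.card_filter_le _ _).trans (by simp)

/-- The law of large numbers for functions of the positions along the chains. -/
theorem ae_tendsto_alongChains (hm₂ : 2 ≤ m₂) (hm : m₂ ≤ m₁) (hq : 2 ≤ q)
    {μ : Measure (Symb m₁ m₂)} [IsProbabilityMeasure μ] {F : Symb m₁ m₂ → ℕ → ℝ}
    (hF : ∀ l, Measurable fun w => F w l) {B : ℝ} (hB : ∀ w l, |F w l| ≤ B) :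
    ∀ᵐ z ∂(multMeasure q μ), ∃ c,
      Tendsto (fun n : ℕ => sumTo (alongChains q F z) n / n) atTop (𝓝 c) := by
  have hmeas : MeasurableSet {z : Symb m₁ m₂ | ∃ c,
      Tendsto (fun n : ℕ => sumTo (alongChains q F z) n / n) atTop (𝓝 c)} := by
    refine measurableSet_exists_tendsto fun n => Measurable.div_const ?_ _
    exact Finset.measurable_sum _ fun m _ => (hF _).comp (measurable_alongJ hm₂ hm q _)
  rw [multMeasure, ae_map_iff (measurable_interleave hm₂ hm q).aemeasurable hmeas]
  choose c hc using fun l => ae_tendsto_chainHeads (μ := μ) hq (hF l) (fun w => hB w l)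
  have hq' : (1 : ℝ) < q := by exact_mod_cast hq
  filter_upwards [ae_all_iff.2 hc] with ω hω
  have hB0 : 0 ≤ B := (abs_nonneg _).trans (hB (ω 0) 0)
  refine ⟨∑' l, c l * (1 / (q ^ l : ℕ)), ?_⟩
  -- Layer `l` has at most `n/q^l` terms, so the geometric bound `B q^(-l)` allows the limit to be
  -- taken layer by layer.
  have h := tendsto_tsum_of_dominated_convergence (𝓕 := atTop)
    (f := fun (n : ℕ) (l : ℕ) => (∑ i ∈ chainHeads q (n / q ^ l), F (ω i) l) / (n : ℝ))
    (g := fun l => c l * (1 / (q ^ l : ℕ))) (bound := fun l : ℕ => B * (1 / (q : ℝ)) ^ l)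
    ((summable_geometric_of_lt_one (by positivity) ((div_lt_one (by linarith)).2 hq')).mul_left B)
    (fun l => tendsto_chainHeads_comp (hω l) (pow_pos (by omega) l))
    (Eventually.of_forall fun n l => by
      rcases Nat.eq_zero_or_pos n with rfl | hn
      · simp; positivity
      have hn' : (0 : ℝ) < n := by exact_mod_cast hn
      rw [Real.norm_eq_abs, abs_div, abs_of_pos hn', div_le_iff₀ hn']
      calc _ ≤ ∑ i ∈ chainHeads q (n / q ^ l), B :=
            (Finset.abs_sum_le_sum_abs _ _).trans (Finset.sum_le_sum fun i _ => hB _ _)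
        _ = (chainHeads q (n / q ^ l)).card * B := by simp
        _ ≤ (n / (q : ℝ) ^ l) * B := by
            refine mul_le_mul_of_nonneg_right ?_ hB0
            calc ((chainHeads q (n / q ^ l)).card : ℝ) ≤ ((n / q ^ l : ℕ) : ℝ) := by
                  exact_mod_cast card_chainHeads_le _
              _ ≤ n / ((q ^ l : ℕ) : ℝ) := Nat.cast_div_le
              _ = _ := by push_cast; rfl
        _ = _ := by rw [one_div, inv_pow]; ring)
  refine h.congr fun n => ?_
  rw [sumTo_alongChains_eq hq, tsum_eq_sum (s := Finset.range n), Finset.sum_div]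
  · refine Finset.sum_congr rfl fun l _ => ?_
    congr 1
    refine Finset.sum_congr rfl fun i hi => ?_
    rw [alongJ_interleave hq ω (mem_chainHeads.1 hi).2]
  · intro l hl
    rw [Finset.mem_range, not_lt] at hl
    have : n / q ^ l = 0 := Nat.div_eq_of_lt (hl.trans_lt (Nat.lt_pow_self (by omega)))
    simp [this, chainHeads]

end MultCarpet

/-! ### Bounds for the Hausdorff dimension from the masses of balls. -/

namespace MultCarpet

variable {m₁ m₂ : ℕ}

theorem ediam_quasiBall_le (hm₂ : 2 ≤ m₂) (hm : m₂ ≤ m₁) (n : ℕ) (z : Symb m₁ m₂) :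
    Metric.ediam (quasiBall n z) ≤ ENNReal.ofReal ((m₁ : ℝ) ^ (-(n : ℝ))) := by
  refine Metric.ediam_le fun x hx y hy => ?_
  rw [← quasiBall_eq_of_mem hy, ← closedBall_eq_quasiBall hm₂ hm, Metric.mem_closedBall] at hx
  rw [edist_dist]
  exact ENNReal.ofReal_le_ofReal hx

theorem subset_quasiBall_of_ediam_le (hm₂ : 2 ≤ m₂) (hm : m₂ ≤ m₁) {n : ℕ} {S : Set (Symb m₁ m₂)}
    (hS : Metric.ediam S ≤ ENNReal.ofReal ((m₁ : ℝ) ^ (-(n : ℝ)))) {z : Symb m₁ m₂} (hz : z ∈ S) :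
    S ⊆ quasiBall n z := by
  intro w hw
  rw [← closedBall_eq_quasiBall hm₂ hm, Metric.mem_closedBall]
  have h := (Metric.edist_le_ediam_of_mem hw hz).trans hS
  rw [edist_dist] at h
  exact (ENNReal.ofReal_le_ofReal_iff (Real.rpow_nonneg (Nat.cast_nonneg _) _)).1 h

theorem countable_range_quasiBall (hm₂ : 2 ≤ m₂) (hm : m₂ ≤ m₁) :
    {Q : Set (Symb m₁ m₂) | ∃ n z, Q = quasiBall n z}.Countable := by
  refine (Set.countable_range (cyl : GWord m₁ m₂ → Set (Symb m₁ m₂))).mono ?_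
  rintro Q ⟨n, z, rfl⟩
  exact ⟨gPrefix n (bigL m₁ m₂ n - n) z,
    (Set.ext fun w => mem_quasiBall (le_bigL hm₂ hm n)).symm⟩

theorem rpow_neg_mul_eq (hm₂ : 2 ≤ m₂) (hm : m₂ ≤ m₁) {s : ℝ} (hs : 0 ≤ s) (n : ℕ) :
    ENNReal.ofReal ((m₁ : ℝ) ^ (-(n : ℝ))) ^ s = ENNReal.ofReal ((m₁ : ℝ) ^ (-(s * n))) := by
  have h0 : (0 : ℝ) < m₁ := by exact_mod_cast (by omega : 0 < m₁)
  rw [ENNReal.ofReal_rpow_of_nonneg (Real.rpow_nonneg h0.le _) hs, ← Real.rpow_mul h0.le]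
  congr 2
  ring

theorem tendsto_rpow_neg_natCast (hm₂ : 2 ≤ m₂) (hm : m₂ ≤ m₁) {s : ℝ} (hs : 0 < s) :
    Tendsto (fun n : ℕ => ENNReal.ofReal ((m₁ : ℝ) ^ (-(s * n)))) atTop (𝓝 0) := by
  have h0 : (1 : ℝ) < m₁ := by exact_mod_cast (by omega : 1 < m₁)
  rw [← ENNReal.ofReal_zero]
  refine ENNReal.tendsto_ofReal ?_
  have h := tendsto_pow_atTop_nhds_zero_of_lt_one (r := (m₁ : ℝ) ^ (-s))
    (Real.rpow_nonneg (by linarith) _) (Real.rpow_lt_one_of_one_lt_of_neg h0 (by linarith))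
  refine h.congr fun n => ?_
  rw [← Real.rpow_natCast, ← Real.rpow_mul (by linarith)]
  congr 1
  ring

/-- The covering bound for the Hausdorff dimension. -/
theorem dimH_le_of_frequently_le (hm₂ : 2 ≤ m₂) (hm : m₂ ≤ m₁) (P : Measure (Symb m₁ m₂))
    [IsProbabilityMeasure P] {X : Set (Symb m₁ m₂)} {s : ℝ} (hs : 0 ≤ s)
    (h : ∀ z ∈ X, ∃ᶠ n : ℕ in atTop,
      ENNReal.ofReal ((m₁ : ℝ) ^ (-(s * n))) ≤ P (quasiBall n z)) :
    dimH X ≤ ENNReal.ofReal s := by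
  classical
  have hex : ∀ (N : ℕ) (z : Symb m₁ m₂), z ∈ X → ∃ n, N ≤ n ∧
      ENNReal.ofReal ((m₁ : ℝ) ^ (-(s * n))) ≤ P (quasiBall n z) :=
    fun N z hz => (frequently_atTop.1 (h z hz)) N
  -- Each point takes its first admissible scale beyond `N`. Indexing by balls rather than by points
  -- counts coinciding balls once.
  let F : ℕ → Set (Set (Symb m₁ m₂)) := fun N =>
    {Q | ∃ z, ∃ hz : z ∈ X, Q = quasiBall (Nat.find (hex N z hz)) z}
  have hcount : ∀ N, (F N).Countable := fun N =>
    (countable_range_quasiBall hm₂ hm).mono <| by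
      rintro Q ⟨z, hz, rfl⟩
      exact ⟨_, z, rfl⟩
  have : ∀ N, Countable (F N) := fun N => (hcount N).to_subtype
  have hdiam : ∀ N, ∀ Q : F N, Metric.ediam (Q : Set (Symb m₁ m₂)) ≤
      ENNReal.ofReal ((m₁ : ℝ) ^ (-(1 * (N : ℝ)))) := by
    rintro N ⟨Q, z, hz, rfl⟩
    refine (ediam_quasiBall_le hm₂ hm _ z).trans (ENNReal.ofReal_le_ofReal ?_)
    have h0 : (1 : ℝ) ≤ m₁ := by exact_mod_cast (by omega : 1 ≤ m₁)
    refine Real.rpow_le_rpow_of_exponent_le h0 ?_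
    rw [one_mul, neg_le_neg_iff]
    exact_mod_cast (Nat.find_spec (hex N z hz)).1
  have hdisj : ∀ N, Pairwise (Function.onFun Disjoint fun Q : F N => (Q : Set (Symb m₁ m₂))) := by
    rintro N ⟨Q, z, hz, rfl⟩ ⟨Q', z', hz', rfl⟩ hne
    refine Set.disjoint_left.2 fun v hv hv' => hne (Subtype.ext ?_)
    wlog hle : Nat.find (hex N z hz) ≤ Nat.find (hex N z' hz') generalizing z z'
    · exact (this z' hz' z hz hne.symm hv' hv (by omega)).symm
    have hsub := quasiBall_subset_of_mem hle hv hv'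
    have hz'mem := hsub (self_mem_quasiBall _ z')
    have heq := quasiBall_eq_of_mem hz'mem
    -- Intersecting balls are nested, so the larger one is also an admissible ball around `z'`;
    -- minimality of the scale at `z'` makes the two equal.
    have hle' : Nat.find (hex N z' hz') ≤ Nat.find (hex N z hz) := by
      refine Nat.find_min' _ ⟨(Nat.find_spec (hex N z hz)).1, ?_⟩
      rw [heq]
      exact (Nat.find_spec (hex N z hz)).2
    have e := le_antisymm hle hle'
    change quasiBall (Nat.find (hex N z hz)) z = quasiBall (Nat.find (hex N z' hz')) z'
    rw [← heq, e]
  have hsum : ∀ N, ∑' Q : F N, Metric.ediam (Q : Set (Symb m₁ m₂)) ^ s ≤ 1 := by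
    intro N
    calc ∑' Q : F N, Metric.ediam (Q : Set (Symb m₁ m₂)) ^ s
        ≤ ∑' Q : F N, P (Q : Set (Symb m₁ m₂)) := by
          refine ENNReal.tsum_le_tsum ?_
          rintro ⟨Q, z, hz, rfl⟩
          refine (ENNReal.rpow_le_rpow (ediam_quasiBall_le hm₂ hm _ z) hs).trans ?_
          rw [rpow_neg_mul_eq hm₂ hm hs]
          exact (Nat.find_spec (hex N z hz)).2
      _ = P (⋃ Q : F N, (Q : Set (Symb m₁ m₂))) := by
          refine (measure_iUnion (hdisj N) ?_).symm
          rintro ⟨Q, z, hz, rfl⟩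
          exact (isOpen_quasiBall hm₂ hm _ z).measurableSet
      _ ≤ 1 := prob_le_one
  have hH : Measure.hausdorffMeasure s X ≤ 1 := by
    refine (Measure.hausdorffMeasure_le_liminf_tsum (l := atTop) s X _
      (tendsto_rpow_neg_natCast hm₂ hm one_pos) (fun N (Q : F N) => (Q : Set (Symb m₁ m₂)))
      (Eventually.of_forall hdiam) (Eventually.of_forall fun N z hz => ?_)).trans ?_
    · exact Set.mem_iUnion.2 ⟨⟨_, z, hz, rfl⟩, self_mem_quasiBall _ z⟩
    · refine (liminf_le_liminf (Eventually.of_forall hsum)).trans_eq ?_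
      exact liminf_const _
  have hs' : ((s.toNNReal : NNReal) : ℝ) = s := Real.coe_toNNReal s hs
  refine dimH_le_of_hausdorffMeasure_ne_top (d := s.toNNReal) ?_
  rw [hs']
  exact ne_top_of_le_ne_top ENNReal.one_ne_top hH

/-- For fixed `n` the mass of the ball is a locally constant function of its centre, so the set is
open. -/
theorem measurableSet_quasiBall_le (hm₂ : 2 ≤ m₂) (hm : m₂ ≤ m₁) (P : Measure (Symb m₁ m₂))
    (n : ℕ) (c : ENNReal) : MeasurableSet {z | P (quasiBall n z) ≤ c} := by
  refine (isOpen_of_quasiBall hm₂ hm fun z hz => ⟨n, fun w hw => ?_⟩).measurableSet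
  rw [Set.mem_ofPred_eq] at *
  rwa [quasiBall_eq_of_mem hw]

/-- The mass distribution principle. -/
theorem le_dimH_of_ae_eventually_le (hm₂ : 2 ≤ m₂) (hm : m₂ ≤ m₁) (P : Measure (Symb m₁ m₂))
    [IsProbabilityMeasure P] {X : Set (Symb m₁ m₂)} (hX : P Xᶜ = 0) {s : ℝ} (hs : 0 < s)
    (h : ∀ᵐ z ∂P, ∀ᶠ n : ℕ in atTop,
      P (quasiBall n z) ≤ ENNReal.ofReal ((m₁ : ℝ) ^ (-(s * n)))) :
    ENNReal.ofReal s ≤ dimH X := by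
  have h1 : (1 : ℝ) < m₁ := by exact_mod_cast (by omega : 1 < m₁)
  have h0 : (0 : ℝ) < m₁ := by linarith
  let A : ℕ → Set (Symb m₁ m₂) := fun N =>
    {z | ∀ n ≥ N, P (quasiBall n z) ≤ ENNReal.ofReal ((m₁ : ℝ) ^ (-(s * n)))}
  have hAm : ∀ N, MeasurableSet (A N) := by
    intro N
    have : A N = ⋂ n ≥ N, {z | P (quasiBall n z) ≤ ENNReal.ofReal ((m₁ : ℝ) ^ (-(s * n)))} := by
      ext z; simp [A]
    rw [this]
    exact MeasurableSet.biInter (Set.to_countable _) fun n _ =>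
      measurableSet_quasiBall_le hm₂ hm P n _
  -- The sets `A N`, on which the mass bound holds uniformly from `N` on, exhaust almost all of the
  -- space.
  obtain ⟨N, hN⟩ : ∃ N, P (A N) ≠ 0 := by
    by_contra! hall
    have hU : P (⋃ N, A N) = 0 := measure_iUnion_null hall
    have hU' : P (⋃ N, A N)ᶜ = 0 := by
      refine mem_ae_iff.1 ?_
      filter_upwards [h] with z hz
      exact Set.mem_iUnion.2 (eventually_atTop.1 hz)
    have := measure_univ_le_add_compl (μ := P) (⋃ N, A N)
    rw [hU, hU', measure_univ] at this
    simp at this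
  set C : ENNReal := ENNReal.ofReal ((m₁ : ℝ) ^ s) with hC
  have hC0 : C ≠ 0 := by
    rw [hC, Ne, ENNReal.ofReal_eq_zero, not_le]; exact Real.rpow_pos_of_pos h0 _
  have hCt : C ≠ ⊤ := ENNReal.ofReal_ne_top
  have hball : ∀ (S : Set (Symb m₁ m₂)) (n : ℕ), N ≤ n →
      Metric.ediam S ≤ ENNReal.ofReal ((m₁ : ℝ) ^ (-(n : ℝ))) →
      P (S ∩ A N) ≤ ENNReal.ofReal ((m₁ : ℝ) ^ (-(s * n))) := by
    intro S n hn hS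
    rcases (S ∩ A N).eq_empty_or_nonempty with he | ⟨z, hz, hzA⟩
    · rw [he, measure_empty]; exact zero_le
    · exact (measure_mono (Set.inter_subset_left.trans
        (subset_quasiBall_of_ediam_le hm₂ hm hS hz))).trans (hzA n hn)
  have hle : C⁻¹ • P.restrict (A N) ≤ Measure.hausdorffMeasure s := by
    refine Measure.le_hausdorffMeasure s _ (ENNReal.ofReal ((m₁ : ℝ) ^ (-(N : ℝ))))
      (ENNReal.ofReal_pos.2 (Real.rpow_pos_of_pos h0 _)) fun S hS => ?_
    rw [Measure.smul_apply, smul_eq_mul, Measure.restrict_apply' (hAm N)]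
    rcases eq_or_ne (Metric.ediam S) 0 with hd | hd
    -- With diameter zero no scale matches, but the mass bound at all scales forces mass zero.
    · have : P (S ∩ A N) = 0 := by
        refine le_antisymm (ge_of_tendsto (tendsto_rpow_neg_natCast hm₂ hm hs) ?_) (zero_le)
        filter_upwards [eventually_ge_atTop N] with n hn
        exact hball S n hn (by rw [hd]; exact zero_le)
      rw [this, mul_zero]
      exact zero_le
    · have hdt : Metric.ediam S ≠ ⊤ := ne_top_of_le_ne_top ENNReal.ofReal_ne_top hS
      set d := (Metric.ediam S).toReal with hd'
      have hdpos : 0 < d := ENNReal.toReal_pos hd hdt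
      have hdS : Metric.ediam S = ENNReal.ofReal d := (ENNReal.ofReal_toReal hdt).symm
      have hdN : d ≤ (m₁ : ℝ) ^ (-(N : ℝ)) := by
        rw [hdS] at hS
        exact (ENNReal.ofReal_le_ofReal_iff (Real.rpow_nonneg h0.le _)).1 hS
      have hpow : ∀ n : ℕ, ((m₁ : ℝ)⁻¹) ^ n = (m₁ : ℝ) ^ (-(n : ℝ)) := fun n => by
        rw [Real.rpow_neg h0.le, Real.rpow_natCast, inv_pow]
      have hd1 : d ≤ 1 := hdN.trans (Real.rpow_le_one_of_one_le_of_nonpos h1.le (by simp))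
      -- The scale satisfies `m₁^(-(n+1)) < d ≤ m₁^(-n)`; the gap of one step is absorbed by `C =
      -- m₁^s`.
      obtain ⟨n, hn, hn'⟩ := exists_nat_pow_near_of_lt_one hdpos hd1 (inv_pos.2 h0)
        (inv_lt_one_of_one_lt₀ h1)
      rw [hpow] at hn hn'
      have hNn : N ≤ n := by
        have := hn.trans_le hdN
        rw [Real.rpow_lt_rpow_left_iff h1, neg_lt_neg_iff] at this
        exact Nat.lt_succ_iff.1 (by exact_mod_cast this)
      have hb := hball S n hNn (by rw [hdS]; exact ENNReal.ofReal_le_ofReal hn')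
      rw [mul_comm, ← div_eq_mul_inv]
      refine ENNReal.div_le_of_le_mul (hb.trans ?_)
      rw [hdS, hC, ENNReal.ofReal_rpow_of_pos hdpos,
        ← ENNReal.ofReal_mul (Real.rpow_nonneg hdpos.le _)]
      refine ENNReal.ofReal_le_ofReal ?_
      have h3 : ((m₁ : ℝ) ^ (-((n + 1 : ℕ) : ℝ))) ^ s ≤ d ^ s :=
        Real.rpow_le_rpow (Real.rpow_nonneg h0.le _) hn.le hs.le
      refine le_trans (le_of_eq ?_) (mul_le_mul_of_nonneg_right h3 (Real.rpow_nonneg h0.le s))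
      rw [← Real.rpow_mul h0.le, ← Real.rpow_add h0]
      congr 1
      push_cast
      ring
  have hpos : Measure.hausdorffMeasure s X ≠ 0 := by
    intro hz
    have h2 := hle X
    rw [hz, Measure.smul_apply, smul_eq_mul, Measure.restrict_apply' (hAm N)] at h2
    have h3 : P (X ∩ A N) = 0 := by
      rcases mul_eq_zero.1 (le_antisymm h2 (zero_le)) with h4 | h4
      · exact absurd h4 (ENNReal.inv_ne_zero.2 hCt)
      · exact h4
    refine hN (le_antisymm ?_ (zero_le))
    calc P (A N) ≤ P (X ∩ A N ∪ Xᶜ) := measure_mono fun z hz => by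
          by_cases hzX : z ∈ X
          · exact Or.inl ⟨hzX, hz⟩
          · exact Or.inr hzX
      _ ≤ P (X ∩ A N) + P Xᶜ := measure_union_le _ _
      _ = 0 := by rw [h3, hX, add_zero]
  have hs' : ((s.toNNReal : NNReal) : ℝ) = s := Real.coe_toNNReal s hs.le
  exact le_dimH_of_hausdorffMeasure_ne_zero (d := s.toNNReal) (by rwa [hs'])

end MultCarpet

/-! ### The error term and the passage to the dimension. -/

namespace MultCarpet

variable {m₁ m₂ q j : ℕ} {Ω : Set (Symb m₁ m₂)} {t : GWord m₁ m₂ → ℝ}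

theorem exists_abs_gPrefix_le (p l : ℕ) (f : GWord m₁ m₂ → ℝ) :
    ∃ B, ∀ w : Symb m₁ m₂, |f (gPrefix p l w)| ≤ B := by
  have hfin : {u : GWord m₁ m₂ | u.1.length = p ∧ u.2.length = l}.Finite := by
    refine ((List.finite_length_eq (Fin m₁ × Fin m₂) p).prod
      (List.finite_length_eq (Fin m₂) l)).subset ?_
    rintro u ⟨h1, h2⟩
    exact ⟨h1, h2⟩
  obtain ⟨B, hB⟩ := (hfin.image fun u => |f u|).bddAbove
  exact ⟨B, fun w => hB ⟨gPrefix p l w, ⟨by simp [gPrefix], by simp [gPrefix]⟩, rfl⟩⟩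

/-- Bounds are needed at all points, also outside `Ω`, where `t` and its column sums may vanish;
there `Real.log 0 = 0` is within the bound. -/
theorem abs_log_le_of_eq_zero_or {x M : ℝ} (hM : 1 ≤ M) (h : x = 0 ∨ 1 ≤ x) (hx : x ≤ M) :
    |Real.log x| ≤ Real.log M := by
  rcases h with rfl | h
  · simp [Real.log_nonneg hM]
  · rw [abs_of_nonneg (Real.log_nonneg h)]
    exact Real.log_le_log (by linarith) hx

theorem IsTreeVector.eq_zero_or_one_le (h : IsTreeVector q j Ω t) (u : GWord m₁ m₂) :
    t u = 0 ∨ 1 ≤ t u := by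
  by_cases hu : u ∈ treeSet Ω j
  · exact Or.inr ((isTreeVector_iff.1 h).2.1 u hu).1
  · exact Or.inl (h.off_tree u hu)

theorem IsTreeVector.exists_le (h : IsTreeVector q j Ω t) (hm₂ : 2 ≤ m₂) (hq : 2 ≤ q) :
    ∃ M, 1 ≤ M ∧ ∀ u, t u ≤ M := by
  refine ⟨_, one_le_treeBound (m₁ := m₁) hm₂ hq, fun u => ?_⟩
  by_cases hu : u ∈ treeSet Ω j
  · exact ((isTreeVector_iff.1 h).2.1 u hu).2
  · rw [h.off_tree u hu]
    exact zero_le_one.trans (one_le_treeBound hm₂ hq)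

theorem colSum_eq_zero_or_one_le (h0 : ∀ u, 0 ≤ t u) (h : ∀ u, t u = 0 ∨ 1 ≤ t u)
    (w : List (Fin m₁ × Fin m₂)) (v : List (Fin m₂)) : colSum t w v = 0 ∨ 1 ≤ colSum t w v := by
  cases v with
  | nil => exact Or.inl rfl
  | cons c r =>
    by_cases hx : ∃ x, 1 ≤ t (w ++ [(x, c)], r)
    · obtain ⟨x, hx⟩ := hx
      exact Or.inr (hx.trans (Finset.single_le_sum (f := fun x => t (w ++ [(x, c)], r))
        (fun x _ => h0 _) (Finset.mem_univ x)))
    · push Not at hx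
      refine Or.inl (Finset.sum_eq_zero fun x _ => ?_)
      exact (h _).resolve_right (not_le.2 (hx x))

/-- Boundedness and measurability of a function of the positions along the chains. -/
def IsChainFunction (F : Symb m₁ m₂ → ℕ → ℝ) : Prop :=
  (∀ l, Measurable fun w => F w l) ∧ ∃ B, ∀ w l, |F w l| ≤ B

theorem IsTreeVector.isChainFunction_logT (h : IsTreeVector q j Ω t) (hm₂ : 2 ≤ m₂)
    (hm : m₂ ≤ m₁) (hq : 2 ≤ q) : IsChainFunction (logT j t) := by
  obtain ⟨M, hM, hle⟩ := h.exists_le hm₂ hq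
  exact ⟨fun l => measurable_gPrefix hm₂ hm (l + 1) j fun u => Real.log (t u), Real.log M,
    fun w l => abs_log_le_of_eq_zero_or hM (h.eq_zero_or_one_le _) (hle _)⟩

theorem IsTreeVector.isChainFunction_logC (h : IsTreeVector q j Ω t) (hm₂ : 2 ≤ m₂)
    (hm : m₂ ≤ m₁) (hq : 2 ≤ q) : IsChainFunction (logC j t) := by
  obtain ⟨M, hM, hle⟩ := h.exists_le hm₂ hq
  have h1 : (1 : ℝ) ≤ m₁ := by exact_mod_cast (by omega : 1 ≤ m₁)
  exact ⟨fun l => measurable_gPrefix hm₂ hm l (j + 1) fun u => Real.log (colSum t u.1 u.2),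
    Real.log (m₁ * M), fun w l => abs_log_le_of_eq_zero_or (one_le_mul_of_one_le_of_one_le h1 hM)
      (colSum_eq_zero_or_one_le h.nonneg h.eq_zero_or_one_le _ _)
      (colSum_le (zero_le_one.trans hM) hle _ _)⟩

theorem isChainFunction_logS (hm₂ : 2 ≤ m₂) (hm : m₂ ≤ m₁) (q j : ℕ) (t : GWord m₁ m₂ → ℝ)
    (p : ℕ) : IsChainFunction (logS q j t p) := by
  obtain ⟨B, hB⟩ := exists_abs_gPrefix_le 0 (j - p) (fun u : GWord m₁ m₂ =>
    Real.log (nestSum q j t p u.2))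
  refine ⟨fun l => ?_, |B|, fun w l => ?_⟩
  · cases l with
    | zero => exact measurable_gPrefix hm₂ hm 0 (j - p) fun u => Real.log (nestSum q j t p u.2)
    | succ l => simp [logS]
  · cases l with
    | zero => exact (hB w).trans (le_abs_self B)
    | succ l => simp [logS]

theorem IsChainFunction.alongChains {F : Symb m₁ m₂ → ℕ → ℝ} (hF : IsChainFunction F) (q : ℕ)
    (z : Symb m₁ m₂) : ∃ B, ∀ m, |alongChains q F z m| ≤ B := by
  obtain ⟨-, B, hB⟩ := hF
  exact ⟨B, fun m => hB _ _⟩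

/-- The limit ratio `1 / (γ q ^ r)` of `L(n) / q ^ r` to `n`. -/
noncomputable def ratio (m₁ m₂ q r : ℕ) : ℝ := 1 / (gam m₁ m₂ * (q : ℝ) ^ r)

theorem ratio_pos (hm₂ : 2 ≤ m₂) (hm : m₂ ≤ m₁) (hq : 2 ≤ q) (r : ℕ) : 0 < ratio m₁ m₂ q r := by
  have := gam_pos hm₂ hm
  have : (0 : ℝ) < q := by exact_mod_cast (by omega : 0 < q)
  rw [ratio]
  positivity

theorem abs_bigL_div_sub_le (hm₂ : 2 ≤ m₂) (hm : m₂ ≤ m₁) (hq : 2 ≤ q) (r n : ℕ) :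
    |((bigL m₁ m₂ n / q ^ r : ℕ) : ℝ) - ratio m₁ m₂ q r * n| ≤ 1 := by
  have hγ := gam_pos hm₂ hm
  have hq1 : (1 : ℝ) ≤ (q : ℝ) ^ r := one_le_pow₀ (by exact_mod_cast (by omega : 1 ≤ q))
  have hq0 : (0 : ℝ) < (q : ℝ) ^ r := by linarith
  have h1 : ((bigL m₁ m₂ n / q ^ r : ℕ) : ℝ) ≤ bigL m₁ m₂ n / (q : ℝ) ^ r := by
    exact_mod_cast (Nat.cast_div_le (α := ℝ) (m := bigL m₁ m₂ n) (n := q ^ r))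
  have h2 : (bigL m₁ m₂ n : ℝ) / (q : ℝ) ^ r < (bigL m₁ m₂ n / q ^ r : ℕ) + 1 := by
    rw [div_lt_iff₀ hq0]
    have hqr : 0 < q ^ r := pow_pos (by omega) r
    exact_mod_cast (Nat.lt_mul_of_div_lt (Nat.lt_succ_self _) hqr).trans_eq
      (by rw [Nat.succ_eq_add_one])
  have h3 : (bigL m₁ m₂ n : ℝ) < n / gam m₁ m₂ + 1 :=
    Nat.ceil_lt_add_one (div_nonneg (Nat.cast_nonneg n) hγ.le)
  have h4 : (n : ℝ) / gam m₁ m₂ ≤ bigL m₁ m₂ n := Nat.le_ceil _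
  have e : ratio m₁ m₂ q r * n = n / gam m₁ m₂ / (q : ℝ) ^ r := by
    rw [ratio, div_div, one_div_mul_eq_div]
  have h5 := div_le_div_of_nonneg_right h4 hq0.le
  have h6 := div_le_div_of_nonneg_right h3.le hq0.le
  have h7 : 1 / (q : ℝ) ^ r ≤ 1 := (div_le_one hq0).2 hq1
  rw [add_div] at h6
  rw [e, abs_le]
  constructor <;> linarith

/-- The difference between two rescaled sums of `h`. -/
noncomputable def sumDiff (m₁ m₂ q r : ℕ) (h : ℕ → ℝ) (n : ℕ) : ℝ :=
  sumTo h (bigL m₁ m₂ n / q ^ r) / ratio m₁ m₂ q r - sumTo h n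

theorem logSumBounded_sumDiff (hm₂ : 2 ≤ m₂) (hm : m₂ ≤ m₁) (hq : 2 ≤ q) (r : ℕ) {h : ℕ → ℝ}
    (hB : ∃ B, ∀ m, |h m| ≤ B) : LogSumBounded (sumDiff m₁ m₂ q r h) := by
  obtain ⟨B, hB⟩ := hB
  exact logSumBounded_sumTo_comp hB (ratio_pos hm₂ hm hq r)
    fun n => abs_bigL_div_sub_le hm₂ hm hq r n

/-- Once the averages converge, both rescaled sums have the same limit after division by `n`. -/
theorem tendsto_sumDiff (hm₂ : 2 ≤ m₂) (hm : m₂ ≤ m₁) (hq : 2 ≤ q) (r : ℕ) {h : ℕ → ℝ}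
    (hc : ∃ c, Tendsto (fun n => sumTo h n / n) atTop (𝓝 c)) :
    Tendsto (fun n => sumDiff m₁ m₂ q r h n / n) atTop (𝓝 0) := by
  obtain ⟨c, hc⟩ := hc
  have hr := ratio_pos hm₂ hm hq r
  have h1 := tendsto_sumTo_comp hr (fun n => abs_bigL_div_sub_le hm₂ hm hq r n) hc
  have h2 := (h1.div_const (ratio m₁ m₂ q r)).sub hc
  rw [mul_div_cancel_right₀ _ hr.ne', sub_self] at h2
  refine h2.congr fun n => ?_
  rw [sumDiff, sub_div, div_right_comm]

/-- The fluctuating part of the logarithm of the mass of a ball. -/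
noncomputable def errTerm (q j : ℕ) (t : GWord m₁ m₂ → ℝ) (z : Symb m₁ m₂) (n : ℕ) : ℝ :=
  ∑ p ∈ Finset.range j, (ratio m₁ m₂ q (j - p) *
      sumDiff m₁ m₂ q (j - p - 1) (alongChains q (logS q j t p) z) n +
    -ratio m₁ m₂ q (j - p) * sumDiff m₁ m₂ q (j - p) (alongChains q (logS q j t p) z) n)
  + (-1 * sumDiff m₁ m₂ q (j + 1) (alongChains q (logT j t) z) n
    + sumDiff m₁ m₂ q j (alongChains q (logC j t) z) n)

/-- The coefficients match because `q^(j+1) γ` and `q^j γ` are the inverses of the ratios for `j+1`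
and `j`. For the nested sums, consecutive ratios differ by the factor `1/q`, so the unscaled sums up
to `n` cancel. -/
theorem errTerm_eq (hm₂ : 2 ≤ m₂) (hm : m₂ ≤ m₁) (hq : 2 ≤ q) (t : GWord m₁ m₂ → ℝ)
    (z : Symb m₁ m₂) (n : ℕ) :
    errTerm q j t z n = ∑ p ∈ Finset.range j,
        (1 / (q : ℝ) * sumTo (alongChains q (logS q j t p) z) (bigL m₁ m₂ n / q ^ (j - p - 1))
          - sumTo (alongChains q (logS q j t p) z) (bigL m₁ m₂ n / q ^ (j - p)))
      + sumTo (alongChains q (logT j t) z) n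
      - q * expA m₁ m₂ q j * sumTo (alongChains q (logT j t) z) (bigL m₁ m₂ n / q ^ (j + 1))
      + expA m₁ m₂ q j * sumTo (alongChains q (logC j t) z) (bigL m₁ m₂ n / q ^ j)
      - sumTo (alongChains q (logC j t) z) n := by
  have hγ := (gam_pos hm₂ hm).ne'
  have hq0 : (q : ℝ) ≠ 0 := by exact_mod_cast (by omega : q ≠ 0)
  have e : ∀ p ∈ Finset.range j, ratio m₁ m₂ q (j - p) *
      sumDiff m₁ m₂ q (j - p - 1) (alongChains q (logS q j t p) z) n +
      -ratio m₁ m₂ q (j - p) * sumDiff m₁ m₂ q (j - p) (alongChains q (logS q j t p) z) n =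
      1 / (q : ℝ) * sumTo (alongChains q (logS q j t p) z) (bigL m₁ m₂ n / q ^ (j - p - 1))
          - sumTo (alongChains q (logS q j t p) z) (bigL m₁ m₂ n / q ^ (j - p)) := by
    intro p hp
    rw [Finset.mem_range] at hp
    have hr := (ratio_pos hm₂ hm hq (j - p)).ne'
    have e1 : ratio m₁ m₂ q (j - p) = 1 / q * ratio m₁ m₂ q (j - p - 1) := by
      obtain ⟨r, hr⟩ : ∃ r, j - p = r + 1 := ⟨j - p - 1, by omega⟩
      rw [hr, Nat.add_sub_cancel, ratio, ratio, pow_succ]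
      field_simp
    have hr1 := (ratio_pos hm₂ hm hq (j - p - 1)).ne'
    have e2 : ratio m₁ m₂ q (j - p) / ratio m₁ m₂ q (j - p - 1) = 1 / q := by
      rw [e1, mul_div_assoc, div_self hr1, mul_one]
    have e3 : ratio m₁ m₂ q (j - p) / ratio m₁ m₂ q (j - p) = 1 := div_self hr
    simp only [sumDiff]
    linear_combination (sumTo (alongChains q (logS q j t p) z) (bigL m₁ m₂ n / q ^ (j - p - 1))) * e2
      - (sumTo (alongChains q (logS q j t p) z) (bigL m₁ m₂ n / q ^ (j - p))) * e3
  have e4 : ∀ x, x / ratio m₁ m₂ q (j + 1) = q * expA m₁ m₂ q j * x := fun x => by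
    rw [ratio, expA]; field_simp; ring
  have e5 : ∀ x, x / ratio m₁ m₂ q j = expA m₁ m₂ q j * x := fun x => by
    rw [ratio, expA]; field_simp
  rw [errTerm, Finset.sum_congr rfl e, sumDiff, sumDiff, e4, e5]
  ring

theorem IsTreeVector.logSumBounded_errTerm (h : IsTreeVector q j Ω t) (hm₂ : 2 ≤ m₂)
    (hm : m₂ ≤ m₁) (hq : 2 ≤ q) (z : Symb m₁ m₂) : LogSumBounded (errTerm q j t z) := by
  refine (LogSumBounded.sum _ fun p _ => ?_).add
    (((logSumBounded_sumDiff hm₂ hm hq _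
      ((h.isChainFunction_logT hm₂ hm hq).alongChains q z)).const_mul _).add
    (logSumBounded_sumDiff hm₂ hm hq _ ((h.isChainFunction_logC hm₂ hm hq).alongChains q z)))
  exact ((logSumBounded_sumDiff hm₂ hm hq _
      ((isChainFunction_logS hm₂ hm q j t p).alongChains q z)).const_mul _).add
    ((logSumBounded_sumDiff hm₂ hm hq _
      ((isChainFunction_logS hm₂ hm q j t p).alongChains q z)).const_mul _)

theorem IsTreeVector.ae_tendsto_errTerm (h : IsTreeVector q j Ω t) (hm₂ : 2 ≤ m₂)
    (hm : m₂ ≤ m₁) (hq : 2 ≤ q) (μ : Measure (Symb m₁ m₂)) [IsProbabilityMeasure μ] :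
    ∀ᵐ z ∂(multMeasure q μ), Tendsto (fun n => errTerm q j t z n / n) atTop (𝓝 0) := by
  have key : ∀ {F : Symb m₁ m₂ → ℕ → ℝ}, IsChainFunction F → ∀ᵐ z ∂(multMeasure q μ), ∃ c,
      Tendsto (fun n : ℕ => sumTo (alongChains q F z) n / n) atTop (𝓝 c) :=
    fun hF => ae_tendsto_alongChains hm₂ hm hq hF.1 hF.2.choose_spec
  filter_upwards [key (h.isChainFunction_logT hm₂ hm hq), key (h.isChainFunction_logC hm₂ hm hq),
    ae_all_iff.2 fun p => key (isChainFunction_logS hm₂ hm q j t p)] with z hT hC hS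
  have h1 := tendsto_finsetSum (Finset.range j) fun p _ =>
    ((tendsto_sumDiff hm₂ hm hq (j - p - 1) (hS p)).const_mul (ratio m₁ m₂ q (j - p))).add
    ((tendsto_sumDiff hm₂ hm hq (j - p) (hS p)).const_mul (-ratio m₁ m₂ q (j - p)))
  have h2 := ((tendsto_sumDiff hm₂ hm hq (j + 1) hT).const_mul (-1)).add
    (tendsto_sumDiff hm₂ hm hq j hC)
  have h3 := h1.add h2
  simp only [mul_zero, add_zero, Finset.sum_const_zero] at h3
  refine h3.congr fun n => ?_
  simp only [errTerm, add_div, Finset.sum_div, mul_div_assoc]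

/-- The asymptotic number of chains. -/
theorem tendsto_card_chainHeads (hm₂ : 2 ≤ m₂) (hm : m₂ ≤ m₁) (hq : 2 ≤ q) :
    Tendsto (fun n : ℕ => ((chainHeads q (bigL m₁ m₂ n)).card : ℝ) / n) atTop
      (𝓝 (((q : ℝ) - 1) / q * (1 / gam m₁ m₂))) := by
  have hq0 : (0 : ℝ) < q := by exact_mod_cast (by omega : 0 < q)
  have hsum : ∀ N : ℕ, sumTo (fun _ => (1 : ℝ)) N = N := fun N => by simp [sumTo]
  have h1 : Tendsto (fun n : ℕ => ((bigL m₁ m₂ n / q ^ 0 : ℕ) : ℝ) / n) atTop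
      (𝓝 (ratio m₁ m₂ q 0)) :=
    tendsto_div_of_abs_sub_le fun n => abs_bigL_div_sub_le hm₂ hm hq 0 n
  have h2 : Tendsto (fun n : ℕ => ((bigL m₁ m₂ n / q ^ 1 : ℕ) : ℝ) / n) atTop
      (𝓝 (ratio m₁ m₂ q 1)) :=
    tendsto_div_of_abs_sub_le fun n => abs_bigL_div_sub_le hm₂ hm hq 1 n
  have h3 := h1.sub h2
  have e : ratio m₁ m₂ q 0 - ratio m₁ m₂ q 1 = ((q : ℝ) - 1) / q * (1 / gam m₁ m₂) := by
    have := (gam_pos hm₂ hm).ne'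
    rw [ratio, ratio]
    field_simp
  rw [e] at h3
  refine h3.congr fun n => ?_
  have h4 := sum_chainHeads hq (fun _ => (1 : ℝ)) (bigL m₁ m₂ n)
  rw [hsum, hsum, Finset.sum_const, nsmul_eq_mul, mul_one] at h4
  rw [h4, pow_zero, pow_one, Nat.div_one, sub_div]

/-- The dimension `((q - 1) / q) log_{m₂} t_∅`. -/
noncomputable def dimValue (q j : ℕ) (t : GWord m₁ m₂ → ℝ) : ℝ :=
  ((q : ℝ) - 1) / q * Real.logb m₂ (tRoot q j t)

theorem tendsto_log_tRoot_mul_card (hm₂ : 2 ≤ m₂) (hm : m₂ ≤ m₁) (hq : 2 ≤ q)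
    (t : GWord m₁ m₂ → ℝ) :
    Tendsto (fun n : ℕ =>
      Real.log (tRoot q j t) * ((chainHeads q (bigL m₁ m₂ n)).card : ℝ) / n) atTop
      (𝓝 (dimValue q j t * Real.log m₁)) := by
  have h := (tendsto_card_chainHeads hm₂ hm hq).const_mul (Real.log (tRoot q j t))
  have e : Real.log (tRoot q j t) * (((q : ℝ) - 1) / q * (1 / gam m₁ m₂)) =
      dimValue q j t * Real.log m₁ := by
    have h1 := (log_pos_of_two_le hm₂).ne'
    have h2 := (log_pos_of_two_le (hm₂.trans hm)).ne'
    rw [dimValue, Real.logb, gam]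
    field_simp
  rw [e] at h
  exact h.congr fun n => by rw [mul_div_assoc]

theorem IsTreeVector.dimValue_nonneg (h : IsTreeVector q j Ω t) (hm₂ : 2 ≤ m₂) (hq : 2 ≤ q)
    (hne : Ω.Nonempty) : 0 ≤ dimValue q j t := by
  have hq' : (2 : ℝ) ≤ q := by exact_mod_cast hq
  have h2 : (1 : ℝ) < m₂ := by exact_mod_cast hm₂
  exact mul_nonneg (div_nonneg (by linarith) (by linarith))
    (Real.logb_nonneg h2 (h.one_le_tRoot hne))

theorem frequently_le_of_errTerm (hm₂ : 2 ≤ m₂) (hm : m₂ ≤ m₁) (hq : 2 ≤ q) {u e : ℕ → ℝ}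
    (hu : ∀ n, u n = -(Real.log (tRoot q j t) * (chainHeads q (bigL m₁ m₂ n)).card) + e n)
    (he : LogSumBounded e) {ε : ℝ} (hε : 0 < ε) :
    ∃ᶠ n : ℕ in atTop, -((dimValue q j t + ε) * n * Real.log m₁) ≤ u n := by
  have hl := log_pos_of_two_le (hm₂.trans hm)
  have hδ : 0 < ε * Real.log m₁ / 2 := by positivity
  have h1 := (tendsto_log_tRoot_mul_card (j := j) hm₂ hm hq t).eventually_lt_const
    (show _ < dimValue q j t * Real.log m₁ + ε * Real.log m₁ / 2 by linarith)
  refine ((he.frequently_ge hδ).and_eventually (h1.and (eventually_gt_atTop 0))).mono ?_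
  rintro n ⟨h2, h3, h4⟩
  have hn : (0 : ℝ) < n := by exact_mod_cast h4
  rw [div_lt_iff₀ hn] at h3
  rw [hu n]
  linarith

theorem eventually_le_of_errTerm (hm₂ : 2 ≤ m₂) (hm : m₂ ≤ m₁) (hq : 2 ≤ q) {u e : ℕ → ℝ}
    (hu : ∀ n, u n = -(Real.log (tRoot q j t) * (chainHeads q (bigL m₁ m₂ n)).card) + e n)
    (he : Tendsto (fun n => e n / n) atTop (𝓝 0)) {ε : ℝ} (hε : 0 < ε) :
    ∀ᶠ n : ℕ in atTop, u n ≤ -((dimValue q j t - ε) * n * Real.log m₁) := by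
  have hl := log_pos_of_two_le (hm₂.trans hm)
  have hδ : 0 < ε * Real.log m₁ / 2 := by positivity
  filter_upwards [(tendsto_log_tRoot_mul_card (j := j) hm₂ hm hq t).eventually_const_lt
    (show dimValue q j t * Real.log m₁ - ε * Real.log m₁ / 2 < _ by linarith),
    he.eventually_lt_const hδ, eventually_gt_atTop 0] with n h1 h2 h3
  have hn : (0 : ℝ) < n := by exact_mod_cast h3
  rw [lt_div_iff₀ hn] at h1
  rw [div_lt_iff₀ hn] at h2
  rw [hu n]
  linarith

theorem ofReal_rpow_le_iff (hm₂ : 2 ≤ m₂) (hm : m₂ ≤ m₁) {x : ENNReal} (hx : 0 < x.toReal)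
    (s : ℝ) : ENNReal.ofReal ((m₁ : ℝ) ^ (-s)) ≤ x ↔ -(s * Real.log m₁) ≤ Real.log x.toReal := by
  have h0 : (0 : ℝ) < m₁ := by exact_mod_cast (by omega : 0 < m₁)
  have hxt : x ≠ ⊤ := fun h => by simp [h] at hx
  rw [ENNReal.ofReal_le_iff_le_toReal hxt, ← Real.log_le_log_iff (Real.rpow_pos_of_pos h0 _) hx,
    Real.log_rpow h0, neg_mul]

theorem le_ofReal_rpow_iff (hm₂ : 2 ≤ m₂) (hm : m₂ ≤ m₁) {x : ENNReal} (hx : 0 < x.toReal)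
    (s : ℝ) : x ≤ ENNReal.ofReal ((m₁ : ℝ) ^ (-s)) ↔ Real.log x.toReal ≤ -(s * Real.log m₁) := by
  have h0 : (0 : ℝ) < m₁ := by exact_mod_cast (by omega : 0 < m₁)
  have hxt : x ≠ ⊤ := fun h => by simp [h] at hx
  rw [ENNReal.le_ofReal_iff_toReal_le hxt (Real.rpow_nonneg h0.le _),
    ← Real.log_le_log_iff hx (Real.rpow_pos_of_pos h0 _), Real.log_rpow h0, neg_mul]

theorem localRate_eq {P : Measure (Symb m₁ m₂)} {z : Symb m₁ m₂} {n : ℕ}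
    (hx : 0 < (P (quasiBall n z)).toReal) :
    localRate P z n = ((-Real.log (P (quasiBall n z)).toReal /
      (Real.log m₂ * bigL m₁ m₂ n) : ℝ) : EReal) := by
  have h0 : P (quasiBall n z) ≠ 0 := fun h => by simp [h] at hx
  have hxt : P (quasiBall n z) ≠ ⊤ := fun h => by simp [h] at hx
  rw [localRate, ENNReal.log_pos_real h0 hxt, EReal.coe_div, EReal.coe_neg]

/-- The ceiling works in the right direction: `n log m₁ ≤ L(n) log m₂`, and `s ≥ 0`. -/
theorem localRate_le (hm₂ : 2 ≤ m₂) (hm : m₂ ≤ m₁) {P : Measure (Symb m₁ m₂)} {z : Symb m₁ m₂}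
    {n : ℕ} (hn : 0 < n) (hx : 0 < (P (quasiBall n z)).toReal) {s : ℝ} (hs : 0 ≤ s)
    (h : -(s * n * Real.log m₁) ≤ Real.log (P (quasiBall n z)).toReal) :
    localRate P z n ≤ (s : EReal) := by
  have hn' : (0 : ℝ) < n := by exact_mod_cast hn
  have hL : (n : ℝ) / gam m₁ m₂ ≤ bigL m₁ m₂ n := Nat.le_ceil _
  have hl := log_pos_of_two_le hm₂
  have hγ := gam_pos hm₂ hm
  have hLpos : (0 : ℝ) < bigL m₁ m₂ n := lt_of_lt_of_le (by positivity) hL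
  rw [localRate_eq hx, EReal.coe_le_coe_iff, div_le_iff₀ (by positivity)]
  have h1 : (n : ℝ) * Real.log m₁ ≤ Real.log m₂ * bigL m₁ m₂ n := by
    rw [div_le_iff₀ hγ] at hL
    have h2 := log_pos_of_two_le (hm₂.trans hm)
    rw [← gam_mul_log hm₂ hm]
    calc (n : ℝ) * Real.log m₁ ≤ bigL m₁ m₂ n * gam m₁ m₂ * Real.log m₁ :=
          mul_le_mul_of_nonneg_right hL h2.le
      _ = _ := by ring
  have h2 := mul_le_mul_of_nonneg_left h1 hs
  linarith

theorem liminf_localRate_le (hm₂ : 2 ≤ m₂) (hm : m₂ ≤ m₁) {P : Measure (Symb m₁ m₂)}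
    {z : Symb m₁ m₂} (hx : ∀ n, 0 < (P (quasiBall n z)).toReal) {D : ℝ} (hD : 0 ≤ D)
    (h : ∀ ε > 0, ∃ᶠ n : ℕ in atTop,
      -((D + ε) * n * Real.log m₁) ≤ Real.log (P (quasiBall n z)).toReal) :
    liminf (localRate P z) atTop ≤ (D : EReal) := by
  rw [← EReal.le_of_forall_lt_iff_le]
  intro s hs
  have hs' : D < s := EReal.coe_lt_coe_iff.1 hs
  refine liminf_le_of_frequently_le ?_
  refine ((h (s - D) (sub_pos.2 hs')).and_eventually (eventually_gt_atTop 0)).mono ?_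
  rintro n ⟨h1, h2⟩
  rw [add_sub_cancel] at h1
  exact localRate_le hm₂ hm h2 (hx n) (hD.trans hs'.le) h1

theorem dimH_eq_of_log_bounds (hm₂ : 2 ≤ m₂) (hm : m₂ ≤ m₁) (P : Measure (Symb m₁ m₂))
    [IsProbabilityMeasure P] {X : Set (Symb m₁ m₂)} (hPX : P Xᶜ = 0)
    (hx : ∀ z ∈ X, ∀ n, 0 < (P (quasiBall n z)).toReal) {D : ℝ} (hD : 0 ≤ D)
    (h : ∀ z ∈ X, ∀ ε > 0, ∃ᶠ n : ℕ in atTop,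
      -((D + ε) * n * Real.log m₁) ≤ Real.log (P (quasiBall n z)).toReal)
    (h' : ∀ᵐ z ∂P, ∀ ε > 0, ∀ᶠ n : ℕ in atTop,
      Real.log (P (quasiBall n z)).toReal ≤ -((D - ε) * n * Real.log m₁)) :
    dimH X = ENNReal.ofReal D := by
  refine le_antisymm (ENNReal.le_of_forall_pos_le_add fun ε hε _ => ?_)
    (ENNReal.le_of_forall_pos_le_add fun ε hε _ => ?_)
  · have hε' : (0 : ℝ) < ε := hε
    have e : ENNReal.ofReal D + ε = ENNReal.ofReal (D + ε) := by
      rw [ENNReal.ofReal_add hD hε'.le, ENNReal.ofReal_coe_nnreal]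
    rw [e]
    refine dimH_le_of_frequently_le hm₂ hm P (by positivity) fun z hz => ?_
    exact (h z hz ε hε').mono fun n hn => (ofReal_rpow_le_iff hm₂ hm (hx z hz n) _).2 hn
  · have hε' : (0 : ℝ) < ε := hε
    -- The mass distribution principle requires a positive exponent; for `D ≤ ε` there is nothing to
    -- prove.
    rcases le_or_gt D ε with hDε | hDε
    · refine le_add_left ?_
      rw [← ENNReal.ofReal_coe_nnreal]
      exact ENNReal.ofReal_le_ofReal hDε
    · have e : ENNReal.ofReal D = ENNReal.ofReal (D - ε) + ε := by
        rw [← ENNReal.ofReal_coe_nnreal (p := ε), ← ENNReal.ofReal_add (by linarith) hε'.le,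
          sub_add_cancel]
      rw [e]
      refine add_le_add_left (le_dimH_of_ae_eventually_le hm₂ hm P hPX (sub_pos.2 hDε) ?_) _
      filter_upwards [h', mem_ae_iff.2 hPX] with z hz hzX
      exact (hz ε hε').mono fun n hn => (le_ofReal_rpow_iff hm₂ hm (hx z hzX n) _).2 hn

end MultCarpet

/-! ### Assembly of the theorem. -/

open MultCarpet

theorem mainTheorem5 (m₁ m₂ q j : ℕ) (hm₂ : 2 ≤ m₂) (hm : m₂ ≤ m₁) (hq : 2 ≤ q)
    (hj : (q : ℝ) ^ j ≤ 1 / gam m₁ m₂) (hj' : 1 / gam m₁ m₂ < (q : ℝ) ^ (j + 1))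
    (Ω : Set (Symb m₁ m₂)) (hΩ : IsClosed Ω) (hne : Ω.Nonempty) :
    ∃ t : GWord m₁ m₂ → ℝ, IsTreeVector q j Ω t ∧ (∀ t', IsTreeVector q j Ω t' → t' = t) ∧
    ∃ μ : Measure (Symb m₁ m₂), IsOptMeasure q j Ω t μ ∧
      (∀ μ', IsOptMeasure q j Ω t μ' → μ' = μ) ∧
    ∃ P : Measure (Symb m₁ m₂), IsMultMeasure q μ P ∧ (∀ P', IsMultMeasure q μ P' → P' = P) ∧
      P (multSet q Ω)ᶜ = 0 ∧
      (∀ z ∈ multSet q Ω, liminf (localRate P z) atTop ≤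
        ((((q : ℝ) - 1) / q * Real.logb m₂ (tRoot q j t) : ℝ) : EReal)) ∧
      dimH (multSet q Ω) =
        ENNReal.ofReal (((q : ℝ) - 1) / q * Real.logb m₂ (tRoot q j t)) := by
  obtain ⟨t, ht⟩ := exists_isTreeVector hm₂ hm hq j Ω
  obtain ⟨μ, hprob, hμ⟩ := ht.exists_measure hm₂ hm hq hne
  have hopt := ht.isOptMeasure hm₂ hm hΩ hμ
  have hP := isProbabilityMeasure_multMeasure hm₂ hm q μ
  have hmult := isMultMeasure_multMeasure hm₂ hm hq μ
  have hPX := multMeasure_compl_multSet hm₂ hm hq hΩ.measurableSet hopt.supp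
  have hD : 0 ≤ dimValue q j t := ht.dimValue_nonneg hm₂ hq hne
  have hball : ∀ z ∈ multSet q Ω, ∀ n, 0 < (multMeasure q μ (quasiBall n z)).toReal ∧
      Real.log (multMeasure q μ (quasiBall n z)).toReal =
        -(Real.log (tRoot q j t) * (chainHeads q (bigL m₁ m₂ n)).card) + errTerm q j t z n := by
    intro z hz n
    obtain ⟨h1, h2⟩ := ht.log_multMeasure_quasiBall hm₂ hm hq hj hj' hμ hz n
    refine ⟨h1, ?_⟩
    rw [h2, errTerm_eq hm₂ hm hq]
    ring
  have hfreq : ∀ z ∈ multSet q Ω, ∀ ε > 0, ∃ᶠ n : ℕ in atTop,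
      -((dimValue q j t + ε) * n * Real.log m₁) ≤
        Real.log (multMeasure q μ (quasiBall n z)).toReal := fun z hz ε hε =>
    frequently_le_of_errTerm hm₂ hm hq (fun n => (hball z hz n).2)
      (ht.logSumBounded_errTerm hm₂ hm hq z) hε
  refine ⟨t, ht, fun t' ht' => ht.unique hm₂ hm hq ht', μ, hopt,
    fun μ' h' => hopt.unique hm₂ hm h', multMeasure q μ, hmult,
    fun P' h' => hmult.unique hm₂ hm h', hPX, fun z hz => ?_, ?_⟩
  · exact liminf_localRate_le hm₂ hm (fun n => (hball z hz n).1) hD (hfreq z hz)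
  · refine dimH_eq_of_log_bounds hm₂ hm (multMeasure q μ) hPX (fun z hz n => (hball z hz n).1)
      hD hfreq ?_
    filter_upwards [ht.ae_tendsto_errTerm hm₂ hm hq μ, mem_ae_iff.2 hPX] with z hz hzX ε hε
    exact eventually_le_of_errTerm hm₂ hm hq (fun n => (hball z hzX n).2) hz hε
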